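/- **Setting.** Consider $x_{t+1}=Ax_t+Bu_t$, $y_t=Cx_t$ with $A\in\mathbb R^{n\times n}$, $B\in\mathbb R^{n\times m}$, $C\in\mathbb R^{p\times n}$, $\rho(A)\ge 1$, and suppose that some $K\in\mathbb R^{m\times p}$ satisfies $\rho(A-BKC)<1$. The initial state $x_0\sim\mathcal D$ has mean zero, covariance $I_n$ and $\|x_0\|\le d$ almost surely, $d>0$. Let $\ell_0I\preceq Q,R\preceq\ell_1I$ with $0<\ell_0\le\ell_1$, and $\|B\|\le\psi$, $\|C\|\le\varphi$ with $\psi,\varphi\ge1$ (spectral norms). For $\gamma\in(0,1]$ let $\mathcal S_\gamma=\{K:\sqrt\gamma\,\rho(A-BKC)<1\}$ and $J_\gamma(K)=\mathbb E\sum_{t\ge0}\gamma^t(x_t^\top Qx_t+u_t^\top Ru_t)$ with $u_t=-Ky_t$. Let $J^{\tau}_{\gamma,x_0}(K)=\sum_{t<\tau}(x_t^\top Qx_t+u_t^\top Ru_t)$ along $x_{t+1}=\sqrt\gamma(A-BKC)x_t$, $u_t=-KCx_t$, and $\widehat J^{\tau,N}_\gamma(K)=\frac1N\sum_{i=1}^NJ^\tau_{\gamma,x_0^i}(K)$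 with independent $x_0^i\sim\mathcal D$. For $\nu>0$ put $\kappa=\sqrt{\nu/\ell_0}$, $D=1/(8\kappa^3\psi\varphi)$, $G=16\kappa^9\ell_1\psi\varphi$, $L=104\kappa^{10}\ell_1\psi^2\varphi^2\sqrt{\min\{m,p\}}$, $G^0=2\kappa^3\varphi(\ell_1+\psi\nu)\sqrt{\min\{m,p\}}$, $\eta=\min\{D/(G^0+\epsilon),1/(2L)\}$ and $M=9\nu/(\eta\epsilon^2)$; a subscript $k$ means that $\nu=\nu_k$. **Algorithm.** Fix $\epsilon>0$, $\zeta\in(0,1)$, $N\in\mathbb N$ and $0<\gamma_0<1/\rho(A)^2$; put $K_0=0$, $\nu_0=J_{\gamma_0}(0)$. For $k=0,1,\dots$: set $K^0=K_k$, and while $\|\widehat\nabla J_{\gamma_k}(K^j)\|_F>2\epsilon/3$ set $K^{j+1}=K^j-\eta_k\widehat\nabla J_{\gamma_k}(K^j)$. When this loop stops set $K_{k+1}=K^j$, $\widehat J_k=\widehat J^{\tau_k,N}_{\gamma_k}(K_{k+1})$, $\alpha_k=\ell_0/(2\widehat J_k-\ell_0)$ and $\gamma_{k+1}=(1+\zeta\alpha_k)\gamma_k$.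 If $\gamma_{k+1}\ge1$ return $K_{k+1}$; otherwise continue with $\nu_{k+1}=8\widehat J_k^{\,3}/((1-\zeta)\ell_0^2)$. The gradient estimate is $$\widehat\nabla J_{\gamma_k}(K)=\frac{mp}{2r_kN^e_k}\sum_{i=1}^{N^e_k}\Big(J^{\tau^e_k}_{\gamma_k,x_0^i}(K+r_kU_i)-J^{\tau^e_k}_{\gamma_k,x_0^i}(K-r_kU_i)\Big)U_i,$$ where $U_i=\overline U_i/\|\overline U_i\|_F$, $\overline U_i$ has i.i.d. $\mathcal N(0,1)$ entries and $x_0^i\sim\mathcal D$. All samples, for all $k$, $j$ and $i$, are independent. **Theorem.** Let $0<\delta_0<e^{-2}/2$ and $0<\delta_1<1$. Let $N\ge8d^4\log\frac2{\delta_1}$, and let $\tau_k,\tau^e_k,N^e_k\in\mathbb N$ and $r_k>0$ be chosen at the start of iteration $k$ as measurable functions of $(K_k,\gamma_k,\nu_k)$ such that, whenever $\nu_k>0$, $$\tau_k\ge\frac{2\nu_k}{\ell_0}\log\frac{\nu_kd^2}{\ell_0},\quad \tau_k^e\ge\frac{2\nu_k}{\ell_0}\log\frac{36d^2\nu_k^2mp}{r_k\epsilon\ell_0},\quad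 N_k^e\ge\frac{81(mpG_k)^2(d^2+1)^2}{\epsilon^2}\log\frac{15}{\delta_0},\quad r_k\le\min\Big\{D_k,\frac{\nu_k}{G_k},\frac{\epsilon}{9L_k}\Big\}.$$ Let $\overline J$ satisfy $J_\gamma(K)\le\overline J$ for all $\gamma\in(0,1]$ and $K\in\mathcal S_\gamma$ with $\|\nabla J_\gamma(K)\|_F\le\epsilon$, and let $$k'=\left\lceil\frac{\log(1/\gamma_0)}{\log\big(1+\zeta\ell_0/(3\overline J-\ell_0)\big)}\right\rceil.$$ Call the run successful if within its first $k'$ outer iterations the algorithm returns a gain $K$ with $\rho(A-BKC)<1$. Let $\Sigma=\sum_k(M_k+1)$, the sum being over the outer iterations $k\in\{0,\dots,k'\}$ that are executed; this is a random variable, since $\nu_k$ is. Then the run is successful with probability at least $1-k'\delta_1-\Sigma\,\delta_0$ in each of the following senses: (a) $\mathbb P(\text{success})\ge1-k'\delta_1-\mathbb E[\Sigma]\,\delta_0$; (b) for every $S\in[0,\infty]$, $\mathbb P(\text{no success and }\Sigma\le S)\le k'\delta_1+S\,\delta_0$; (c) $\mathbb P(\text{success})\ge1-k'\big(\delta_1+(\overline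 M+1)\delta_0\big)$, where $\overline M$ is the value of $M$ at $\nu=\max\{J_{\gamma_0}(0),\,27\overline J^{\,3}/((1-\zeta)\ell_0^2)\}$. -/

import Mathlib

open MeasureTheory ProbabilityTheory
open scoped ENNReal Matrix Matrix.Norms.L2Operator

namespace DiscountedSOF

/-- The matrices of the linear system `x (t+1) = A x t + B u t`, `y t = C x t`
and of the stage cost `xᵀ Q x + uᵀ R u`. -/
structure Plant (n m p : ℕ) where
  A : Matrix (Fin n) (Fin n) ℝ
  B : Matrix (Fin n) (Fin m) ℝ
  C : Matrix (Fin p) (Fin n) ℝ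
  Q : Matrix (Fin n) (Fin n) ℝ
  R : Matrix (Fin m) (Fin m) ℝ

/-- Spectral radius of a real square matrix: the largest modulus of a complex eigenvalue. -/
noncomputable def specRad {n : ℕ} (M : Matrix (Fin n) (Fin n) ℝ) : ℝ :=
  (spectralRadius ℂ (M.map (algebraMap ℝ ℂ))).toReal

/-- Frobenius norm. (The notation `‖M‖` for a matrix is the spectral norm in this file.) -/
noncomputable def frob {m p : ℕ} (M : Matrix (Fin m) (Fin p) ℝ) : ℝ :=
  √(∑ i, ∑ j, M i j ^ 2)

/-- The initial state has mean zero, identity covariance, and norm at most `d`. -/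
structure IsInitialLaw {n : ℕ} (𝒟 : Measure (Fin n → ℝ)) (d : ℝ) : Prop where
  mean_zero : ∀ i, ∫ x, x i ∂𝒟 = 0
  cov_id : ∀ i j, ∫ x, x i * x j ∂𝒟 = if i = j then 1 else 0
  bounded : ∀ᵐ x ∂𝒟, ‖(WithLp.toLp 2 x : EuclideanSpace ℝ (Fin n))‖ ≤ d

namespace Plant

variable {n m p : ℕ}

/-- The closed-loop matrix `A - B K C`. -/
def closedLoop (P : Plant n m p) (K : Matrix (Fin m) (Fin p) ℝ) : Matrix (Fin n) (Fin n) ℝ :=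
  P.A - P.B * K * P.C

/-- The static output feedback `u = -K y` with `y = C x`. -/
def input (P : Plant n m p) (K : Matrix (Fin m) (Fin p) ℝ) (x : Fin n → ℝ) : Fin m → ℝ :=
  -(K *ᵥ (P.C *ᵥ x))

/-- The stage cost `xᵀ Q x + uᵀ R u` under `u = -K C x`. -/
def stageCost (P : Plant n m p) (K : Matrix (Fin m) (Fin p) ℝ) (x : Fin n → ℝ) : ℝ :=
  x ⬝ᵥ (P.Q *ᵥ x) + P.input K x ⬝ᵥ (P.R *ᵥ P.input K x)

/-- The state of the original (undamped) closed-loop system started at `x₀`. -/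
def traj (P : Plant n m p) (K : Matrix (Fin m) (Fin p) ℝ) (x₀ : Fin n → ℝ) : ℕ → Fin n → ℝ
  | 0 => x₀
  | t + 1 => P.A *ᵥ P.traj K x₀ t + P.B *ᵥ P.input K (P.traj K x₀ t)

/-- The state of the damped closed-loop system `x (t+1) = √γ (A - B K C) x t`. -/
noncomputable def dampedTraj (P : Plant n m p) (γ : ℝ) (K : Matrix (Fin m) (Fin p) ℝ)
    (x₀ : Fin n → ℝ) : ℕ → Fin n → ℝ
  | 0 => x₀
  | t + 1 => √γ • (P.closedLoop K *ᵥ P.dampedTraj γ K x₀ t)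

/-- The discounted cost `J_γ(K) = 𝔼 ∑ γ ^ t (x_tᵀ Q x_t + u_tᵀ R u_t)`, as an extended
nonnegative number. -/
noncomputable def extCost (P : Plant n m p) (𝒟 : Measure (Fin n → ℝ)) (γ : ℝ)
    (K : Matrix (Fin m) (Fin p) ℝ) : ℝ≥0∞ :=
  ∫⁻ x₀, ∑' t : ℕ, ENNReal.ofReal (γ ^ t * P.stageCost K (P.traj K x₀ t)) ∂𝒟

/-- The discounted cost as a real number (used where it is finite). -/
noncomputable def cost (P : Plant n m p) (𝒟 : Measure (Fin n → ℝ)) (γ : ℝ)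
    (K : Matrix (Fin m) (Fin p) ℝ) : ℝ :=
  (P.extCost 𝒟 γ K).toReal

/-- The set `𝒮_γ` of gains that stabilize the damped system. -/
def stabSet (P : Plant n m p) (γ : ℝ) : Set (Matrix (Fin m) (Fin p) ℝ) :=
  {K | √γ * specRad (P.closedLoop K) < 1}

/-- The gradient of `J_γ` at `K`, for the Frobenius inner product; its Euclidean norm is the
Frobenius norm of the gradient matrix. -/
noncomputable def costGrad (P : Plant n m p) (𝒟 : Measure (Fin n → ℝ)) (γ : ℝ)
    (K : Matrix (Fin m) (Fin p) ℝ) : EuclideanSpace ℝ (Fin m × Fin p) :=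
  gradient
    (fun v : EuclideanSpace ℝ (Fin m × Fin p) =>
      P.cost 𝒟 γ (Matrix.of fun i j => v (i, j)))
    (WithLp.toLp 2 fun ij => K ij.1 ij.2)

/-- The cost of one rollout of the damped system, truncated to the first `τ` steps. -/
noncomputable def truncCost (P : Plant n m p) (γ : ℝ) (τ : ℕ) (K : Matrix (Fin m) (Fin p) ℝ)
    (x₀ : Fin n → ℝ) : ℝ :=
  ∑ t ∈ Finset.range τ, P.stageCost K (P.dampedTraj γ K x₀ t)

/-- Two-point gradient estimate from the samples `w i = (Gaussian matrix, initial state)`,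
`i < N`; the directions are the normalized Gaussian matrices. -/
noncomputable def gradEst (P : Plant n m p) (γ : ℝ) (K : Matrix (Fin m) (Fin p) ℝ) (r : ℝ)
    (τ N : ℕ) (w : ℕ → (Fin m → Fin p → ℝ) × (Fin n → ℝ)) : Matrix (Fin m) (Fin p) ℝ :=
  let U : ℕ → Matrix (Fin m) (Fin p) ℝ := fun i =>
    (frob (Matrix.of (w i).1))⁻¹ • Matrix.of (w i).1
  ((m * p : ℝ) / (2 * r * N)) •
    ∑ i ∈ Finset.range N,
      (P.truncCost γ τ (K + r • U i) (w i).2 - P.truncCost γ τ (K - r • U i) (w i).2) • U i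

/-- Empirical cost estimate from the initial states `z i`, `i < N`. -/
noncomputable def costEst (P : Plant n m p) (γ : ℝ) (τ N : ℕ) (K : Matrix (Fin m) (Fin p) ℝ)
    (z : ℕ → Fin n → ℝ) : ℝ :=
  (1 / (N : ℝ)) * ∑ i ∈ Finset.range N, P.truncCost γ τ K (z i)

end Plant

/-- Known bounds `ℓ₀ I ≤ Q, R ≤ ℓ₁ I`, `‖B‖ ≤ ψ`, `‖C‖ ≤ φ`. -/
structure Bounds where
  ℓ₀ : ℝ
  ℓ₁ : ℝ
  ψ : ℝ
  φ : ℝ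

/-- The bounds are valid for the plant. -/
structure Bounds.Valid {n m p : ℕ} (b : Bounds) (P : Plant n m p) : Prop where
  pos : 0 < b.ℓ₀
  le : b.ℓ₀ ≤ b.ℓ₁
  one_le_psi : 1 ≤ b.ψ
  one_le_phi : 1 ≤ b.φ
  Q_lower : (P.Q - b.ℓ₀ • (1 : Matrix (Fin n) (Fin n) ℝ)).PosSemidef
  Q_upper : (b.ℓ₁ • (1 : Matrix (Fin n) (Fin n) ℝ) - P.Q).PosSemidef
  R_lower : (P.R - b.ℓ₀ • (1 : Matrix (Fin m) (Fin m) ℝ)).PosSemidef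
  R_upper : (b.ℓ₁ • (1 : Matrix (Fin m) (Fin m) ℝ) - P.R).PosSemidef
  B_le : ‖P.B‖ ≤ b.ψ
  C_le : ‖P.C‖ ≤ b.φ

namespace Bounds

/-- `κ = √(ν / ℓ₀)`. -/
noncomputable def kappa (b : Bounds) (ν : ℝ) : ℝ := √(ν / b.ℓ₀)

/-- Radius `D` of the local Lipschitz and smoothness estimates at level `ν`. -/
noncomputable def rad (b : Bounds) (ν : ℝ) : ℝ := 1 / (8 * b.kappa ν ^ 3 * b.ψ * b.φ)

/-- Local Lipschitz constant `G` at level `ν`. -/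
noncomputable def lip (b : Bounds) (ν : ℝ) : ℝ := 16 * b.kappa ν ^ 9 * b.ℓ₁ * b.ψ * b.φ

/-- Local smoothness constant `L` at level `ν`, for gains of size `m × p`. -/
noncomputable def smooth (b : Bounds) (m p : ℕ) (ν : ℝ) : ℝ :=
  104 * b.kappa ν ^ 10 * b.ℓ₁ * b.ψ ^ 2 * b.φ ^ 2 * √(min m p : ℕ)

/-- Gradient bound `G⁰` at level `ν`, for gains of size `m × p`. -/
noncomputable def gradBound (b : Bounds) (m p : ℕ) (ν : ℝ) : ℝ :=
  2 * b.kappa ν ^ 3 * b.φ * (b.ℓ₁ + b.ψ * ν) * √(min m p : ℕ)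

/-- The stepsize `η = min {D / (G⁰ + ε), 1 / (2 L)}` at level `ν`. -/
noncomputable def step (b : Bounds) (m p : ℕ) (ε ν : ℝ) : ℝ :=
  min (b.rad ν / (b.gradBound m p ν + ε)) (1 / (2 * b.smooth m p ν))

/-- The iteration bound `M = 9 ν / (η ε²)` at level `ν`. -/
noncomputable def iterBound (b : Bounds) (m p : ℕ) (ε ν : ℝ) : ℝ :=
  9 * ν / (b.step m p ε ν * ε ^ 2)

end Bounds

/-- What is known at the start of an outer iteration: the gain `K_k`, the discount factor `γ_k`
and the level `ν_k`. -/
abbrev State (m p : ℕ) : Type := (Fin m → Fin p → ℝ) × ℝ × ℝ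

/-- Inputs of the algorithm. The rollout lengths `τ_k`, `τᵉ_k`, the number `Nᵉ_k` of trajectories
and the smoothing constant `r_k` are chosen at the start of iteration `k`, as functions of the
state of the algorithm at that time. -/
structure Config (m p : ℕ) where
  γ₀ : ℝ
  ε : ℝ
  ζ : ℝ
  N : ℕ
  τ : ℕ → State m p → ℕ
  τe : ℕ → State m p → ℕ
  Ne : ℕ → State m p → ℕ
  r : ℕ → State m p → ℝ

/-- The parameters depend measurably on the state and satisfy the required inequalities at
every level `ν > 0`. -/
structure Config.Admissible {m p : ℕ} (c : Config m p) (b : Bounds) (d δ₀ δ₁ : ℝ) : Prop where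
  meas_τ : ∀ k, Measurable (c.τ k)
  meas_τe : ∀ k, Measurable (c.τe k)
  meas_Ne : ∀ k, Measurable (c.Ne k)
  meas_r : ∀ k, Measurable (c.r k)
  N_ge : 8 * d ^ 4 * Real.log (2 / δ₁) ≤ c.N
  τ_ge : ∀ k K γ ν, 0 < ν → 2 * ν / b.ℓ₀ * Real.log (ν * d ^ 2 / b.ℓ₀) ≤ c.τ k (K, γ, ν)
  τe_ge : ∀ k K γ ν, 0 < ν →
    2 * ν / b.ℓ₀ *
        Real.log (36 * d ^ 2 * ν ^ 2 * m * p / (c.r k (K, γ, ν) * c.ε * b.ℓ₀)) ≤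
      c.τe k (K, γ, ν)
  Ne_ge : ∀ k K γ ν, 0 < ν →
    81 * (m * p * b.lip ν) ^ 2 * (d ^ 2 + 1) ^ 2 / c.ε ^ 2 * Real.log (15 / δ₀) ≤
      c.Ne k (K, γ, ν)
  r_pos : ∀ k K γ ν, 0 < ν → 0 < c.r k (K, γ, ν)
  r_le : ∀ k K γ ν, 0 < ν →
    c.r k (K, γ, ν) ≤ min (b.rad ν) (min (ν / b.lip ν) (c.ε / (9 * b.smooth m p ν)))

/-- The random inputs of a run. The entry `(k, j, i)` of the first component is the `i`-th sample
(Gaussian matrix, initial state) of the gradient estimate at the `j`-th gradient step of outer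
iteration `k`; the entry `(k, i)` of the second component is the `i`-th initial state of the cost
estimate of outer iteration `k`. -/
abbrev Noise (n m p : ℕ) : Type :=
  (ℕ × ℕ × ℕ → (Fin m → Fin p → ℝ) × (Fin n → ℝ)) × (ℕ × ℕ → Fin n → ℝ)

/-- All samples are independent, the Gaussian matrices have independent standard normal entries,
and the initial states have law `𝒟`. -/
noncomputable def noiseLaw {n : ℕ} (m p : ℕ) (𝒟 : Measure (Fin n → ℝ)) [IsProbabilityMeasure 𝒟] :
    Measure (Noise n m p) :=
  (Measure.infinitePi fun _ : ℕ × ℕ × ℕ =>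
      (Measure.pi fun _ : Fin m => Measure.pi fun _ : Fin p => gaussianReal 0 1).prod 𝒟).prod
    (Measure.infinitePi fun _ : ℕ × ℕ => 𝒟)

section Algorithm

variable {n m p : ℕ} (P : Plant n m p) (𝒟 : Measure (Fin n → ℝ)) (b : Bounds) (c : Config m p)

/-- The gradient estimate at gain `K` in gradient step `j` of outer iteration `k` started in
state `s`. -/
noncomputable def stepGrad (ω : Noise n m p) (k : ℕ) (s : State m p) (j : ℕ)
    (K : Matrix (Fin m) (Fin p) ℝ) : Matrix (Fin m) (Fin p) ℝ :=
  P.gradEst s.2.1 K (c.r k s) (c.τe k s) (c.Ne k s) fun i => ω.1 (k, j, i)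

/-- The policy gradient iterates `K^j` of outer iteration `k` started in state `s`. -/
noncomputable def inner (ω : Noise n m p) (k : ℕ) (s : State m p) :
    ℕ → Matrix (Fin m) (Fin p) ℝ
  | 0 => Matrix.of s.1
  | j + 1 => inner ω k s j - b.step m p c.ε s.2.2 • stepGrad P c ω k s j (inner ω k s j)

/-- The stopping test of the inner loop holds at step `j`. -/
def StopsAt (ω : Noise n m p) (k : ℕ) (s : State m p) (j : ℕ) : Prop :=
  frob (stepGrad P c ω k s j (inner P b c ω k s j)) ≤ 2 * c.ε / 3

/-- The inner loop terminates. -/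
def InnerStops (ω : Noise n m p) (k : ℕ) (s : State m p) : Prop :=
  ∃ j, StopsAt P b c ω k s j

/-- The gain `K_{k+1}`: the inner iterate at the first step at which the stopping test holds. -/
noncomputable def nextGain (ω : Noise n m p) (k : ℕ) (s : State m p) :
    Matrix (Fin m) (Fin p) ℝ :=
  inner P b c ω k s (sInf {j | StopsAt P b c ω k s j})

/-- The empirical cost of `K_{k+1}` for the discount factor `γ_k`. -/
noncomputable def nextCostEst (ω : Noise n m p) (k : ℕ) (s : State m p) : ℝ :=
  P.costEst s.2.1 (c.τ k s) c.N (nextGain P b c ω k s) fun i => ω.2 (k, i)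

/-- `γ_{k+1} = (1 + ζ α_k) γ_k` with `α_k = ℓ₀ / (2 Ĵ - ℓ₀)`. -/
noncomputable def nextDiscount (ω : Noise n m p) (k : ℕ) (s : State m p) : ℝ :=
  (1 + c.ζ * (b.ℓ₀ / (2 * nextCostEst P b c ω k s - b.ℓ₀))) * s.2.1

/-- The state in which iteration `k + 1` starts, with `ν_{k+1} = 8 Ĵ³ / ((1 - ζ) ℓ₀²)`. -/
noncomputable def nextState (ω : Noise n m p) (k : ℕ) (s : State m p) : State m p :=
  (fun i j => nextGain P b c ω k s i j, nextDiscount P b c ω k s,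
    8 * nextCostEst P b c ω k s ^ 3 / ((1 - c.ζ) * b.ℓ₀ ^ 2))

open Classical in
/-- The state in which outer iteration `k` starts, or `none` if iteration `k` is not executed,
because the algorithm has returned before or an earlier inner loop did not terminate. -/
noncomputable def run (ω : Noise n m p) : ℕ → Option (State m p)
  | 0 => some (0, c.γ₀, P.cost 𝒟 c.γ₀ 0)
  | k + 1 =>
    match run ω k with
    | none => none
    | some s =>
      if InnerStops P b c ω k s ∧ nextDiscount P b c ω k s < 1 then
        some (nextState P b c ω k s)
      else none

/-- The algorithm returns the gain `K` in outer iteration `k`. -/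
def Returns (ω : Noise n m p) (k : ℕ) (K : Matrix (Fin m) (Fin p) ℝ) : Prop :=
  ∃ s, run P 𝒟 b c ω k = some s ∧ InnerStops P b c ω k s ∧
    1 ≤ nextDiscount P b c ω k s ∧ K = nextGain P b c ω k s

/-- The algorithm returns, within its first `k'` outer iterations, a gain `K` with
`ρ(A - B K C) < 1`. -/
def Succeeds (k' : ℕ) (ω : Noise n m p) : Prop :=
  ∃ k < k', ∃ K, Returns P 𝒟 b c ω k K ∧ specRad (P.closedLoop K) < 1

/-- The sum of `M_k + 1` over the executed outer iterations `k ∈ {0, …, k'}`. -/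
noncomputable def iterSum (k' : ℕ) (ω : Noise n m p) : ℝ≥0∞ :=
  ∑ k ∈ Finset.range (k' + 1),
    match run P 𝒟 b c ω k with
    | none => 0
    | some s => ENNReal.ofReal (b.iterBound m p c.ε s.2.2 + 1)

end Algorithm

/-- The number `k'` of outer iterations. -/
noncomputable def outerBound (γ₀ ζ ℓ₀ Jbar : ℝ) : ℕ :=
  ⌈Real.log (1 / γ₀) / Real.log (1 + ζ * ℓ₀ / (3 * Jbar - ℓ₀))⌉₊

end DiscountedSOF

/-! If the damped closed loop `A_K = √γ (A - B K C)` is stable, the cost of `K` is the trace of its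
value matrix `V`, the solution of `V = Q_K + A_Kᵀ V A_K` with `Q_K ⪰ ℓ₀ I` the stage-cost matrix.
The bound `tr V ≤ ν` controls everything else. Since `V` is a Lyapunov function, `∑ ‖A_K ^ t‖_F² ≤ ν
/ ℓ₀ = κ²`, and `V`, `K C`, `A_K` are bounded through `ν` and `κ`. The same `V` remains a Lyapunov
function for all gains within distance `rad` (`powSqBound_add`), and subtracting two Lyapunov
equations yields the local constants of the cost (`norm_valueMat_add_sub_le`,
`abs_trace_sub_costDeriv_le`, `abs_costDeriv_sub_le`).

The gradient estimate has three errors. Its bias is of order `L r`, by a Stein identity on the unit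
sphere obtained from rotation invariance. Its fluctuation obeys a dimension-free Hoeffding
inequality in Hilbert space. Its truncation error decays exponentially in the rollout length. The
total is at most `ε / 3` outside an event of probability `δ₀` (`measure_gradEst_sub_gt_le`). The
cost estimate is accurate relative to the cost outside an event of probability `δ₁`
(`measure_costEst_le`).

If all estimates are accurate, the run is controlled deterministically. Each gradient step that
fails the stopping test lowers the cost by at least `η ε² / 9 = ν / M`, so the test is met at some
step `j ≤ M`, at a gain with gradient at most `ε` and hence cost at most `Jbar`. There `V` is still
a Lyapunov function after the discount factor is multiplied by `1 + ζ α`, and the cost grows by at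
most the factor `1 / (1 - ζ)` (`Stable.mul_disc`). That multiplier is bounded below by a fixed
number above 1, so `k'` iterations bring the discount factor to 1. A failed run therefore contains
an inaccurate estimate (`exists_bad`).

The number of estimates is random, so the union bound is taken conditionally. The samples of an
estimate are independent of the gain at which it is formed, and can be replaced by fresh ones
(`measure_le_of_resample`). Thus the estimate `(k, j)` is bad with probability at most `δ₀ P(k
executed, j ≤ M_k)`, and summing over `j` gives `δ₀` times the expectation of `M_k + 1` on that
event. `measure_failure_le` does this inside events `G k` that are known at the start of iteration
`k`; three choices of `G` give the three claims. -/

namespace DiscountedSOF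

/-! ### Quadratic forms, Frobenius norms and Lyapunov series. -/

section MatrixAnalysis

variable {k l m n p : ℕ}

/-- Euclidean norm of a vector. -/
noncomputable def en (x : Fin n → ℝ) : ℝ := ‖(WithLp.toLp 2 x : EuclideanSpace ℝ (Fin n))‖

lemma en_nonneg (x : Fin n → ℝ) : 0 ≤ en x := norm_nonneg _

lemma en_sq (x : Fin n → ℝ) : en x ^ 2 = x ⬝ᵥ x := by
  rw [en, EuclideanSpace.norm_sq_eq]
  simp [dotProduct, sq]

lemma dot_le_en (x y : Fin n → ℝ) : |x ⬝ᵥ y| ≤ en x * en y := by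
  have h := abs_real_inner_le_norm (WithLp.toLp 2 x : EuclideanSpace ℝ (Fin n)) (WithLp.toLp 2 y)
  have e : Inner.inner ℝ (WithLp.toLp 2 x : EuclideanSpace ℝ (Fin n)) (WithLp.toLp 2 y) = x ⬝ᵥ y := by
    rw [EuclideanSpace.inner_toLp_toLp]
    simp [dotProduct_comm]
  rwa [e] at h

lemma en_mulVec_le (M : Matrix (Fin m) (Fin n) ℝ) (x : Fin n → ℝ) :
    en (M *ᵥ x) ≤ ‖M‖ * en x :=
  Matrix.l2_opNorm_mulVec M (WithLp.toLp 2 x)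

lemma opNorm_le_of_en (M : Matrix (Fin m) (Fin n) ℝ) {c : ℝ} (hc : 0 ≤ c)
    (h : ∀ x, en (M *ᵥ x) ≤ c * en x) : ‖M‖ ≤ c := by
  rw [Matrix.l2_opNorm_def]
  refine ContinuousLinearMap.opNorm_le_bound _ hc fun x => ?_
  exact h x.ofLp

lemma norm_transpose (M : Matrix (Fin m) (Fin n) ℝ) : ‖Mᵀ‖ = ‖M‖ := by
  rw [← Matrix.conjTranspose_eq_transpose_of_trivial, Matrix.l2_opNorm_conjTranspose]

lemma norm_mul_le_rect (M : Matrix (Fin k) (Fin m) ℝ) (N : Matrix (Fin m) (Fin n) ℝ) :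
    ‖M * N‖ ≤ ‖M‖ * ‖N‖ := Matrix.l2_opNorm_mul M N

/-- Quadratic form of a square matrix. -/
noncomputable def qf (M : Matrix (Fin n) (Fin n) ℝ) (x : Fin n → ℝ) : ℝ := x ⬝ᵥ (M *ᵥ x)

lemma abs_qf_le (M : Matrix (Fin n) (Fin n) ℝ) (x : Fin n → ℝ) : |qf M x| ≤ ‖M‖ * en x ^ 2 := by
  refine (dot_le_en _ _).trans ?_
  nlinarith [en_mulVec_le M x, en_nonneg x]

lemma qf_conj (M : Matrix (Fin m) (Fin m) ℝ) (A : Matrix (Fin m) (Fin n) ℝ) (x : Fin n → ℝ) :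
    qf (Aᵀ * M * A) x = qf M (A *ᵥ x) := by
  simp only [qf, ← Matrix.mulVec_mulVec, Matrix.dotProduct_mulVec, Matrix.vecMul_transpose]

lemma qf_add (M N : Matrix (Fin n) (Fin n) ℝ) (x : Fin n → ℝ) :
    qf (M + N) x = qf M x + qf N x := by simp [qf, Matrix.add_mulVec]

lemma qf_sub (M N : Matrix (Fin n) (Fin n) ℝ) (x : Fin n → ℝ) :
    qf (M - N) x = qf M x - qf N x := by simp [qf, Matrix.sub_mulVec]

lemma qf_smul (c : ℝ) (M : Matrix (Fin n) (Fin n) ℝ) (x : Fin n → ℝ) :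
    qf (c • M) x = c * qf M x := by simp [qf, Matrix.smul_mulVec]

lemma qf_one (x : Fin n → ℝ) : qf 1 x = en x ^ 2 := by simp [qf, en_sq]

lemma qf_smul_vec (c : ℝ) (M : Matrix (Fin n) (Fin n) ℝ) (x : Fin n → ℝ) :
    qf M (c • x) = c ^ 2 * qf M x := by
  simp [qf, Matrix.mulVec_smul]; ring

lemma qf_nonneg {M : Matrix (Fin n) (Fin n) ℝ} (h : M.PosSemidef) (x : Fin n → ℝ) :
    0 ≤ qf M x := by
  simpa [qf] using h.dotProduct_mulVec_nonneg x

lemma qf_single (M : Matrix (Fin n) (Fin n) ℝ) (i : Fin n) : qf M (Pi.single i 1) = M i i := by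
  simp [qf]

/-- Sum of the squares of the entries. -/
noncomputable def fsq (M : Matrix (Fin m) (Fin n) ℝ) : ℝ := ∑ i, ∑ j, M i j ^ 2

lemma fsq_nonneg (M : Matrix (Fin m) (Fin n) ℝ) : 0 ≤ fsq M :=
  Finset.sum_nonneg fun _ _ => Finset.sum_nonneg fun _ _ => sq_nonneg _

lemma fsq_eq_sum_en (M : Matrix (Fin m) (Fin n) ℝ) :
    fsq M = ∑ j, en (M *ᵥ Pi.single j 1) ^ 2 := by
  simp only [en_sq, Matrix.mulVec_single_one]
  rw [fsq, Finset.sum_comm]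
  simp [dotProduct, sq]

lemma norm_sq_le_fsq (M : Matrix (Fin m) (Fin n) ℝ) : ‖M‖ ^ 2 ≤ fsq M := by
  have h : ‖M‖ ≤ √(fsq M) := by
    refine opNorm_le_of_en M (Real.sqrt_nonneg _) fun x => ?_
    refine abs_le_of_sq_le_sq' ?_ (by positivity [en_nonneg x]) |>.2
    rw [mul_pow, Real.sq_sqrt (fsq_nonneg M), en_sq, en_sq, fsq, Finset.sum_mul]
    refine Finset.sum_le_sum fun i _ => ?_
    have := Finset.sum_mul_sq_le_sq_mul_sq Finset.univ (fun j => M i j) x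
    simpa [Matrix.mulVec, dotProduct, sq] using this
  calc ‖M‖ ^ 2 ≤ √(fsq M) ^ 2 := by gcongr
    _ = fsq M := Real.sq_sqrt (fsq_nonneg M)

lemma trace_conj (M : Matrix (Fin m) (Fin m) ℝ) (A : Matrix (Fin m) (Fin n) ℝ) :
    (Aᵀ * M * A).trace = ∑ j, qf M (A *ᵥ Pi.single j 1) := by
  rw [Matrix.trace]
  refine Finset.sum_congr rfl fun j _ => ?_
  rw [← qf_conj, qf_single, Matrix.diag_apply]

lemma abs_trace_conj_le (M : Matrix (Fin m) (Fin m) ℝ) (A : Matrix (Fin m) (Fin n) ℝ) :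
    |(Aᵀ * M * A).trace| ≤ ‖M‖ * fsq A := by
  rw [trace_conj, fsq_eq_sum_en, Finset.mul_sum]
  exact (Finset.abs_sum_le_sum_abs _ _).trans (Finset.sum_le_sum fun j _ => abs_qf_le _ _)

lemma norm_conj_le (M : Matrix (Fin m) (Fin m) ℝ) (A : Matrix (Fin m) (Fin n) ℝ) :
    ‖Aᵀ * M * A‖ ≤ ‖M‖ * fsq A := by
  calc ‖Aᵀ * M * A‖ ≤ ‖Aᵀ‖ * ‖M‖ * ‖A‖ :=
        (norm_mul_le_rect _ _).trans (by gcongr; exact norm_mul_le_rect _ _)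
    _ = ‖M‖ * ‖A‖ ^ 2 := by rw [norm_transpose]; ring
    _ ≤ _ := by gcongr; exact norm_sq_le_fsq A

open scoped MatrixOrder in
/-- A factorization of a positive semidefinite matrix. -/
lemma exists_factor {M : Matrix (Fin n) (Fin n) ℝ} (h : M.PosSemidef) :
    ∃ N : Matrix (Fin n) (Fin n) ℝ, M = Nᵀ * N := by
  obtain ⟨N, hN⟩ := CStarAlgebra.nonneg_iff_eq_star_mul_self.1 h.nonneg
  exact ⟨N, by simpa [Matrix.star_eq_conjTranspose] using hN⟩

/-- Writing `M = Nᵀ N` turns the form into `‖N x‖²`, so the hypothesis is a bound on `‖N‖²`. -/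
lemma norm_le_of_qf_le {M : Matrix (Fin n) (Fin n) ℝ} (h : M.PosSemidef) {c : ℝ} (hc : 0 ≤ c)
    (hM : ∀ x, qf M x ≤ c * en x ^ 2) : ‖M‖ ≤ c := by
  obtain ⟨N, rfl⟩ := exists_factor h
  have h1 : ‖N‖ ≤ √c := by
    refine opNorm_le_of_en N (Real.sqrt_nonneg _) fun x => ?_
    refine abs_le_of_sq_le_sq' ?_ (by positivity [en_nonneg x]) |>.2
    rw [mul_pow, Real.sq_sqrt hc]
    have := hM x
    rwa [← mul_one Nᵀ, qf_conj, qf_one] at this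
  calc ‖Nᵀ * N‖ ≤ ‖Nᵀ‖ * ‖N‖ := norm_mul_le_rect _ _
    _ = ‖N‖ ^ 2 := by rw [norm_transpose]; ring
    _ ≤ √c ^ 2 := by gcongr
    _ = c := Real.sq_sqrt hc

lemma qf_le_trace {M : Matrix (Fin n) (Fin n) ℝ} (h : M.PosSemidef) (x : Fin n → ℝ) :
    qf M x ≤ M.trace * en x ^ 2 := by
  obtain ⟨N, rfl⟩ := exists_factor h
  have e : (Nᵀ * N).trace = fsq N := by
    have := trace_conj (1 : Matrix (Fin n) (Fin n) ℝ) N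
    simpa only [qf_one, ← fsq_eq_sum_en, mul_one] using this
  have e2 : qf (Nᵀ * N) x = en (N *ᵥ x) ^ 2 := by rw [← mul_one Nᵀ, qf_conj, qf_one]
  rw [e, e2]
  calc en (N *ᵥ x) ^ 2 ≤ (‖N‖ * en x) ^ 2 := by
        gcongr
        · exact en_nonneg _
        · exact en_mulVec_le N x
    _ = ‖N‖ ^ 2 * en x ^ 2 := by ring
    _ ≤ _ := by gcongr; exact norm_sq_le_fsq N

lemma trace_le_of_qf_le {M N : Matrix (Fin n) (Fin n) ℝ} (h : ∀ x, qf M x ≤ qf N x) :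
    M.trace ≤ N.trace := by
  refine Finset.sum_le_sum fun i _ => ?_
  have := h (Pi.single i 1)
  rwa [qf_single, qf_single] at this

/-- The Frobenius norms of the powers of `A` are square summable, with sum at most `s`. -/
def PowSqBound (A : Matrix (Fin n) (Fin n) ℝ) (s : ℝ) : Prop :=
  ∀ N, ∑ t ∈ Finset.range N, fsq (A ^ t) ≤ s

/-- The solution `∑ₜ (Aᵀ)ᵗ X Aᵗ` of the Lyapunov equation `Y = X + Aᵀ Y A`. -/
noncomputable def lyap (A X : Matrix (Fin n) (Fin n) ℝ) : Matrix (Fin n) (Fin n) ℝ :=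
  ∑' t, (A ^ t)ᵀ * X * A ^ t

namespace PowSqBound

variable {A : Matrix (Fin n) (Fin n) ℝ} {s : ℝ}

lemma summable_fsq (h : PowSqBound A s) : Summable fun t => fsq (A ^ t) :=
  summable_of_sum_range_le (fun _ => fsq_nonneg _) h

lemma tsum_fsq_le (h : PowSqBound A s) : ∑' t, fsq (A ^ t) ≤ s :=
  h.summable_fsq.tsum_le_of_sum_range_le h

lemma summable (h : PowSqBound A s) (X : Matrix (Fin n) (Fin n) ℝ) :
    Summable fun t => (A ^ t)ᵀ * X * A ^ t :=
  Summable.of_norm_bounded (h.summable_fsq.mul_left ‖X‖) fun _ => norm_conj_le _ _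

lemma norm_lyap_le (h : PowSqBound A s) (X : Matrix (Fin n) (Fin n) ℝ) :
    ‖lyap A X‖ ≤ s * ‖X‖ := by
  calc ‖lyap A X‖ ≤ ∑' t, ‖X‖ * fsq (A ^ t) :=
        tsum_of_norm_bounded (h.summable_fsq.mul_left ‖X‖).hasSum fun _ => norm_conj_le _ _
    _ = ‖X‖ * ∑' t, fsq (A ^ t) := tsum_mul_left
    _ ≤ ‖X‖ * s := by gcongr; exact h.tsum_fsq_le
    _ = _ := mul_comm _ _

lemma hasSum_trace (h : PowSqBound A s) (X : Matrix (Fin n) (Fin n) ℝ) :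
    HasSum (fun t => ((A ^ t)ᵀ * X * A ^ t).trace) (lyap A X).trace :=
  (h.summable X).hasSum.map (Matrix.traceAddMonoidHom (Fin n) ℝ)
    (continuous_id.matrix_trace)

/-- No factor `n` is lost, because `|tr((A ^ t)ᵀ X A ^ t)| ≤ ‖X‖ ‖A ^ t‖_F²`. This is the reason for
measuring stability by Frobenius norms: one constant serves for both the norm and the trace. -/
lemma abs_trace_lyap_le (h : PowSqBound A s) (X : Matrix (Fin n) (Fin n) ℝ) :
    |(lyap A X).trace| ≤ s * ‖X‖ := by
  rw [← (h.hasSum_trace X).tsum_eq]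
  calc |∑' t, ((A ^ t)ᵀ * X * A ^ t).trace| ≤ ∑' t, ‖X‖ * fsq (A ^ t) :=
        tsum_of_norm_bounded (f := fun t => ((A ^ t)ᵀ * X * A ^ t).trace)
          (h.summable_fsq.mul_left ‖X‖).hasSum fun _ => abs_trace_conj_le _ _
    _ = ‖X‖ * ∑' t, fsq (A ^ t) := tsum_mul_left
    _ ≤ ‖X‖ * s := by gcongr; exact h.tsum_fsq_le
    _ = _ := mul_comm _ _

lemma hasSum_qf (h : PowSqBound A s) (X : Matrix (Fin n) (Fin n) ℝ) (x : Fin n → ℝ) :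
    HasSum (fun t => qf X (A ^ t *ᵥ x)) (qf (lyap A X) x) := by
  have h1 := (h.summable X).hasSum.map
    (AddMonoidHom.mk' (fun M : Matrix (Fin n) (Fin n) ℝ => qf M x) fun M N => qf_add M N x)
    (by
      change Continuous fun M : Matrix (Fin n) (Fin n) ℝ => x ⬝ᵥ (M *ᵥ x)
      exact continuous_const.dotProduct (continuous_id.matrix_mulVec continuous_const))
  simpa only [Function.comp_def, qf_conj, AddMonoidHom.mk'_apply, lyap] using h1

lemma lyap_eq (h : PowSqBound A s) (X : Matrix (Fin n) (Fin n) ℝ) :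
    lyap A X = X + Aᵀ * lyap A X * A := by
  have h0 : lyap A X = _ := (h.summable X).tsum_eq_zero_add
  conv_lhs => rw [h0]
  simp only [pow_zero, Matrix.transpose_one, one_mul, mul_one]
  congr 1
  rw [lyap, ← (h.summable X).tsum_mul_left Aᵀ, ← ((h.summable X).mul_left Aᵀ).tsum_mul_right A]
  refine tsum_congr fun t => ?_
  rw [pow_succ, Matrix.transpose_mul]
  noncomm_ring

lemma tendsto_fsq (h : PowSqBound A s) :
    Filter.Tendsto (fun t => fsq (A ^ t)) Filter.atTop (nhds 0) :=
  h.summable_fsq.tendsto_atTop_zero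

/-- The difference of two solutions satisfies `Z = Aᵀ Z A`, hence `Z = (A ^ t)ᵀ Z A ^ t` for every
`t`, and this tends to 0. -/
lemma lyap_unique (h : PowSqBound A s) {X Y : Matrix (Fin n) (Fin n) ℝ}
    (hY : Y = X + Aᵀ * Y * A) : Y = lyap A X := by
  set Z := Y - lyap A X with hZ
  have h1 : Z = Aᵀ * Z * A := by
    have := h.lyap_eq X
    calc Z = (X + Aᵀ * Y * A) - (X + Aᵀ * lyap A X * A) := by rw [← hY, ← this]
      _ = _ := by rw [hZ]; noncomm_ring
  have h2 : ∀ t, Z = (A ^ t)ᵀ * Z * A ^ t := by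
    intro t
    induction t with
    | zero => simp
    | succ t ih =>
      conv_lhs => rw [h1, ih]
      rw [pow_succ, Matrix.transpose_mul]
      noncomm_ring
  have h3 : ‖Z‖ ≤ 0 := by
    refine ge_of_tendsto' (b := ‖Z‖) (by simpa using h.tendsto_fsq.const_mul ‖Z‖) fun t => ?_
    conv_lhs => rw [h2 t]
    exact norm_conj_le _ _
  exact sub_eq_zero.1 (norm_le_zero_iff.1 h3)

lemma lyap_add (h : PowSqBound A s) (X Y : Matrix (Fin n) (Fin n) ℝ) :
    lyap A (X + Y) = lyap A X + lyap A Y := by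
  rw [lyap, lyap, lyap, ← (h.summable X).tsum_add (h.summable Y)]
  exact tsum_congr fun t => by noncomm_ring

lemma lyap_smul (h : PowSqBound A s) (c : ℝ) (X : Matrix (Fin n) (Fin n) ℝ) :
    lyap A (c • X) = c • lyap A X := by
  rw [lyap, lyap, ← (h.summable X).tsum_const_smul c]
  exact tsum_congr fun t => by simp

lemma lyap_sub (h : PowSqBound A s) (X Y : Matrix (Fin n) (Fin n) ℝ) :
    lyap A (X - Y) = lyap A X - lyap A Y := by
  rw [lyap, lyap, lyap, ← (h.summable X).tsum_sub (h.summable Y)]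
  exact tsum_congr fun t => by noncomm_ring

lemma posSemidef_lyap (h : PowSqBound A s) {X : Matrix (Fin n) (Fin n) ℝ} (hX : X.PosSemidef) :
    (lyap A X).PosSemidef := by
  refine Matrix.PosSemidef.of_dotProduct_mulVec_nonneg ?_ fun x => ?_
  · have h1 : (lyap A X)ᵀ = lyap A X := by
      have hX' : Xᵀ = X := by
        simpa only [Matrix.conjTranspose_eq_transpose_of_trivial] using hX.isHermitian.eq
      rw [lyap, Matrix.transpose_tsum]
      exact tsum_congr fun t => by simp [Matrix.transpose_mul, hX', mul_assoc]
    simpa [Matrix.IsHermitian] using h1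
  · have := (h.hasSum_qf X x).nonneg fun t => qf_nonneg hX _
    simpa [qf] using this

lemma qf_lyap_mulVec (h : PowSqBound A s) (X : Matrix (Fin n) (Fin n) ℝ) (x : Fin n → ℝ) :
    qf (lyap A X) (A *ᵥ x) = qf (lyap A X) x - qf X x := by
  have := congrArg (fun M => qf M x) (h.lyap_eq X)
  simp only [qf_add, qf_conj] at this
  linarith

/-- A strict Lyapunov inequality bounds the powers. -/
lemma of_lyapunov {P : Matrix (Fin n) (Fin n) ℝ} {c : ℝ} (hc : 0 < c)
    (hP : ∀ x, 0 ≤ qf P x) (h : ∀ x, qf P (A *ᵥ x) ≤ qf P x - c * en x ^ 2) :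
    PowSqBound A (P.trace / c) := by
  -- Telescoping along the trajectory of `x`. Taking `x` among the basis vectors and adding produces
  -- Frobenius norms on the left and the trace of `P` on the right.
  have h1 : ∀ x N, ∑ t ∈ Finset.range N, c * en (A ^ t *ᵥ x) ^ 2 + qf P (A ^ N *ᵥ x) ≤ qf P x := by
    intro x N
    induction N with
    | zero => simp
    | succ N ih =>
      have := h (A ^ N *ᵥ x)
      rw [Matrix.mulVec_mulVec, ← pow_succ'] at this
      rw [Finset.sum_range_succ]
      linarith
  intro N
  rw [le_div_iff₀ hc]
  calc (∑ t ∈ Finset.range N, fsq (A ^ t)) * c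
      = ∑ j, ∑ t ∈ Finset.range N, c * en (A ^ t *ᵥ Pi.single j 1) ^ 2 := by
        rw [Finset.sum_comm, Finset.sum_mul]
        refine Finset.sum_congr rfl fun t _ => ?_
        rw [fsq_eq_sum_en, mul_comm, Finset.mul_sum]
    _ ≤ ∑ j, qf P (Pi.single j 1) := by
        refine Finset.sum_le_sum fun j _ => ?_
        have := h1 (Pi.single j 1) N
        linarith [hP (A ^ N *ᵥ Pi.single j 1)]
    _ = P.trace := by simp [qf_single, Matrix.trace]

end PowSqBound

end MatrixAnalysis

end DiscountedSOF

/-! ### Perturbation of Lyapunov equations and the algebra of the policy gradient. -/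

namespace DiscountedSOF

section LyapunovPerturbation

variable {n : ℕ} {A : Matrix (Fin n) (Fin n) ℝ} {s : ℝ}

lemma PowSqBound.mono (h : PowSqBound A s) {s' : ℝ} (hs : s ≤ s') : PowSqBound A s' :=
  fun N => (h N).trans hs

/-- The difference of the two solutions itself solves a Lyapunov equation for `A'`. This exact
identity replaces any term-by-term comparison of the two series. -/
lemma lyap_sub_lyap {A' : Matrix (Fin n) (Fin n) ℝ} {s' : ℝ} (h : PowSqBound A s)
    (h' : PowSqBound A' s') (X X' : Matrix (Fin n) (Fin n) ℝ) :
    lyap A' X' - lyap A X =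
      lyap A' (X' - X + (A'ᵀ * lyap A X * A' - Aᵀ * lyap A X * A)) := by
  refine h'.lyap_unique ?_
  have h1 := h.lyap_eq X
  have h2 := h'.lyap_eq X'
  calc lyap A' X' - lyap A X
      = (X' + A'ᵀ * lyap A' X' * A') - (X + Aᵀ * lyap A X * A) := by rw [← h1, ← h2]
    _ = _ := by noncomm_ring

lemma norm_conj_sub_conj_le (Y T : Matrix (Fin n) (Fin n) ℝ) :
    ‖(A - T)ᵀ * Y * (A - T) - Aᵀ * Y * A‖ ≤ ‖Y‖ * (2 * ‖A‖ + ‖T‖) * ‖T‖ := by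
  have e : (A - T)ᵀ * Y * (A - T) - Aᵀ * Y * A = Tᵀ * Y * T - Tᵀ * Y * A - Aᵀ * Y * T := by
    rw [Matrix.transpose_sub]; noncomm_ring
  have h3 : ∀ U V : Matrix (Fin n) (Fin n) ℝ, ‖Uᵀ * Y * V‖ ≤ ‖U‖ * ‖Y‖ * ‖V‖ := fun U V =>
    calc ‖Uᵀ * Y * V‖ ≤ ‖Uᵀ‖ * ‖Y‖ * ‖V‖ :=
          (norm_mul_le_rect _ _).trans (by gcongr; exact norm_mul_le_rect _ _)
      _ = _ := by rw [norm_transpose]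
  rw [e]
  calc _ ≤ ‖Tᵀ * Y * T‖ + ‖Tᵀ * Y * A‖ + ‖Aᵀ * Y * T‖ :=
        (norm_sub_le _ _).trans (by gcongr; exact norm_sub_le _ _)
    _ ≤ ‖T‖ * ‖Y‖ * ‖T‖ + ‖T‖ * ‖Y‖ * ‖A‖ + ‖A‖ * ‖Y‖ * ‖T‖ := by gcongr <;> exact h3 _ _
    _ = _ := by ring

end LyapunovPerturbation

namespace Plant

variable {n m p : ℕ} (P : Plant n m p) (γ : ℝ) (K : Matrix (Fin m) (Fin p) ℝ)

/-- The damped closed-loop matrix `√γ (A - B K C)`. -/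
noncomputable def damped : Matrix (Fin n) (Fin n) ℝ := √γ • P.closedLoop K

/-- The matrix of the stage cost as a quadratic form in the state. -/
noncomputable def stageMat : Matrix (Fin n) (Fin n) ℝ :=
  P.Q + (K * P.C)ᵀ * P.R * (K * P.C)

/-- The value matrix: the cost of the damped system started at `x` is its quadratic form at `x`. -/
noncomputable def valueMat : Matrix (Fin n) (Fin n) ℝ := lyap (P.damped γ K) (P.stageMat K)

/-- The damped closed loop is stable. -/
def Stable : Prop := ∃ s, PowSqBound (P.damped γ K) s

/-- The damped input matrix. -/
noncomputable def dampedB : Matrix (Fin n) (Fin m) ℝ := √γ • P.B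

/-- The matrix `R K C - γ Bᵀ P_K (A - B K C)` of the policy gradient. -/
noncomputable def gradMat : Matrix (Fin m) (Fin n) ℝ :=
  P.R * (K * P.C) - (P.dampedB γ)ᵀ * P.valueMat γ K * P.damped γ K

/-- First-order change of the Lyapunov residual in the direction `H`. -/
noncomputable def residual (H : Matrix (Fin m) (Fin p) ℝ) : Matrix (Fin n) (Fin n) ℝ :=
  (H * P.C)ᵀ * P.gradMat γ K + (P.gradMat γ K)ᵀ * (H * P.C)

/-- The directional derivative of the cost. -/
noncomputable def costDeriv (H : Matrix (Fin m) (Fin p) ℝ) : ℝ :=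
  (lyap (P.damped γ K) (P.residual γ K H)).trace

variable {P γ K}

lemma damped_add (Δ : Matrix (Fin m) (Fin p) ℝ) :
    P.damped γ (K + Δ) = P.damped γ K - P.dampedB γ * (Δ * P.C) := by
  simp only [damped, dampedB, closedLoop, Matrix.mul_add, Matrix.add_mul, smul_sub, smul_add,
    Matrix.smul_mul, Matrix.mul_assoc]
  abel

lemma stageMat_add (hR : P.Rᵀ = P.R) (Δ : Matrix (Fin m) (Fin p) ℝ) :
    P.stageMat (K + Δ) - P.stageMat K = (Δ * P.C)ᵀ * (P.R * (K * P.C)) +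
      (P.R * (K * P.C))ᵀ * (Δ * P.C) + (Δ * P.C)ᵀ * P.R * (Δ * P.C) := by
  simp only [stageMat, Matrix.mul_add, Matrix.add_mul, Matrix.transpose_add, Matrix.transpose_mul,
    Matrix.mul_assoc, hR]
  abel

/-- The Lyapunov residual of `P_K` for the perturbed gain. -/
lemma residual_expansion (hR : P.Rᵀ = P.R) (hV : (P.valueMat γ K)ᵀ = P.valueMat γ K)
    (Δ : Matrix (Fin m) (Fin p) ℝ) :
    P.stageMat (K + Δ) - P.stageMat K +
      ((P.damped γ (K + Δ))ᵀ * P.valueMat γ K * P.damped γ (K + Δ) -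
        (P.damped γ K)ᵀ * P.valueMat γ K * P.damped γ K) =
      P.residual γ K Δ +
        (Δ * P.C)ᵀ * (P.R + (P.dampedB γ)ᵀ * P.valueMat γ K * P.dampedB γ) * (Δ * P.C) := by
  rw [stageMat_add hR, damped_add, residual, gradMat]
  generalize P.valueMat γ K = V at *
  generalize P.damped γ K = A
  generalize P.dampedB γ = B
  generalize Δ * P.C = D
  generalize K * P.C = F
  simp only [Matrix.mul_add, Matrix.add_mul, Matrix.mul_sub, Matrix.sub_mul, Matrix.transpose_sub,
    Matrix.transpose_mul, Matrix.mul_assoc, hR, hV,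
    Matrix.transpose_transpose]
  abel

lemma residual_add (H H' : Matrix (Fin m) (Fin p) ℝ) :
    P.residual γ K (H + H') = P.residual γ K H + P.residual γ K H' := by
  simp only [residual, Matrix.add_mul, Matrix.mul_add, Matrix.transpose_add]
  abel

lemma residual_smul (c : ℝ) (H : Matrix (Fin m) (Fin p) ℝ) :
    P.residual γ K (c • H) = c • P.residual γ K H := by
  simp [residual, Matrix.smul_mul, smul_add]

lemma Stable.costDeriv_add (h : P.Stable γ K) (H H' : Matrix (Fin m) (Fin p) ℝ) :
    P.costDeriv γ K (H + H') = P.costDeriv γ K H + P.costDeriv γ K H' := by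
  obtain ⟨s, hs⟩ := h
  rw [costDeriv, residual_add, hs.lyap_add, Matrix.trace_add]; rfl

lemma Stable.costDeriv_smul (h : P.Stable γ K) (c : ℝ) (H : Matrix (Fin m) (Fin p) ℝ) :
    P.costDeriv γ K (c • H) = c * P.costDeriv γ K H := by
  obtain ⟨s, hs⟩ := h
  rw [costDeriv, residual_smul, hs.lyap_smul, Matrix.trace_smul]; rfl

end Plant

namespace Bounds.Valid

variable {n m p : ℕ} {P : Plant n m p} {b : Bounds} (hb : b.Valid P)
include hb

lemma l1_pos : 0 < b.ℓ₁ := hb.pos.trans_le hb.le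

lemma posSemidef_Q : P.Q.PosSemidef := by
  have := hb.Q_lower.add (Matrix.PosSemidef.one.smul hb.pos.le)
  simpa using this

lemma posSemidef_R : P.R.PosSemidef := by
  have := hb.R_lower.add (Matrix.PosSemidef.one.smul hb.pos.le)
  simpa using this

lemma R_symm : P.Rᵀ = P.R := by
  simpa only [Matrix.conjTranspose_eq_transpose_of_trivial] using hb.posSemidef_R.isHermitian.eq

lemma qf_Q_ge (x : Fin n → ℝ) : b.ℓ₀ * en x ^ 2 ≤ qf P.Q x := by
  have := qf_nonneg hb.Q_lower x
  rw [qf_sub, qf_smul, qf_one] at this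
  linarith

lemma qf_R_ge (x : Fin m → ℝ) : b.ℓ₀ * en x ^ 2 ≤ qf P.R x := by
  have := qf_nonneg hb.R_lower x
  rw [qf_sub, qf_smul, qf_one] at this
  linarith

lemma norm_R_le : ‖P.R‖ ≤ b.ℓ₁ := by
  refine norm_le_of_qf_le hb.posSemidef_R hb.l1_pos.le fun x => ?_
  have := qf_nonneg hb.R_upper x
  rw [qf_sub, qf_smul, qf_one] at this
  linarith

lemma posSemidef_stageMat (K : Matrix (Fin m) (Fin p) ℝ) : (P.stageMat K).PosSemidef := by
  refine hb.posSemidef_Q.add ?_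
  simpa only [Matrix.conjTranspose_eq_transpose_of_trivial] using
    hb.posSemidef_R.conjTranspose_mul_mul_same (K * P.C)

lemma qf_stageMat_ge (K : Matrix (Fin m) (Fin p) ℝ) (x : Fin n → ℝ) :
    b.ℓ₀ * en x ^ 2 + b.ℓ₀ * en ((K * P.C) *ᵥ x) ^ 2 ≤ qf (P.stageMat K) x := by
  rw [Plant.stageMat, qf_add, qf_conj]
  exact add_le_add (hb.qf_Q_ge x) (hb.qf_R_ge _)

lemma qf_stageMat_ge' (K : Matrix (Fin m) (Fin p) ℝ) (x : Fin n → ℝ) :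
    b.ℓ₀ * en x ^ 2 ≤ qf (P.stageMat K) x := by
  have := hb.qf_stageMat_ge K x
  nlinarith [hb.pos, sq_nonneg (en ((K * P.C) *ᵥ x))]

lemma norm_mulC_le (Δ : Matrix (Fin m) (Fin p) ℝ) : ‖Δ * P.C‖ ≤ b.φ * ‖Δ‖ := by
  calc ‖Δ * P.C‖ ≤ ‖Δ‖ * ‖P.C‖ := norm_mul_le_rect _ _
    _ ≤ ‖Δ‖ * b.φ := by gcongr; exact hb.C_le
    _ = _ := mul_comm _ _

lemma norm_dampedB_le {γ : ℝ} (hγ : γ ≤ 1) : ‖P.dampedB γ‖ ≤ b.ψ := by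
  rw [Plant.dampedB, norm_smul, Real.norm_of_nonneg (Real.sqrt_nonneg _)]
  calc √γ * ‖P.B‖ ≤ 1 * b.ψ := by
        gcongr
        · exact Real.sqrt_le_one.2 hγ
        · exact hb.B_le
    _ = _ := one_mul _

end Bounds.Valid

end DiscountedSOF

/-! ### A priori bounds for gains of cost at most `ν`, and stability of nearby gains. -/

namespace DiscountedSOF

/-- The gain `K` stabilizes the system with damping `√γ`, and its cost is at most `ν`. -/
structure Plant.Level {n m p : ℕ} (P : Plant n m p) (b : Bounds) (γ : ℝ)
    (K : Matrix (Fin m) (Fin p) ℝ) (ν : ℝ) : Prop where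
  valid : b.Valid P
  disc_le : γ ≤ 1
  level_ge : b.ℓ₀ ≤ ν
  stable : P.Stable γ K
  trace_le : (P.valueMat γ K).trace ≤ ν

namespace Plant

variable {n m p : ℕ} {P : Plant n m p} {b : Bounds} {γ ν : ℝ} {K : Matrix (Fin m) (Fin p) ℝ}

lemma Stable.posSemidef_valueMat (h : P.Stable γ K) (hb : b.Valid P) :
    (P.valueMat γ K).PosSemidef := by
  obtain ⟨s, hs⟩ := h
  exact hs.posSemidef_lyap (hb.posSemidef_stageMat K)

lemma Stable.valueMat_symm (h : P.Stable γ K) (hb : b.Valid P) :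
    (P.valueMat γ K)ᵀ = P.valueMat γ K := by
  simpa only [Matrix.conjTranspose_eq_transpose_of_trivial] using
    (h.posSemidef_valueMat hb).isHermitian.eq

lemma Stable.qf_valueMat_damped (h : P.Stable γ K) (x : Fin n → ℝ) :
    qf (P.valueMat γ K) (P.damped γ K *ᵥ x) = qf (P.valueMat γ K) x - qf (P.stageMat K) x := by
  obtain ⟨s, hs⟩ := h
  exact hs.qf_lyap_mulVec _ x

lemma Stable.qf_stageMat_le (h : P.Stable γ K) (hb : b.Valid P) (x : Fin n → ℝ) :
    qf (P.stageMat K) x ≤ qf (P.valueMat γ K) x := by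
  have := qf_nonneg (h.posSemidef_valueMat hb) (P.damped γ K *ᵥ x)
  rw [h.qf_valueMat_damped] at this
  linarith

lemma Stable.qf_valueMat_ge (h : P.Stable γ K) (hb : b.Valid P) (x : Fin n → ℝ) :
    b.ℓ₀ * en x ^ 2 ≤ qf (P.valueMat γ K) x :=
  (hb.qf_stageMat_ge' K x).trans (h.qf_stageMat_le hb x)

lemma Stable.trace_valueMat_ge (h : P.Stable γ K) (hb : b.Valid P) :
    n * b.ℓ₀ ≤ (P.valueMat γ K).trace := by
  have : ∀ x, qf (b.ℓ₀ • (1 : Matrix (Fin n) (Fin n) ℝ)) x ≤ qf (P.valueMat γ K) x := fun x => by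
    rw [qf_smul, qf_one]; exact h.qf_valueMat_ge hb x
  have := trace_le_of_qf_le this
  simpa [mul_comm] using this

namespace Level

variable (h : P.Level b γ K ν)
include h

lemma level_pos : 0 < ν := h.valid.pos.trans_le h.level_ge

lemma kappa_sq : b.kappa ν ^ 2 * b.ℓ₀ = ν := by
  have := h.valid.pos
  have := h.level_pos
  rw [Bounds.kappa, Real.sq_sqrt (by positivity)]
  field_simp

lemma one_le_kappa : 1 ≤ b.kappa ν := by
  rw [Bounds.kappa, Real.one_le_sqrt, one_le_div h.valid.pos]
  exact h.level_ge

lemma qf_valueMat_le (x : Fin n → ℝ) : qf (P.valueMat γ K) x ≤ ν * en x ^ 2 :=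
  (qf_le_trace (h.stable.posSemidef_valueMat h.valid) x).trans
    (by gcongr; exact h.trace_le)

lemma norm_valueMat_le : ‖P.valueMat γ K‖ ≤ ν :=
  norm_le_of_qf_le (h.stable.posSemidef_valueMat h.valid) h.level_pos.le h.qf_valueMat_le

/-- The input cost alone is at most the value: `ℓ₀ ‖K C x‖² ≤ xᵀ V x ≤ ν ‖x‖²`. -/
lemma norm_mulC_le : ‖K * P.C‖ ≤ b.kappa ν := by
  have hκ := h.one_le_kappa
  refine opNorm_le_of_en _ (by linarith) fun x => ?_
  refine abs_le_of_sq_le_sq' ?_ (by positivity [en_nonneg x]) |>.2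
  have h1 := h.valid.qf_stageMat_ge K x
  have h2 := h.stable.qf_stageMat_le h.valid x
  have h3 := h.qf_valueMat_le x
  have h4 := h.valid.pos
  rw [← h.kappa_sq] at h3
  refine le_of_mul_le_mul_left ?_ h4
  nlinarith [sq_nonneg (en x)]

/-- The value after one step is at least `ℓ₀ ‖A_K x‖²` and at most the value `xᵀ V x ≤ ν ‖x‖²`
before it. -/
lemma norm_damped_le : ‖P.damped γ K‖ ≤ b.kappa ν := by
  have hκ := h.one_le_kappa
  refine opNorm_le_of_en _ (by linarith) fun x => ?_
  refine abs_le_of_sq_le_sq' ?_ (by positivity [en_nonneg x]) |>.2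
  have h1 := h.stable.qf_valueMat_ge h.valid (P.damped γ K *ᵥ x)
  rw [h.stable.qf_valueMat_damped] at h1
  have h2 := h.valid.qf_stageMat_ge' K x
  have h3 := h.qf_valueMat_le x
  have h4 := h.valid.pos
  rw [← h.kappa_sq] at h3
  refine le_of_mul_le_mul_left ?_ h4
  nlinarith [sq_nonneg (en x)]

/-- `V` is a Lyapunov function that drops by at least `ℓ₀ ‖x‖²` per step, so the constant is `tr V /
ℓ₀ ≤ κ²`. -/
lemma powSqBound : PowSqBound (P.damped γ K) (b.kappa ν ^ 2) := by
  have h4 := h.valid.pos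
  refine (PowSqBound.of_lyapunov (P := P.valueMat γ K) h4
    (qf_nonneg (h.stable.posSemidef_valueMat h.valid)) fun x => ?_).mono ?_
  · rw [h.stable.qf_valueMat_damped]
    linarith [h.valid.qf_stageMat_ge' K x]
  · rw [div_le_iff₀ h4, h.kappa_sq]
    exact h.trace_le

lemma norm_gradMat_le : ‖P.gradMat γ K‖ ≤ b.kappa ν * (b.ℓ₁ + b.ψ * ν) := by
  have hκ := h.one_le_kappa
  have hl := h.valid.l1_pos
  have hν := h.level_pos
  have hψ := h.valid.one_le_psi
  calc ‖P.gradMat γ K‖ ≤ ‖P.R‖ * ‖K * P.C‖ + ‖(P.dampedB γ)ᵀ‖ * ‖P.valueMat γ K‖ * ‖P.damped γ K‖ :=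
        (norm_sub_le _ _).trans (add_le_add (norm_mul_le_rect _ _)
          ((norm_mul_le_rect _ _).trans (by gcongr; exact norm_mul_le_rect _ _)))
    _ ≤ b.ℓ₁ * b.kappa ν + b.ψ * ν * b.kappa ν := by
        rw [norm_transpose]
        gcongr
        · exact h.valid.norm_R_le
        · exact h.norm_mulC_le
        · exact h.valid.norm_dampedB_le h.disc_le
        · exact h.norm_valueMat_le
        · exact h.norm_damped_le
    _ = _ := by ring

lemma level_le : ν ≤ b.kappa ν ^ 2 * b.ℓ₁ := by
  rw [← h.kappa_sq]
  have := h.valid.le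
  rw [h.kappa_sq]
  calc ν = b.kappa ν ^ 2 * b.ℓ₀ := h.kappa_sq.symm
    _ ≤ _ := by gcongr

lemma norm_gradMat_le' : ‖P.gradMat γ K‖ ≤ 2 * b.kappa ν ^ 3 * b.ℓ₁ * b.ψ := by
  have hκ := h.one_le_kappa
  have hl := h.valid.l1_pos
  have hψ := h.valid.one_le_psi
  calc _ ≤ b.kappa ν * (b.ℓ₁ + b.ψ * ν) := h.norm_gradMat_le
    _ ≤ b.kappa ν * (b.kappa ν ^ 2 * b.ℓ₁ * b.ψ + b.ψ * (b.kappa ν ^ 2 * b.ℓ₁)) := by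
        gcongr
        · calc b.ℓ₁ = 1 * b.ℓ₁ * 1 := by ring
            _ ≤ b.kappa ν ^ 2 * b.ℓ₁ * b.ψ := by gcongr; exact one_le_pow₀ hκ
        · exact h.level_le
    _ = _ := by ring

lemma norm_residual_le (H : Matrix (Fin m) (Fin p) ℝ) :
    ‖P.residual γ K H‖ ≤ 2 * b.φ * ‖P.gradMat γ K‖ * ‖H‖ := by
  calc ‖P.residual γ K H‖ ≤ ‖(H * P.C)ᵀ‖ * ‖P.gradMat γ K‖ + ‖(P.gradMat γ K)ᵀ‖ * ‖H * P.C‖ :=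
        (norm_add_le _ _).trans (add_le_add (norm_mul_le_rect _ _) (norm_mul_le_rect _ _))
    _ = 2 * ‖P.gradMat γ K‖ * ‖H * P.C‖ := by rw [norm_transpose, norm_transpose]; ring
    _ ≤ 2 * ‖P.gradMat γ K‖ * (b.φ * ‖H‖) := by gcongr; exact h.valid.norm_mulC_le H
    _ = _ := by ring

lemma abs_costDeriv_le (H : Matrix (Fin m) (Fin p) ℝ) :
    |P.costDeriv γ K H| ≤ 2 * b.kappa ν ^ 3 * b.φ * (b.ℓ₁ + b.ψ * ν) * ‖H‖ := by
  have hφ := h.valid.one_le_phi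
  calc _ ≤ b.kappa ν ^ 2 * ‖P.residual γ K H‖ := h.powSqBound.abs_trace_lyap_le _
    _ ≤ b.kappa ν ^ 2 * (2 * b.φ * (b.kappa ν * (b.ℓ₁ + b.ψ * ν)) * ‖H‖) := by
        gcongr
        refine (h.norm_residual_le H).trans ?_
        gcongr
        exact h.norm_gradMat_le
    _ = _ := by ring

section Perturbation

variable {Δ : Matrix (Fin m) (Fin p) ℝ} (hΔ : ‖Δ‖ ≤ b.rad ν)
include hΔ

omit hΔ in
lemma norm_perturb_le (Δ : Matrix (Fin m) (Fin p) ℝ) :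
    ‖P.dampedB γ * (Δ * P.C)‖ ≤ b.ψ * b.φ * ‖Δ‖ := by
  have hψ := h.valid.one_le_psi
  calc _ ≤ ‖P.dampedB γ‖ * ‖Δ * P.C‖ := norm_mul_le_rect _ _
    _ ≤ b.ψ * (b.φ * ‖Δ‖) := by
        gcongr
        · exact h.valid.norm_dampedB_le h.disc_le
        · exact h.valid.norm_mulC_le Δ
    _ = _ := by ring

lemma kappa_mul_norm_le : b.kappa ν ^ 3 * (b.ψ * b.φ * ‖Δ‖) ≤ 1 / 8 := by
  have hκ := h.one_le_kappa
  have hψ := h.valid.one_le_psi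
  have hφ := h.valid.one_le_phi
  rw [Bounds.rad, le_div_iff₀ (by positivity)] at hΔ
  linarith

lemma psi_phi_norm_le : b.ψ * b.φ * ‖Δ‖ ≤ 1 / 8 := by
  have hκ := h.one_le_kappa
  have hψ := h.valid.one_le_psi
  have hφ := h.valid.one_le_phi
  have h1 := h.kappa_mul_norm_le hΔ
  have h2 : 1 * (b.ψ * b.φ * ‖Δ‖) ≤ b.kappa ν ^ 3 * (b.ψ * b.φ * ‖Δ‖) := by
    gcongr
    exact one_le_pow₀ hκ
  linarith

lemma norm_damped_add_le : ‖P.damped γ (K + Δ)‖ ≤ 9 / 8 * b.kappa ν := by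
  have hκ := h.one_le_kappa
  rw [damped_add]
  have h1 := norm_sub_le (P.damped γ K) (P.dampedB γ * (Δ * P.C))
  have h2 := h.norm_perturb_le Δ
  have h3 := h.psi_phi_norm_le hΔ
  have h4 := h.norm_damped_le
  linarith

/-- The value matrix of `K` still works as a Lyapunov function for `K + Δ`. The perturbation changes
its decrease by at most `17/64 ℓ₀ ≤ ℓ₀ / 3`, by the choice of `rad`, so a decrease of `2/3 ℓ₀ ‖x‖²`
is left; this is the origin of the factor `3/2`. -/
lemma powSqBound_add : PowSqBound (P.damped γ (K + Δ)) (3 / 2 * b.kappa ν ^ 2) := by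
  have h4 := h.valid.pos
  have hκ := h.one_le_kappa
  have hν := h.level_pos
  set V := P.valueMat γ K with hV
  set T := P.dampedB γ * (Δ * P.C) with hT
  have hT1 : b.kappa ν ^ 3 * ‖T‖ ≤ 1 / 8 :=
    (mul_le_mul_of_nonneg_left (h.norm_perturb_le Δ) (by positivity)).trans
      (h.kappa_mul_norm_le hΔ)
  have key : ‖(P.damped γ K - T)ᵀ * V * (P.damped γ K - T) -
      (P.damped γ K)ᵀ * V * P.damped γ K‖ ≤ b.ℓ₀ / 3 := by
    refine (norm_conj_sub_conj_le V T).trans ?_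
    have hT2 : ‖T‖ ≤ 1 / 8 * b.kappa ν :=
      (h.norm_perturb_le Δ).trans ((h.psi_phi_norm_le hΔ).trans (by linarith))
    calc ‖V‖ * (2 * ‖P.damped γ K‖ + ‖T‖) * ‖T‖
        ≤ ν * (2 * b.kappa ν + 1 / 8 * b.kappa ν) * ‖T‖ := by
          gcongr
          · exact h.norm_valueMat_le
          · exact h.norm_damped_le
      _ = 17 / 8 * b.ℓ₀ * (b.kappa ν ^ 3 * ‖T‖) := by
          linear_combination (-(17 / 8 * b.kappa ν * ‖T‖)) * h.kappa_sq
      _ ≤ 17 / 8 * b.ℓ₀ * (1 / 8) := by gcongr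
      _ ≤ _ := by linarith
  refine (PowSqBound.of_lyapunov (P := V) (c := 2 / 3 * b.ℓ₀) (by positivity)
    (qf_nonneg (h.stable.posSemidef_valueMat h.valid)) fun x => ?_).mono ?_
  · have h5 := (abs_le.1 (abs_qf_le ((P.damped γ K - T)ᵀ * V * (P.damped γ K - T) -
      (P.damped γ K)ᵀ * V * P.damped γ K) x)).2
    rw [qf_sub, qf_conj, qf_conj, ← damped_add, h.stable.qf_valueMat_damped] at h5
    have h6 := h.valid.qf_stageMat_ge' K x
    have h7 := mul_le_mul_of_nonneg_right key (sq_nonneg (en x))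
    rw [← damped_add] at h7
    linarith
  · rw [div_le_iff₀ (by positivity)]
    have := h.trace_le
    linarith [h.kappa_sq]

lemma stable_add : P.Stable γ (K + Δ) := ⟨_, h.powSqBound_add hΔ⟩

end Perturbation

end Level

end Plant

end DiscountedSOF

/-! ### Local Lipschitz and smoothness estimates for the cost. -/

namespace DiscountedSOF

namespace Plant.Level

variable {n m p : ℕ} {P : Plant n m p} {b : Bounds} {γ ν : ℝ} {K : Matrix (Fin m) (Fin p) ℝ}

variable (h : P.Level b γ K ν)
include h

variable {Δ : Matrix (Fin m) (Fin p) ℝ} (hΔ : ‖Δ‖ ≤ b.rad ν)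

/-- The second-order part of the Lyapunov residual. -/
lemma norm_residual_quad_le (Δ : Matrix (Fin m) (Fin p) ℝ) :
    ‖(Δ * P.C)ᵀ * (P.R + (P.dampedB γ)ᵀ * P.valueMat γ K * P.dampedB γ) * (Δ * P.C)‖ ≤
      2 * b.kappa ν ^ 2 * b.ℓ₁ * b.ψ ^ 2 * b.φ ^ 2 * ‖Δ‖ ^ 2 := by
  have hκ := h.one_le_kappa
  have hψ := h.valid.one_le_psi
  have hφ := h.valid.one_le_phi
  have hl := h.valid.l1_pos
  have hν := h.level_pos
  have h1 : ‖P.R + (P.dampedB γ)ᵀ * P.valueMat γ K * P.dampedB γ‖ ≤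
      2 * b.kappa ν ^ 2 * b.ℓ₁ * b.ψ ^ 2 := by
    calc _ ≤ ‖P.R‖ + ‖(P.dampedB γ)ᵀ‖ * ‖P.valueMat γ K‖ * ‖P.dampedB γ‖ :=
          (norm_add_le _ _).trans (add_le_add le_rfl ((norm_mul_le_rect _ _).trans
            (by gcongr; exact norm_mul_le_rect _ _)))
      _ ≤ b.ℓ₁ + b.ψ * (b.kappa ν ^ 2 * b.ℓ₁) * b.ψ := by
          rw [norm_transpose]
          have hB := h.valid.norm_dampedB_le h.disc_le
          gcongr
          · exact h.valid.norm_R_le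
          · exact h.norm_valueMat_le.trans h.level_le
      _ = 1 * b.ℓ₁ * 1 + b.kappa ν ^ 2 * b.ℓ₁ * b.ψ ^ 2 := by ring
      _ ≤ b.kappa ν ^ 2 * b.ℓ₁ * b.ψ ^ 2 + b.kappa ν ^ 2 * b.ℓ₁ * b.ψ ^ 2 := by
          gcongr
          · exact one_le_pow₀ hκ
          · exact one_le_pow₀ hψ
      _ = _ := by ring
  calc _ ≤ ‖(Δ * P.C)ᵀ‖ * ‖P.R + (P.dampedB γ)ᵀ * P.valueMat γ K * P.dampedB γ‖ * ‖Δ * P.C‖ :=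
        (norm_mul_le_rect _ _).trans (by gcongr; exact norm_mul_le_rect _ _)
    _ ≤ (b.φ * ‖Δ‖) * (2 * b.kappa ν ^ 2 * b.ℓ₁ * b.ψ ^ 2) * (b.φ * ‖Δ‖) := by
        rw [norm_transpose]
        gcongr <;> exact h.valid.norm_mulC_le Δ
    _ = _ := by ring

/-- The exact residual of the value matrix for the perturbed gain. -/
lemma valueMat_add_sub (hΔ : ‖Δ‖ ≤ b.rad ν) :
    P.valueMat γ (K + Δ) - P.valueMat γ K = lyap (P.damped γ (K + Δ))
      (P.residual γ K Δ +
        (Δ * P.C)ᵀ * (P.R + (P.dampedB γ)ᵀ * P.valueMat γ K * P.dampedB γ) * (Δ * P.C)) := by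
  rw [← residual_expansion h.valid.R_symm (h.stable.valueMat_symm h.valid)]
  exact lyap_sub_lyap h.powSqBound (h.powSqBound_add hΔ) _ _

include hΔ

/-- Inside the radius `rad` the quadratic part of the residual is at most `1/16` of the bound `4 κ³
ℓ₁ ψ φ ‖Δ‖` for the linear part. The factor `3/2 κ²` from the perturbed Lyapunov operator then gives
`51/8 ≤ 8`. -/
lemma norm_valueMat_add_sub_le :
    ‖P.valueMat γ (K + Δ) - P.valueMat γ K‖ ≤
      8 * b.kappa ν ^ 5 * b.ℓ₁ * b.ψ * b.φ * ‖Δ‖ := by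
  have hκ := h.one_le_kappa
  have hψ := h.valid.one_le_psi
  have hφ := h.valid.one_le_phi
  have hl := h.valid.l1_pos
  have h1 : ‖P.residual γ K Δ‖ ≤ 4 * (b.kappa ν ^ 3 * b.ℓ₁ * b.ψ * b.φ * ‖Δ‖) :=
    calc _ ≤ 2 * b.φ * ‖P.gradMat γ K‖ * ‖Δ‖ := h.norm_residual_le Δ
      _ ≤ 2 * b.φ * (2 * b.kappa ν ^ 3 * b.ℓ₁ * b.ψ) * ‖Δ‖ := by
          gcongr; exact h.norm_gradMat_le'
      _ = _ := by ring
  have h2 : 2 * b.kappa ν ^ 2 * b.ℓ₁ * b.ψ ^ 2 * b.φ ^ 2 * ‖Δ‖ ^ 2 ≤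
      1 / 4 * (b.kappa ν ^ 3 * b.ℓ₁ * b.ψ * b.φ * ‖Δ‖) :=
    calc _ = 2 * (b.kappa ν ^ 2 * b.ℓ₁ * b.ψ * b.φ * ‖Δ‖) * (b.ψ * b.φ * ‖Δ‖) := by ring
      _ ≤ 2 * (b.kappa ν ^ 3 * b.ℓ₁ * b.ψ * b.φ * ‖Δ‖) * (1 / 8) := by
          gcongr
          · norm_num
          · exact h.psi_phi_norm_le hΔ
      _ = _ := by ring
  rw [h.valueMat_add_sub hΔ]
  calc _ ≤ 3 / 2 * b.kappa ν ^ 2 * (4 * (b.kappa ν ^ 3 * b.ℓ₁ * b.ψ * b.φ * ‖Δ‖) +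
        1 / 4 * (b.kappa ν ^ 3 * b.ℓ₁ * b.ψ * b.φ * ‖Δ‖)) := by
        refine ((h.powSqBound_add hΔ).norm_lyap_le _).trans ?_
        gcongr
        exact (norm_add_le _ _).trans (add_le_add h1 ((h.norm_residual_quad_le Δ).trans h2))
    _ = 51 / 8 * (b.kappa ν ^ 5 * b.ℓ₁ * b.ψ * b.φ * ‖Δ‖) := by ring
    _ ≤ 8 * (b.kappa ν ^ 5 * b.ℓ₁ * b.ψ * b.φ * ‖Δ‖) := by gcongr; norm_num
    _ = _ := by ring

/-- Here the residual is kept fixed and only the closed loop of the Lyapunov operator is perturbed.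
This difference enters both the second-order expansion of the cost and the Lipschitz bound for its
derivative. -/
lemma abs_trace_lyap_sub_le (H : Matrix (Fin m) (Fin p) ℝ) :
    |(lyap (P.damped γ (K + Δ)) (P.residual γ K H)).trace - P.costDeriv γ K H| ≤
      13 * b.kappa ν ^ 8 * b.ℓ₁ * b.ψ ^ 2 * b.φ ^ 2 * ‖Δ‖ * ‖H‖ := by
  have hκ := h.one_le_kappa
  have hψ := h.valid.one_le_psi
  have hφ := h.valid.one_le_phi
  have hl := h.valid.l1_pos
  rw [costDeriv, ← Matrix.trace_sub, lyap_sub_lyap h.powSqBound (h.powSqBound_add hΔ), sub_self,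
    zero_add]
  refine ((h.powSqBound_add hΔ).abs_trace_lyap_le _).trans ?_
  have h1 : ‖P.residual γ K H‖ ≤ 4 * (b.kappa ν ^ 3 * b.ℓ₁ * b.ψ * b.φ * ‖H‖) :=
    calc _ ≤ 2 * b.φ * ‖P.gradMat γ K‖ * ‖H‖ := h.norm_residual_le H
      _ ≤ 2 * b.φ * (2 * b.kappa ν ^ 3 * b.ℓ₁ * b.ψ) * ‖H‖ := by
          gcongr; exact h.norm_gradMat_le'
      _ = _ := by ring
  have h2 := h.powSqBound.norm_lyap_le (P.residual γ K H)
  have hT := h.norm_perturb_le Δ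
  have hT' := h.psi_phi_norm_le hΔ
  have h3 := norm_conj_sub_conj_le (A := P.damped γ K)
    (lyap (P.damped γ K) (P.residual γ K H)) (P.dampedB γ * (Δ * P.C))
  rw [← damped_add] at h3
  calc _ ≤ 3 / 2 * b.kappa ν ^ 2 *
        ((b.kappa ν ^ 2 * (4 * (b.kappa ν ^ 3 * b.ℓ₁ * b.ψ * b.φ * ‖H‖))) *
          (2 * b.kappa ν + 1 / 8 * b.kappa ν) * (b.ψ * b.φ * ‖Δ‖)) := by
        gcongr
        refine h3.trans ?_
        gcongr
        · exact h2.trans (by gcongr)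
        · exact h.norm_damped_le
        · linarith
    _ = 51 / 4 * (b.kappa ν ^ 8 * b.ℓ₁ * b.ψ ^ 2 * b.φ ^ 2 * ‖Δ‖ * ‖H‖) := by ring
    _ ≤ 13 * (b.kappa ν ^ 8 * b.ℓ₁ * b.ψ ^ 2 * b.φ ^ 2 * ‖Δ‖ * ‖H‖) := by gcongr; norm_num
    _ = _ := by ring

/-- Second-order expansion of the cost. -/
lemma abs_trace_sub_costDeriv_le :
    |(P.valueMat γ (K + Δ)).trace - (P.valueMat γ K).trace - P.costDeriv γ K Δ| ≤
      16 * b.kappa ν ^ 8 * b.ℓ₁ * b.ψ ^ 2 * b.φ ^ 2 * ‖Δ‖ ^ 2 := by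
  have hκ := h.one_le_kappa
  have hψ := h.valid.one_le_psi
  have hφ := h.valid.one_le_phi
  have hl := h.valid.l1_pos
  rw [← Matrix.trace_sub, h.valueMat_add_sub hΔ, (h.powSqBound_add hΔ).lyap_add,
    Matrix.trace_add, add_sub_right_comm]
  refine (abs_add_le _ _).trans ?_
  have h1 := h.abs_trace_lyap_sub_le hΔ Δ
  have h2 : 3 / 2 * b.kappa ν ^ 2 * (2 * b.kappa ν ^ 2 * b.ℓ₁ * b.ψ ^ 2 * b.φ ^ 2 * ‖Δ‖ ^ 2) ≤
      3 * b.kappa ν ^ 8 * b.ℓ₁ * b.ψ ^ 2 * b.φ ^ 2 * ‖Δ‖ ^ 2 :=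
    calc _ = 3 * b.kappa ν ^ 4 * b.ℓ₁ * b.ψ ^ 2 * b.φ ^ 2 * ‖Δ‖ ^ 2 := by ring
      _ ≤ _ := by gcongr; norm_num
  have h3 := ((h.powSqBound_add hΔ).abs_trace_lyap_le ((Δ * P.C)ᵀ * (P.R + (P.dampedB γ)ᵀ *
    P.valueMat γ K * P.dampedB γ) * (Δ * P.C))).trans
      (mul_le_mul_of_nonneg_left (h.norm_residual_quad_le Δ) (by positivity))
  linarith

lemma norm_gradMat_add_sub_le :
    ‖P.gradMat γ (K + Δ) - P.gradMat γ K‖ ≤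
      11 * b.kappa ν ^ 6 * b.ℓ₁ * b.ψ ^ 2 * b.φ * ‖Δ‖ := by
  have hκ := h.one_le_kappa
  have hψ := h.valid.one_le_psi
  have hφ := h.valid.one_le_phi
  have hl := h.valid.l1_pos
  have hν := h.level_pos
  have hB := h.valid.norm_dampedB_le h.disc_le
  set V := P.valueMat γ K with hV
  set V' := P.valueMat γ (K + Δ) with hV'
  set T := P.dampedB γ * (Δ * P.C) with hT
  -- The grouping pairs `V' - V` with the perturbed closed loop and `T` with the unperturbed `V`, so
  -- that each term contains exactly one increment.
  have e : P.gradMat γ (K + Δ) - P.gradMat γ K =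
      P.R * (Δ * P.C) - (P.dampedB γ)ᵀ * ((V' - V) * P.damped γ (K + Δ) - V * T) := by
    have e1 : P.damped γ K = P.damped γ (K + Δ) + T := by rw [damped_add]; abel
    rw [gradMat, gradMat, ← hV, ← hV', e1]
    generalize P.damped γ (K + Δ) = A
    generalize P.dampedB γ = B
    simp only [Matrix.mul_add, Matrix.add_mul, Matrix.mul_sub, Matrix.sub_mul, Matrix.mul_assoc]
    abel
  have h1 : ‖(V' - V) * P.damped γ (K + Δ) - V * T‖ ≤
      (8 * b.kappa ν ^ 5 * b.ℓ₁ * b.ψ * b.φ * ‖Δ‖) * (9 / 8 * b.kappa ν) +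
        b.kappa ν ^ 2 * b.ℓ₁ * (b.ψ * b.φ * ‖Δ‖) := by
    refine (norm_sub_le _ _).trans (add_le_add ((norm_mul_le_rect _ _).trans ?_)
      ((norm_mul_le_rect _ _).trans ?_))
    · gcongr
      · exact h.norm_valueMat_add_sub_le hΔ
      · exact h.norm_damped_add_le hΔ
    · gcongr
      · exact h.norm_valueMat_le.trans h.level_le
      · exact h.norm_perturb_le Δ
  have h6 : b.kappa ν ^ 2 ≤ b.kappa ν ^ 6 := by gcongr; norm_num
  have h60 : 1 ≤ b.kappa ν ^ 6 := one_le_pow₀ hκ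
  have hψ2 : 1 ≤ b.ψ ^ 2 := one_le_pow₀ hψ
  rw [e]
  calc _ ≤ ‖P.R‖ * ‖Δ * P.C‖ + ‖P.dampedB γ‖ * ‖(V' - V) * P.damped γ (K + Δ) - V * T‖ := by
        refine (norm_sub_le _ _).trans (add_le_add (norm_mul_le_rect _ _) ?_)
        rw [← norm_transpose (P.dampedB γ)]
        exact norm_mul_le_rect _ _
    _ ≤ b.ℓ₁ * (b.φ * ‖Δ‖) + b.ψ * ((8 * b.kappa ν ^ 5 * b.ℓ₁ * b.ψ * b.φ * ‖Δ‖) *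
        (9 / 8 * b.kappa ν) + b.kappa ν ^ 2 * b.ℓ₁ * (b.ψ * b.φ * ‖Δ‖)) := by
        gcongr
        · exact h.valid.norm_R_le
        · exact h.valid.norm_mulC_le Δ
    _ = 1 * b.ℓ₁ * 1 * b.φ * ‖Δ‖ + 9 * b.kappa ν ^ 6 * b.ℓ₁ * b.ψ ^ 2 * b.φ * ‖Δ‖ +
        b.kappa ν ^ 2 * b.ℓ₁ * b.ψ ^ 2 * b.φ * ‖Δ‖ := by ring
    _ ≤ b.kappa ν ^ 6 * b.ℓ₁ * b.ψ ^ 2 * b.φ * ‖Δ‖ +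
        9 * b.kappa ν ^ 6 * b.ℓ₁ * b.ψ ^ 2 * b.φ * ‖Δ‖ +
        b.kappa ν ^ 6 * b.ℓ₁ * b.ψ ^ 2 * b.φ * ‖Δ‖ := by gcongr
    _ = _ := by ring

/-- The derivative of the cost is locally Lipschitz. -/
lemma abs_costDeriv_sub_le (H : Matrix (Fin m) (Fin p) ℝ) :
    |P.costDeriv γ (K + Δ) H - P.costDeriv γ K H| ≤
      46 * b.kappa ν ^ 8 * b.ℓ₁ * b.ψ ^ 2 * b.φ ^ 2 * ‖Δ‖ * ‖H‖ := by
  have hκ := h.one_le_kappa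
  have hψ := h.valid.one_le_psi
  have hφ := h.valid.one_le_phi
  have hl := h.valid.l1_pos
  have h1 := h.abs_trace_lyap_sub_le hΔ H
  -- The intermediate point has the new closed loop and the old gradient matrix. The change of the
  -- gradient matrix contributes 33 and the change of the closed loop contributes 13, in total 46.
  have e : P.costDeriv γ (K + Δ) H - (lyap (P.damped γ (K + Δ)) (P.residual γ K H)).trace =
      (lyap (P.damped γ (K + Δ)) ((H * P.C)ᵀ * (P.gradMat γ (K + Δ) - P.gradMat γ K) +
        (P.gradMat γ (K + Δ) - P.gradMat γ K)ᵀ * (H * P.C))).trace := by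
    rw [costDeriv, ← Matrix.trace_sub, ← (h.powSqBound_add hΔ).lyap_sub]
    congr 2
    simp only [residual, Matrix.mul_sub, Matrix.sub_mul, Matrix.transpose_sub]
    abel
  have h2 : |P.costDeriv γ (K + Δ) H - (lyap (P.damped γ (K + Δ)) (P.residual γ K H)).trace| ≤
      33 * b.kappa ν ^ 8 * b.ℓ₁ * b.ψ ^ 2 * b.φ ^ 2 * ‖Δ‖ * ‖H‖ := by
    rw [e]
    refine ((h.powSqBound_add hΔ).abs_trace_lyap_le _).trans ?_
    have hg := h.norm_gradMat_add_sub_le hΔ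
    set G := P.gradMat γ (K + Δ) - P.gradMat γ K
    calc _ ≤ 3 / 2 * b.kappa ν ^ 2 * (‖(H * P.C)ᵀ‖ * ‖G‖ + ‖Gᵀ‖ * ‖H * P.C‖) := by
          gcongr
          exact (norm_add_le _ _).trans (add_le_add (norm_mul_le_rect _ _) (norm_mul_le_rect _ _))
      _ = 3 * b.kappa ν ^ 2 * ‖G‖ * ‖H * P.C‖ := by rw [norm_transpose, norm_transpose]; ring
      _ ≤ 3 * b.kappa ν ^ 2 * (11 * b.kappa ν ^ 6 * b.ℓ₁ * b.ψ ^ 2 * b.φ * ‖Δ‖) * (b.φ * ‖H‖) := by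
          gcongr
          exact h.valid.norm_mulC_le H
      _ = _ := by ring
  have h3 := abs_sub_le (P.costDeriv γ (K + Δ) H)
    (lyap (P.damped γ (K + Δ)) (P.residual γ K H)).trace (P.costDeriv γ K H)
  linarith

end Plant.Level

end DiscountedSOF

/-! ### Spectral radius versus summable powers, and the cost as the trace of the value matrix. -/

namespace DiscountedSOF

section SpectralRadius

variable {n : ℕ}

lemma specRad_nonneg (M : Matrix (Fin n) (Fin n) ℝ) : 0 ≤ specRad M := ENNReal.toReal_nonneg

lemma map_pow_complex (M : Matrix (Fin n) (Fin n) ℝ) (t : ℕ) :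
    (M ^ t).map (algebraMap ℝ ℂ) = M.map (algebraMap ℝ ℂ) ^ t :=
  map_pow (algebraMap ℝ ℂ).mapMatrix M t

lemma spectralRadius_ne_top (M : Matrix (Fin n) (Fin n) ℂ) : spectralRadius ℂ M ≠ ⊤ := by
  refine ne_top_of_le_ne_top (ENNReal.coe_ne_top (r := ‖M‖₊ * ‖(1 : Matrix (Fin n) (Fin n) ℂ)‖₊))
    (iSup₂_le fun k hk => ?_)
  exact_mod_cast spectrum.norm_le_norm_mul_of_mem hk

lemma norm_entry_le_l2 (M : Matrix (Fin n) (Fin n) ℂ) (i j : Fin n) : ‖M i j‖ ≤ ‖M‖ := by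
  have h := Matrix.l2_opNorm_mulVec M (EuclideanSpace.single j 1)
  rw [PiLp.norm_single, norm_one, mul_one] at h
  refine le_trans ?_ h
  have h2 := PiLp.norm_apply_le (p := 2) (WithLp.toLp 2 (M *ᵥ (Pi.single j 1 : Fin n → ℂ))) i
  simpa using h2

lemma fsq_le_norm_complex (M : Matrix (Fin n) (Fin n) ℝ) :
    fsq M ≤ n ^ 2 * ‖M.map (algebraMap ℝ ℂ)‖ ^ 2 := by
  calc fsq M ≤ ∑ _i : Fin n, ∑ _j : Fin n, ‖M.map (algebraMap ℝ ℂ)‖ ^ 2 := by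
        refine Finset.sum_le_sum fun i _ => Finset.sum_le_sum fun j _ => ?_
        have h := norm_entry_le_l2 (M.map (algebraMap ℝ ℂ)) i j
        simp only [Matrix.map_apply, norm_algebraMap', Real.norm_eq_abs] at h
        rw [← sq_abs]
        gcongr
    _ = _ := by simp; ring

lemma fsq_smul {m : ℕ} (c : ℝ) (M : Matrix (Fin m) (Fin n) ℝ) : fsq (c • M) = c ^ 2 * fsq M := by
  simp [fsq, mul_pow, Finset.mul_sum]

/-- If `c ρ(M) < 1` then the powers of `c M` are square summable. -/
lemma exists_powSqBound_of_specRad_lt {M : Matrix (Fin n) (Fin n) ℝ} {c : ℝ} (hc : 0 < c)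
    (h : c * specRad M < 1) : ∃ s, PowSqBound (c • M) s := by
  set Mc := M.map (algebraMap ℝ ℂ) with hMc
  obtain ⟨q, hq1, hq2⟩ : ∃ q, specRad M < q ∧ q < 1 / c :=
    exists_between (by rwa [lt_div_iff₀ hc, mul_comm])
  have hq0 : 0 < q := (specRad_nonneg M).trans_lt hq1
  have hlt : spectralRadius ℂ Mc < ENNReal.ofReal q :=
    (ENNReal.lt_ofReal_iff_toReal_lt (spectralRadius_ne_top Mc)).2 hq1
  -- Gelfand's formula: eventually `‖M ^ t‖ ≤ q ^ t`, where `q` lies strictly between `ρ(M)` and `1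
  -- / c`.
  have hev := (spectrum.pow_norm_pow_one_div_tendsto_nhds_spectralRadius Mc).eventually_lt_const hlt
  obtain ⟨T, hT⟩ := Filter.eventually_atTop.1 (hev.and (Filter.eventually_ge_atTop 1))
  have hcq : c * q < 1 := by rw [mul_comm]; exact (lt_div_iff₀ hc).1 hq2
  have hbound : ∀ t ≥ T, fsq ((c • M) ^ t) ≤ n ^ 2 * ((c * q) ^ 2) ^ t := by
    intro t ht
    obtain ⟨h1, h2⟩ := hT t ht
    rw [ENNReal.ofReal_lt_ofReal_iff hq0] at h1
    have h3 : ‖Mc ^ t‖ ≤ q ^ t := by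
      calc ‖Mc ^ t‖ = (‖Mc ^ t‖ ^ (1 / t : ℝ)) ^ t := by
            rw [one_div, Real.rpow_inv_natCast_pow (norm_nonneg _) (by omega)]
        _ ≤ q ^ t := by gcongr
    rw [smul_pow, fsq_smul]
    calc (c ^ t) ^ 2 * fsq (M ^ t) ≤ (c ^ t) ^ 2 * (n ^ 2 * (q ^ t) ^ 2) := by
          gcongr
          refine (fsq_le_norm_complex _).trans ?_
          rw [map_pow_complex]
          gcongr
      _ = _ := by rw [mul_pow c q 2, mul_pow, ← pow_mul, ← pow_mul, ← pow_mul, ← pow_mul]; ring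
  have hsum : Summable fun t => fsq ((c • M) ^ t) := by
    rw [← summable_nat_add_iff T]
    refine Summable.of_nonneg_of_le (fun _ => fsq_nonneg _) (fun t => hbound (t + T) (by omega)) ?_
    refine (summable_nat_add_iff T (f := fun t => (n : ℝ) ^ 2 * ((c * q) ^ 2) ^ t)).2 ?_
    refine (summable_geometric_of_lt_one (by positivity) ?_).mul_left _
    exact pow_lt_one₀ (by positivity) hcq (by norm_num)
  exact ⟨∑' t, fsq ((c • M) ^ t), fun N => hsum.sum_le_tsum _ fun _ _ => fsq_nonneg _⟩

/-- The powers tend to 0, so some power of `c M` has norm below `1/2`. Every eigenvalue `k` of `M`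
then satisfies `(c |k|) ^ t ≤ 1/2`. The factor `‖1‖` is kept because it is not 1 when `n = 0`. -/
lemma specRad_lt_of_powSqBound {M : Matrix (Fin n) (Fin n) ℝ} {c s : ℝ} (hc : 0 < c)
    (h : PowSqBound (c • M) s) : c * specRad M < 1 := by
  set Mc := M.map (algebraMap ℝ ℂ) with hMc
  have h0 : Filter.Tendsto (fun t => (c • M) ^ t) Filter.atTop (nhds 0) := by
    rw [tendsto_zero_iff_norm_tendsto_zero]
    have h1 : Filter.Tendsto (fun t => ‖(c • M) ^ t‖ ^ 2) Filter.atTop (nhds 0) :=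
      squeeze_zero (fun _ => by positivity) (fun t => norm_sq_le_fsq _) h.tendsto_fsq
    have h2 := h1.sqrt
    simpa [Real.sqrt_sq] using h2
  have h1 : Filter.Tendsto (fun t => ‖((c • M) ^ t).map (algebraMap ℝ ℂ)‖ *
      ‖(1 : Matrix (Fin n) (Fin n) ℂ)‖) Filter.atTop (nhds 0) := by
    have hcont : Continuous fun N : Matrix (Fin n) (Fin n) ℝ => N.map (algebraMap ℝ ℂ) :=
      continuous_id.matrix_map (continuous_algebraMap ℝ ℂ)
    have := ((hcont.tendsto 0).comp h0).norm.mul_const ‖(1 : Matrix (Fin n) (Fin n) ℂ)‖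
    simpa using this
  obtain ⟨t, ht, ht1⟩ := ((h1.eventually_lt_const (by norm_num : (0 : ℝ) < 1 / 2)).and
    (Filter.eventually_ge_atTop 1)).exists
  set r : ℝ := (1 / 2 : ℝ) ^ ((t : ℝ)⁻¹) with hr
  have ht0 : t ≠ 0 := by omega
  have hr0 : 0 ≤ r := by positivity
  have hrt : r ^ t = 1 / 2 := Real.rpow_inv_natCast_pow (by norm_num) ht0
  have hr1 : r < 1 := by
    by_contra hcon
    have := one_le_pow₀ (n := t) (not_lt.1 hcon)
    linarith
  have hle : spectralRadius ℂ Mc ≤ ENNReal.ofReal (r / c) := by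
    refine iSup₂_le fun k hk => ?_
    have h2 := spectrum.norm_le_norm_mul_of_mem (spectrum.pow_mem_pow Mc t hk)
    have h3 : (c * ‖k‖) ^ t ≤ r ^ t := by
      rw [hrt, mul_pow, ← norm_pow]
      refine le_trans ?_ ht.le
      have e : ((c • M) ^ t).map (algebraMap ℝ ℂ) = (c ^ t : ℝ) • Mc ^ t := by
        rw [smul_pow, hMc, ← map_pow_complex]
        ext i j
        simp
      rw [e, norm_smul, Real.norm_of_nonneg (by positivity), mul_assoc]
      gcongr
    have h4 : c * ‖k‖ ≤ r := le_of_pow_le_pow_left₀ ht0 hr0 h3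
    rw [← ENNReal.ofReal_coe_nnreal, coe_nnnorm]
    refine ENNReal.ofReal_le_ofReal ?_
    rw [le_div_iff₀ hc]
    linarith
  have h5 : specRad M ≤ r / c := ENNReal.toReal_le_of_le_ofReal (by positivity) hle
  calc c * specRad M ≤ c * (r / c) := by gcongr
    _ = r := by field_simp
    _ < 1 := hr1

end SpectralRadius

namespace IsInitialLaw

variable {n : ℕ} {𝒟 : Measure (Fin n → ℝ)} {d : ℝ}

lemma ae_en_le (h : IsInitialLaw 𝒟 d) : ∀ᵐ x ∂𝒟, en x ≤ d := h.bounded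

lemma abs_le_en (x : Fin n → ℝ) (i : Fin n) : |x i| ≤ en x := by
  have := PiLp.norm_apply_le (p := 2) (WithLp.toLp 2 x : EuclideanSpace ℝ (Fin n)) i
  simpa [en] using this

variable [IsProbabilityMeasure 𝒟]

lemma integrable_mul (h : IsInitialLaw 𝒟 d) (i j : Fin n) : Integrable (fun x => x i * x j) 𝒟 := by
  refine Integrable.of_bound (by fun_prop) (d * d) ?_
  filter_upwards [h.ae_en_le] with x hx
  rw [norm_mul]
  have h1 := (abs_le_en x i).trans hx
  have h2 := (abs_le_en x j).trans hx
  have h3 : 0 ≤ d := (en_nonneg x).trans hx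
  exact mul_le_mul h1 h2 (abs_nonneg _) h3

lemma qf_eq_sum (M : Matrix (Fin n) (Fin n) ℝ) (x : Fin n → ℝ) :
    qf M x = ∑ i, ∑ j, M i j * (x i * x j) := by
  simp only [qf, dotProduct, Matrix.mulVec, Finset.mul_sum]
  exact Finset.sum_congr rfl fun i _ => Finset.sum_congr rfl fun j _ => by ring

lemma integrable_qf (h : IsInitialLaw 𝒟 d) (M : Matrix (Fin n) (Fin n) ℝ) :
    Integrable (qf M) 𝒟 := by
  rw [funext (qf_eq_sum M)]
  exact integrable_finsetSum _ fun i _ => integrable_finsetSum _ fun j _ =>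
    (h.integrable_mul i j).const_mul _

lemma integral_qf (h : IsInitialLaw 𝒟 d) (M : Matrix (Fin n) (Fin n) ℝ) :
    ∫ x, qf M x ∂𝒟 = M.trace := by
  simp only [qf_eq_sum]
  refine (integral_finsetSum _ fun i _ => integrable_finsetSum _ fun j _ =>
    (h.integrable_mul i j).const_mul _).trans (Finset.sum_congr rfl fun i _ => ?_)
  refine (integral_finsetSum _ fun j _ => (h.integrable_mul i j).const_mul _).trans ?_
  simp [integral_const_mul, h.cov_id]

/-- Identity covariance gives `n = 𝔼 ‖x‖²`. -/
lemma dim_le (h : IsInitialLaw 𝒟 d) : (n : ℝ) ≤ d ^ 2 := by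
  have h1 := h.integral_qf 1
  have h2 : ∫ x, qf 1 x ∂𝒟 ≤ ∫ _x, d ^ 2 ∂𝒟 := by
    refine integral_mono_ae (h.integrable_qf 1) (integrable_const _) ?_
    filter_upwards [h.ae_en_le] with x hx
    rw [qf_one]
    exact pow_le_pow_left₀ (en_nonneg x) hx 2
  rw [h1] at h2
  simpa using h2

end IsInitialLaw

namespace Plant

variable {n m p : ℕ} {P : Plant n m p} {γ : ℝ} {K : Matrix (Fin m) (Fin p) ℝ}

lemma mem_stabSet_iff (hγ : 0 < γ) : K ∈ P.stabSet γ ↔ P.Stable γ K :=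
  ⟨fun h => exists_powSqBound_of_specRad_lt (Real.sqrt_pos.2 hγ) h,
    fun ⟨_, h⟩ => specRad_lt_of_powSqBound (Real.sqrt_pos.2 hγ) h⟩

/-- Used at the return of the algorithm: stability for a discount factor that has passed 1 is
stability of the undamped system. -/
lemma specRad_closedLoop_lt_one (hγ : 1 ≤ γ) (h : P.Stable γ K) :
    specRad (P.closedLoop K) < 1 := by
  have h1 := (mem_stabSet_iff (by linarith)).2 h
  have h2 : 1 ≤ √γ := Real.one_le_sqrt.2 hγ
  exact lt_of_le_of_lt (le_mul_of_one_le_left (specRad_nonneg _) h2) h1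

lemma stageCost_eq (x : Fin n → ℝ) : P.stageCost K x = qf (P.stageMat K) x := by
  rw [stageCost, stageMat, qf_add, qf_conj]
  simp [qf, input, Matrix.mulVec_neg, ← Matrix.mulVec_mulVec]

lemma traj_eq (x : Fin n → ℝ) (t : ℕ) : P.traj K x t = P.closedLoop K ^ t *ᵥ x := by
  induction t with
  | zero => simp [traj]
  | succ t ih =>
    rw [traj, ih, pow_succ', ← Matrix.mulVec_mulVec]
    generalize P.closedLoop K ^ t *ᵥ x = y
    simp only [input, closedLoop, Matrix.sub_mulVec, Matrix.mulVec_neg, Matrix.mulVec_mulVec,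
      Matrix.mul_assoc]
    abel

lemma dampedTraj_eq (x : Fin n → ℝ) (t : ℕ) : P.dampedTraj γ K x t = P.damped γ K ^ t *ᵥ x := by
  induction t with
  | zero => simp [dampedTraj]
  | succ t ih =>
    rw [dampedTraj, ih, pow_succ', ← Matrix.mulVec_mulVec, ← Matrix.smul_mulVec]
    rfl

lemma discounted_stageCost_eq (hγ : 0 ≤ γ) (x : Fin n → ℝ) (t : ℕ) :
    γ ^ t * P.stageCost K (P.traj K x t) = qf (P.stageMat K) (P.damped γ K ^ t *ᵥ x) := by
  rw [stageCost_eq, traj_eq, damped, smul_pow, Matrix.smul_mulVec, qf_smul_vec, ← pow_mul,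
    mul_comm t 2, pow_mul, Real.sq_sqrt hγ]

lemma Stable.hasSum_qf (h : P.Stable γ K) (x : Fin n → ℝ) :
    HasSum (fun t => qf (P.stageMat K) (P.damped γ K ^ t *ᵥ x)) (qf (P.valueMat γ K) x) := by
  obtain ⟨s, hs⟩ := h
  exact hs.hasSum_qf _ x

/-- Each stage cost is the drop of the value along one step, so the sum telescopes. -/
lemma Stable.truncCost_eq (h : P.Stable γ K) (τ : ℕ) (x : Fin n → ℝ) :
    P.truncCost γ τ K x =
      qf (P.valueMat γ K) x - qf (P.valueMat γ K) (P.damped γ K ^ τ *ᵥ x) := by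
  induction τ with
  | zero => simp [truncCost]
  | succ τ ih =>
    have e : P.truncCost γ (τ + 1) K x = P.truncCost γ τ K x +
        P.stageCost K (P.dampedTraj γ K x τ) := Finset.sum_range_succ _ _
    rw [e, ih, stageCost_eq, dampedTraj_eq, pow_succ', ← Matrix.mulVec_mulVec,
      h.qf_valueMat_damped]
    ring

variable {𝒟 : Measure (Fin n → ℝ)} [IsProbabilityMeasure 𝒟] {d : ℝ} {b : Bounds}

/-- The cost of a stabilizing gain is the trace of its value matrix. -/
lemma Stable.cost_eq (h : P.Stable γ K) (hγ : 0 ≤ γ) (hb : b.Valid P) (h𝒟 : IsInitialLaw 𝒟 d) :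
    P.cost 𝒟 γ K = (P.valueMat γ K).trace := by
  have hpos := h.posSemidef_valueMat hb
  have e : ∀ x, ∑' t : ℕ, ENNReal.ofReal (γ ^ t * P.stageCost K (P.traj K x t)) =
      ENNReal.ofReal (qf (P.valueMat γ K) x) := by
    intro x
    simp only [discounted_stageCost_eq hγ]
    rw [← (h.hasSum_qf x).tsum_eq, ENNReal.ofReal_tsum_of_nonneg
      (fun t => qf_nonneg (hb.posSemidef_stageMat K) _) (h.hasSum_qf x).summable]
  rw [cost, extCost]
  simp only [e]
  rw [← ofReal_integral_eq_lintegral_ofReal (h𝒟.integrable_qf _)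
    (Filter.Eventually.of_forall fun x => qf_nonneg hpos x), h𝒟.integral_qf,
    ENNReal.toReal_ofReal]
  rw [← h𝒟.integral_qf]
  exact integral_nonneg fun x => qf_nonneg hpos x

end Plant

end DiscountedSOF

/-! ### The gradient in the Frobenius inner product. -/

namespace DiscountedSOF

section Vectorize

variable {m p : ℕ}

/-- The space of gains with the Frobenius inner product. -/
abbrev GainSpace (m p : ℕ) : Type := EuclideanSpace ℝ (Fin m × Fin p)

/-- The gain with the given coordinates. -/
def toMat (v : GainSpace m p) : Matrix (Fin m) (Fin p) ℝ := Matrix.of fun i j => v (i, j)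

/-- The coordinates of a gain. -/
def toVec (K : Matrix (Fin m) (Fin p) ℝ) : GainSpace m p := WithLp.toLp 2 fun ij => K ij.1 ij.2

@[simp] lemma toMat_toVec (K : Matrix (Fin m) (Fin p) ℝ) : toMat (toVec K) = K := rfl

@[simp] lemma toVec_toMat (v : GainSpace m p) : toVec (toMat v) = v := rfl

@[simp] lemma toMat_add (v w : GainSpace m p) : toMat (v + w) = toMat v + toMat w := rfl

@[simp] lemma toMat_neg (v : GainSpace m p) : toMat (-v) = -toMat v := rfl

@[simp] lemma toMat_smul (c : ℝ) (v : GainSpace m p) : toMat (c • v) = c • toMat v := rfl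

@[simp] lemma toVec_add (K L : Matrix (Fin m) (Fin p) ℝ) : toVec (K + L) = toVec K + toVec L := rfl

@[simp] lemma toVec_smul (c : ℝ) (K : Matrix (Fin m) (Fin p) ℝ) : toVec (c • K) = c • toVec K := rfl

lemma frob_eq (K : Matrix (Fin m) (Fin p) ℝ) : frob K = ‖toVec K‖ := by
  rw [frob, EuclideanSpace.norm_eq, Fintype.sum_prod_type]
  simp [toVec]

/-- The spectral norm is at most the Frobenius norm. The estimates above, proved in the spectral
norm, thereby pass to `GainSpace`. -/
lemma norm_toMat_le (v : GainSpace m p) : ‖toMat v‖ ≤ ‖v‖ := by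
  have h : ‖toMat v‖ ^ 2 ≤ ‖v‖ ^ 2 := by
    refine (norm_sq_le_fsq _).trans_eq ?_
    rw [EuclideanSpace.norm_sq_eq, Fintype.sum_prod_type]
    simp [fsq, toMat]
  exact le_of_sq_le_sq h (norm_nonneg _)

end Vectorize

namespace Plant

variable {n m p : ℕ} {P : Plant n m p} {γ ν : ℝ} {K : Matrix (Fin m) (Fin p) ℝ} {b : Bounds}
  {𝒟 : Measure (Fin n → ℝ)} {d : ℝ}

/-- The gradient of the cost of a stabilizing gain, as a linear form. -/
noncomputable def Stable.derivForm (h : P.Stable γ K) : StrongDual ℝ (GainSpace m p) :=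
  LinearMap.toContinuousLinearMap
    { toFun := fun v => P.costDeriv γ K (toMat v)
      map_add' := fun v w => by rw [toMat_add, h.costDeriv_add]
      map_smul' := fun c v => by rw [toMat_smul, h.costDeriv_smul]; rfl }

namespace Level

variable (h : P.Level b γ K ν)
include h

lemma rad_pos : 0 < b.rad ν := by
  have hκ := h.one_le_kappa
  have hψ := h.valid.one_le_psi
  have hφ := h.valid.one_le_phi
  rw [Bounds.rad]
  positivity

lemma lip_pos : 0 < b.lip ν := by
  have hκ := h.one_le_kappa
  have hψ := h.valid.one_le_psi
  have hφ := h.valid.one_le_phi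
  have hl := h.valid.l1_pos
  rw [Bounds.lip]
  positivity

/-- All second-order constants are compared with `smooth` through this bound: `16 ≤ 104/6` for the
remainder of the cost and `46 ≤ 104/2` for the gradient. Without `1 ≤ min m p` the factor `√(min m
p)` would make `smooth` vanish. -/
lemma coeff_le_smooth (hmp : 1 ≤ min m p) :
    104 * (b.kappa ν ^ 8 * b.ℓ₁ * b.ψ ^ 2 * b.φ ^ 2) ≤ b.smooth m p ν := by
  have hκ := h.one_le_kappa
  have hψ := h.valid.one_le_psi
  have hφ := h.valid.one_le_phi
  have hl := h.valid.l1_pos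
  have h1 : 1 ≤ √((min m p : ℕ) : ℝ) := Real.one_le_sqrt.2 (by exact_mod_cast hmp)
  rw [Bounds.smooth]
  calc _ = 104 * b.kappa ν ^ 8 * b.ℓ₁ * b.ψ ^ 2 * b.φ ^ 2 * 1 := by ring
    _ ≤ _ := by gcongr; norm_num

lemma smooth_pos (hmp : 1 ≤ min m p) : 0 < b.smooth m p ν := by
  have hκ := h.one_le_kappa
  have hψ := h.valid.one_le_psi
  have hφ := h.valid.one_le_phi
  have hl := h.valid.l1_pos
  exact lt_of_lt_of_le (by positivity) (h.coeff_le_smooth hmp)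

lemma norm_valueMat_add_sub_le_lip {Δ : Matrix (Fin m) (Fin p) ℝ} (hΔ : ‖Δ‖ ≤ b.rad ν) :
    ‖P.valueMat γ (K + Δ) - P.valueMat γ K‖ ≤ b.lip ν / 2 * ‖Δ‖ := by
  have hκ := h.one_le_kappa
  have hψ := h.valid.one_le_psi
  have hφ := h.valid.one_le_phi
  have hl := h.valid.l1_pos
  refine (h.norm_valueMat_add_sub_le hΔ).trans ?_
  rw [Bounds.lip]
  calc _ ≤ 8 * b.kappa ν ^ 9 * b.ℓ₁ * b.ψ * b.φ * ‖Δ‖ := by gcongr; norm_num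
    _ = _ := by ring

variable [IsProbabilityMeasure 𝒟]

lemma abs_cost_sub_le (hγ : 0 ≤ γ) (h𝒟 : IsInitialLaw 𝒟 d) (hmp : 1 ≤ min m p)
    {v : GainSpace m p} (hv : ‖v‖ ≤ b.rad ν) :
    |P.cost 𝒟 γ (K + toMat v) - P.cost 𝒟 γ K - P.costDeriv γ K (toMat v)| ≤
      b.smooth m p ν / 6 * ‖v‖ ^ 2 := by
  have hκ := h.one_le_kappa
  have hψ := h.valid.one_le_psi
  have hφ := h.valid.one_le_phi
  have hl := h.valid.l1_pos
  have hv' := (norm_toMat_le v).trans hv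
  rw [(h.stable_add hv').cost_eq hγ h.valid h𝒟, h.stable.cost_eq hγ h.valid h𝒟]
  refine (h.abs_trace_sub_costDeriv_le hv').trans ?_
  have h1 := h.coeff_le_smooth hmp
  have h2 := norm_toMat_le v
  calc _ = 16 * (b.kappa ν ^ 8 * b.ℓ₁ * b.ψ ^ 2 * b.φ ^ 2) * ‖toMat v‖ ^ 2 := by ring
    _ ≤ b.smooth m p ν / 6 * ‖v‖ ^ 2 := by
        have : 0 < b.kappa ν ^ 8 * b.ℓ₁ * b.ψ ^ 2 * b.φ ^ 2 := by positivity
        have h3 : 16 * (b.kappa ν ^ 8 * b.ℓ₁ * b.ψ ^ 2 * b.φ ^ 2) ≤ b.smooth m p ν / 6 := by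
          linarith
        have h4 := h.smooth_pos hmp
        gcongr

/-- The remainder is quadratic on a ball of radius `rad`, which is more than differentiability
requires. -/
lemma hasGradientAt (hγ : 0 ≤ γ) (h𝒟 : IsInitialLaw 𝒟 d) (hmp : 1 ≤ min m p) :
    HasGradientAt (fun v => P.cost 𝒟 γ (toMat v))
      ((InnerProductSpace.toDual ℝ _).symm h.stable.derivForm) (toVec K) := by
  rw [hasGradientAt_iff_isLittleO_nhds_zero]
  have hO : (fun v : GainSpace m p => P.cost 𝒟 γ (toMat (toVec K + v)) -
      P.cost 𝒟 γ (toMat (toVec K)) -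
      Inner.inner ℝ ((InnerProductSpace.toDual ℝ _).symm h.stable.derivForm) v) =O[nhds 0]
      fun v => ‖v‖ ^ 2 := by
    refine Asymptotics.IsBigO.of_bound (b.smooth m p ν / 6) ?_
    filter_upwards [Metric.closedBall_mem_nhds (0 : GainSpace m p) h.rad_pos] with v hv
    rw [mem_closedBall_zero_iff] at hv
    rw [InnerProductSpace.toDual_symm_apply, norm_pow, norm_norm]
    exact h.abs_cost_sub_le hγ h𝒟 hmp hv
  exact hO.trans_isLittleO (Asymptotics.isLittleO_norm_pow_id one_lt_two)

end Level

variable [IsProbabilityMeasure 𝒟]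

/-- Every stabilizing gain belongs to some level, so qualitative facts such as differentiability
follow from the quantitative ones. -/
lemma Stable.level (h : P.Stable γ K) (hb : b.Valid P) (hγ : γ ≤ 1) :
    P.Level b γ K (max b.ℓ₀ (P.valueMat γ K).trace) :=
  ⟨hb, hγ, le_max_left _ _, h, le_max_right _ _⟩

/-- Hypotheses on the data under which the cost is studied. -/
structure Setting (P : Plant n m p) (b : Bounds) (𝒟 : Measure (Fin n → ℝ)) (d γ : ℝ) : Prop where
  valid : b.Valid P
  law : IsInitialLaw 𝒟 d
  disc_pos : 0 < γ
  disc_le : γ ≤ 1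
  dim_pos : 1 ≤ min m p

variable (S : P.Setting b 𝒟 d γ)
include S

lemma Stable.hasGradientAt (h : P.Stable γ K) :
    HasGradientAt (fun v => P.cost 𝒟 γ (toMat v)) (P.costGrad 𝒟 γ K) (toVec K) := by
  have h1 := (h.level S.valid S.disc_le).hasGradientAt S.disc_pos.le S.law S.dim_pos
  have h2 : P.costGrad 𝒟 γ K = _ := h1.gradient
  rw [h2]
  exact h1

lemma Stable.inner_costGrad (h : P.Stable γ K) (v : GainSpace m p) :
    Inner.inner ℝ (P.costGrad 𝒟 γ K) v = P.costDeriv γ K (toMat v) := by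
  have h1 := (h.level S.valid S.disc_le).hasGradientAt S.disc_pos.le S.law S.dim_pos
  have h2 : P.costGrad 𝒟 γ K = _ := h1.gradient
  rw [h2, InnerProductSpace.toDual_symm_apply]
  rfl

namespace Level

variable (h : P.Level b γ K ν)
include h

lemma abs_cost_sub_inner_le {v : GainSpace m p} (hv : ‖v‖ ≤ b.rad ν) :
    |P.cost 𝒟 γ (K + toMat v) - P.cost 𝒟 γ K - Inner.inner ℝ (P.costGrad 𝒟 γ K) v| ≤
      b.smooth m p ν / 6 * ‖v‖ ^ 2 := by
  rw [h.stable.inner_costGrad S]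
  exact h.abs_cost_sub_le S.disc_pos.le S.law S.dim_pos hv

omit [IsProbabilityMeasure 𝒟] S h in
lemma norm_le_of_forall_inner {g : GainSpace m p} {c : ℝ} (hc : 0 ≤ c)
    (hg : ∀ v, |Inner.inner ℝ g v| ≤ c * ‖v‖) : ‖g‖ ≤ c := by
  rcases (norm_nonneg g).eq_or_lt with h0 | h0
  · rwa [← h0]
  · have h1 := hg g
    rw [real_inner_self_eq_norm_sq, abs_of_nonneg (by positivity), sq] at h1
    exact le_of_mul_le_mul_right h1 h0

lemma norm_costGrad_le : ‖P.costGrad 𝒟 γ K‖ ≤ b.gradBound m p ν := by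
  have hκ := h.one_le_kappa
  have hψ := h.valid.one_le_psi
  have hφ := h.valid.one_le_phi
  have hl := h.valid.l1_pos
  have hν := h.level_pos
  have h1 : 1 ≤ √((min m p : ℕ) : ℝ) := Real.one_le_sqrt.2 (by exact_mod_cast S.dim_pos)
  refine norm_le_of_forall_inner (by rw [Bounds.gradBound]; positivity) fun v => ?_
  rw [h.stable.inner_costGrad S, Bounds.gradBound]
  calc _ ≤ 2 * b.kappa ν ^ 3 * b.φ * (b.ℓ₁ + b.ψ * ν) * ‖toMat v‖ := h.abs_costDeriv_le _
    _ = 2 * b.kappa ν ^ 3 * b.φ * (b.ℓ₁ + b.ψ * ν) * 1 * ‖toMat v‖ := by ring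
    _ ≤ _ := by gcongr; exact norm_toMat_le v

lemma norm_costGrad_add_sub_le {v : GainSpace m p} (hv : ‖v‖ ≤ b.rad ν) :
    ‖P.costGrad 𝒟 γ (K + toMat v) - P.costGrad 𝒟 γ K‖ ≤ b.smooth m p ν / 2 * ‖v‖ := by
  have hκ := h.one_le_kappa
  have hψ := h.valid.one_le_psi
  have hφ := h.valid.one_le_phi
  have hl := h.valid.l1_pos
  have hv' := (norm_toMat_le v).trans hv
  have hs := h.coeff_le_smooth S.dim_pos
  have hs0 := h.smooth_pos S.dim_pos
  refine norm_le_of_forall_inner (by positivity) fun w => ?_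
  rw [inner_sub_left, h.stable.inner_costGrad S, (h.stable_add hv').inner_costGrad S]
  refine (h.abs_costDeriv_sub_le hv' _).trans ?_
  calc _ = 46 * (b.kappa ν ^ 8 * b.ℓ₁ * b.ψ ^ 2 * b.φ ^ 2) * ‖toMat v‖ * ‖toMat w‖ := by ring
    _ ≤ b.smooth m p ν / 2 * ‖v‖ * ‖w‖ := by
        have : 0 < b.kappa ν ^ 8 * b.ℓ₁ * b.ψ ^ 2 * b.φ ^ 2 := by positivity
        have h3 : 46 * (b.kappa ν ^ 8 * b.ℓ₁ * b.ψ ^ 2 * b.φ ^ 2) ≤ b.smooth m p ν / 2 := by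
          linarith
        gcongr
        · exact norm_toMat_le v
        · exact norm_toMat_le w

end Level

end Plant

end DiscountedSOF

/-! ### Resampling of coordinates of a product measure, and Hoeffding's inequality in Hilbert space.
-/

namespace DiscountedSOF

section Resampling

variable {ι κ X : Type*} [MeasurableSpace X] (ν : Measure X) [IsProbabilityMeasure ν]

lemma measurable_extend (e : κ → ι) (he : Function.Injective e) :
    Measurable fun q : (ι → X) × (κ → X) => Function.extend e q.2 q.1 := by
  refine measurable_pi_iff.2 fun i => ?_
  by_cases hi : ∃ a, e a = i
  · obtain ⟨a, rfl⟩ := hi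
    simp only [he.extend_apply]
    fun_prop
  · simp only [Function.extend_apply' _ _ _ hi]
    fun_prop

/-- Replacing the coordinates in the range of `e` by fresh samples preserves a product measure. -/
lemma measurePreserving_extend (e : κ → ι) (he : Function.Injective e) :
    MeasurePreserving (fun q : (ι → X) × (κ → X) => Function.extend e q.2 q.1)
      ((Measure.infinitePi fun _ : ι => ν).prod (Measure.infinitePi fun _ : κ => ν))
      (Measure.infinitePi fun _ : ι => ν) := by
  classical
  refine ⟨measurable_extend e he, Measure.eq_infinitePi _ fun s t ht => ?_⟩
  rw [Measure.map_apply (measurable_extend e he)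
    (MeasurableSet.pi s.countable_toSet fun i _ => ht i)]
  have hset : (fun q : (ι → X) × (κ → X) => Function.extend e q.2 q.1) ⁻¹' (Set.pi s t) =
      (Set.pi (s.filter fun i => i ∉ Set.range e) t) ×ˢ
        (Set.pi (s.preimage e he.injOn) fun k => t (e k)) := by
    ext ⟨ω, y⟩
    simp only [Set.mem_preimage, Set.mem_pi, Finset.mem_coe, Set.mem_prod, Finset.mem_filter,
      Finset.mem_preimage]
    constructor
    · intro h
      refine ⟨fun i hi => ?_, fun k hk => ?_⟩
      · have := h i hi.1
        rwa [Function.extend_apply' _ _ _ (by simpa using hi.2)] at this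
      · have := h (e k) hk
        rwa [he.extend_apply] at this
    · rintro ⟨h1, h2⟩ i hi
      by_cases hr : i ∈ Set.range e
      · obtain ⟨k, rfl⟩ := hr
        rw [he.extend_apply]
        exact h2 k hi
      · rw [Function.extend_apply' _ _ _ (by simpa using hr)]
        exact h1 i ⟨hi, hr⟩
  rw [hset, Measure.prod_prod, Measure.infinitePi_pi _ fun i _ => ht i,
    Measure.infinitePi_pi _ fun k _ => ht (e k),
    Finset.prod_preimage' e s he.injOn fun i => ν (t i), mul_comm,
    Finset.prod_filter_mul_prod_filter_not s (fun i => i ∈ Set.range e) fun i => ν (t i)]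

lemma lintegral_extend (e : κ → ι) (he : Function.Injective e) {f : (ι → X) → ℝ≥0∞}
    (hf : Measurable f) :
    ∫⁻ ω, f ω ∂(Measure.infinitePi fun _ : ι => ν) =
      ∫⁻ ω, ∫⁻ y, f (Function.extend e y ω) ∂(Measure.infinitePi fun _ : κ => ν)
        ∂(Measure.infinitePi fun _ : ι => ν) := by
  rw [← (measurePreserving_extend ν e he).lintegral_comp hf]
  exact lintegral_prod _ (hf.comp (measurable_extend e he)).aemeasurable

end Resampling

section HilbertHoeffding

/-- The bound on `s` is the convex combination of `(a + c)²` and `(a - c)²` with weights `(1 ± u) /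
2`. Since `cosh √s = ∑ s ^ k / (2k)!`, convexity and monotonicity of `s ↦ s ^ k` give the claim term
by term. -/
lemma cosh_sqrt_le {a c u s : ℝ} (hu : |u| ≤ 1) (hs0 : 0 ≤ s)
    (hs : s ≤ a ^ 2 + c ^ 2 + 2 * a * c * u) :
    Real.cosh √s ≤ Real.cosh a * Real.cosh c + u * (Real.sinh a * Real.sinh c) := by
  obtain ⟨hu1, hu2⟩ := abs_le.1 hu
  have e : Real.cosh a * Real.cosh c + u * (Real.sinh a * Real.sinh c) =
      (1 + u) / 2 * Real.cosh (a + c) + (1 - u) / 2 * Real.cosh (a - c) := by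
    rw [Real.cosh_add, Real.cosh_sub]; ring
  rw [e]
  refine hasSum_le (fun k => ?_) (Real.hasSum_cosh √s)
    (((Real.hasSum_cosh (a + c)).mul_left ((1 + u) / 2)).add
      ((Real.hasSum_cosh (a - c)).mul_left ((1 - u) / 2)))
  have hconv := (convexOn_pow (𝕜 := ℝ) k).2 (Set.mem_Ici.2 (sq_nonneg (a + c)))
    (Set.mem_Ici.2 (sq_nonneg (a - c))) (by linarith : 0 ≤ (1 + u) / 2)
    (by linarith : 0 ≤ (1 - u) / 2) (by ring)
  simp only [smul_eq_mul] at hconv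
  rw [pow_mul, pow_mul, pow_mul, Real.sq_sqrt hs0, ← mul_div_assoc, ← mul_div_assoc, ← add_div]
  gcongr
  refine le_trans ?_ hconv
  gcongr
  linarith

variable {H : Type*} [NormedAddCommGroup H] [InnerProductSpace ℝ H]

/-- The right side is affine in `z`. Averaging over a centered `z` therefore leaves `cosh ‖x‖ * cosh
c`, which makes `cosh` of the norm of a random walk a supermartingale up to the factor `cosh c` per
step. If `‖x‖ * c = 0`, the quotient is 0 and so is the inner product. -/
lemma cosh_norm_add_le {x z : H} {c : ℝ} (hz : ‖z‖ ≤ c) :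
    Real.cosh ‖x + z‖ ≤ Real.cosh ‖x‖ * Real.cosh c +
      Inner.inner ℝ x z / (‖x‖ * c) * (Real.sinh ‖x‖ * Real.sinh c) := by
  have hc : 0 ≤ c := (norm_nonneg z).trans hz
  have hi : |Inner.inner ℝ x z| ≤ ‖x‖ * c :=
    (abs_real_inner_le_norm x z).trans (by gcongr)
  have h1 : |Inner.inner ℝ x z / (‖x‖ * c)| ≤ 1 := by
    rw [abs_div, abs_of_nonneg (by positivity : 0 ≤ ‖x‖ * c)]
    exact div_le_one_of_le₀ hi (by positivity)
  have h2 : ‖x + z‖ ^ 2 ≤ ‖x‖ ^ 2 + c ^ 2 + 2 * ‖x‖ * c * (Inner.inner ℝ x z / (‖x‖ * c)) := by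
    have h3 : 2 * ‖x‖ * c * (Inner.inner ℝ x z / (‖x‖ * c)) = 2 * Inner.inner ℝ x z := by
      rcases eq_or_ne (‖x‖ * c) 0 with h0 | h0
      · have : Inner.inner ℝ x z = (0 : ℝ) := by
          rw [h0] at hi; exact abs_nonpos_iff.1 hi
        rw [this]; simp
      · rw [mul_assoc 2, mul_assoc, mul_div_cancel₀ _ h0]
    rw [h3, norm_add_sq_real]
    have : ‖z‖ ^ 2 ≤ c ^ 2 := by gcongr
    linarith
  have := cosh_sqrt_le h1 (sq_nonneg _) h2
  rwa [Real.sqrt_sq (norm_nonneg _)] at this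

variable [CompleteSpace H] [MeasurableSpace H] [BorelSpace H] [SecondCountableTopology H]
  {X : Type*} [MeasurableSpace X] {ν : Measure X} [IsProbabilityMeasure ν] {Y : X → H} {c : ℝ}

lemma lintegral_cosh_norm_add_le (hY : Measurable Y) (hb : ∀ᵐ w ∂ν, ‖Y w‖ ≤ c)
    (h0 : ∫ w, Y w ∂ν = 0) (x : H) :
    ∫⁻ w, ENNReal.ofReal (Real.cosh ‖x + Y w‖) ∂ν ≤
      ENNReal.ofReal (Real.cosh ‖x‖) * ENNReal.ofReal (Real.cosh c) := by
  have hint : Integrable Y ν := Integrable.of_bound hY.aestronglyMeasurable c hb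
  set g : X → ℝ := fun w => Real.cosh ‖x‖ * Real.cosh c +
    Inner.inner ℝ x (Y w) / (‖x‖ * c) * (Real.sinh ‖x‖ * Real.sinh c) with hg
  have hle : ∀ᵐ w ∂ν, Real.cosh ‖x + Y w‖ ≤ g w := by
    filter_upwards [hb] with w hw using cosh_norm_add_le hw
  have hgi : Integrable g ν :=
    (integrable_const _).add (((hint.const_inner x).div_const _).mul_const _)
  have hgint : ∫ w, g w ∂ν = Real.cosh ‖x‖ * Real.cosh c := by
    rw [hg, integral_add (integrable_const _) (((hint.const_inner x).div_const _).mul_const _),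
      integral_mul_const, integral_mul_const]
    simp only [integral_div, integral_inner hint, h0]
    simp
  rw [← ENNReal.ofReal_mul (Real.cosh_pos _).le, ← hgint,
    ofReal_integral_eq_lintegral_ofReal hgi]
  · refine lintegral_mono_ae ?_
    filter_upwards [hle] with w hw using ENNReal.ofReal_le_ofReal hw
  · filter_upwards [hle] with w hw using (Real.cosh_pos _).le.trans hw

/-- Induction on the number of summands: the coordinate `N` is replaced by a fresh sample, indexed
by `Unit`, and integrated first. -/
lemma lintegral_cosh_norm_sum_le (hY : Measurable Y) (hb : ∀ᵐ w ∂ν, ‖Y w‖ ≤ c)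
    (h0 : ∫ w, Y w ∂ν = 0) (N : ℕ) :
    ∫⁻ w, ENNReal.ofReal (Real.cosh ‖∑ i ∈ Finset.range N, Y (w i)‖)
      ∂(Measure.infinitePi fun _ : ℕ => ν) ≤ ENNReal.ofReal (Real.cosh c) ^ N := by
  have hcosh : Measurable fun x : H => ENNReal.ofReal (Real.cosh ‖x‖) := by fun_prop
  induction N with
  | zero => simp
  | succ N ih =>
    have he : Function.Injective (fun _ : Unit => N) := fun _ _ _ => rfl
    rw [lintegral_extend ν (fun _ : Unit => N) he (by fun_prop)]
    have hstep : ∀ ω : ℕ → X, ∫⁻ y, ENNReal.ofReal (Real.cosh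
        ‖∑ i ∈ Finset.range (N + 1), Y (Function.extend (fun _ : Unit => N) y ω i)‖)
        ∂(Measure.infinitePi fun _ : Unit => ν) ≤
        ENNReal.ofReal (Real.cosh ‖∑ i ∈ Finset.range N, Y (ω i)‖) *
          ENNReal.ofReal (Real.cosh c) := by
      intro ω
      have e : ∀ y : Unit → X,
          ∑ i ∈ Finset.range (N + 1), Y (Function.extend (fun _ : Unit => N) y ω i) =
          ∑ i ∈ Finset.range N, Y (ω i) + Y (y ()) := by
        intro y
        rw [Finset.sum_range_succ]
        congr 1
        · refine Finset.sum_congr rfl fun i hi => ?_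
          rw [Function.extend_apply']
          rintro ⟨_, h⟩
          rw [← h] at hi
          simp at hi
        · congr 1
          exact he.extend_apply y ω ()
      simp only [e]
      have := (measurePreserving_eval_infinitePi (fun _ : Unit => ν) ()).lintegral_comp
        (f := fun w => ENNReal.ofReal (Real.cosh ‖∑ i ∈ Finset.range N, Y (ω i) + Y w‖))
        (hcosh.comp (by fun_prop))
      refine (this.trans_le ?_)
      exact lintegral_cosh_norm_add_le hY hb h0 _
    refine (lintegral_mono hstep).trans ?_
    rw [lintegral_mul_const _ (by fun_prop), pow_succ]
    gcongr

/-- Hoeffding's inequality for sums of independent centered bounded vectors of a Hilbert space. -/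
lemma measure_norm_sum_ge_le (hY : Measurable Y) (hc : 0 < c) (hb : ∀ᵐ w ∂ν, ‖Y w‖ ≤ c)
    (h0 : ∫ w, Y w ∂ν = 0) {N : ℕ} (hN : 0 < N) {t : ℝ} (ht : 0 ≤ t) :
    (Measure.infinitePi fun _ : ℕ => ν) {w | t ≤ ‖∑ i ∈ Finset.range N, Y (w i)‖} ≤
      ENNReal.ofReal (2 * Real.exp (-(t ^ 2 / (2 * N * c ^ 2)))) := by
  have hN' : (0 : ℝ) < N := by exact_mod_cast hN
  -- This minimizes `N θ² c² / 2 - θ t`, the exponent obtained from `cosh (θ c) ≤ exp (θ² c² / 2)`.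
  -- The factor 2 of the conclusion comes from `exp ≤ 2 cosh`; the dimension does not enter.
  set θ := t / (N * c ^ 2) with hθ
  have hθ0 : 0 ≤ θ := by positivity
  have h1 := lintegral_cosh_norm_sum_le (Y := fun w => θ • Y w) (c := θ * c) (ν := ν)
    (by fun_prop) (by
      filter_upwards [hb] with w hw
      rw [norm_smul, Real.norm_of_nonneg hθ0]
      gcongr) (by rw [integral_smul, h0, smul_zero]) N
  have hmeas : Measurable fun w : ℕ → X =>
      ENNReal.ofReal (Real.cosh ‖∑ i ∈ Finset.range N, θ • Y (w i)‖) := by fun_prop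
  have h2 := mul_meas_ge_le_lintegral (μ := Measure.infinitePi fun _ : ℕ => ν) hmeas
    (ENNReal.ofReal (Real.cosh (θ * t)))
  have hsub : {w : ℕ → X | t ≤ ‖∑ i ∈ Finset.range N, Y (w i)‖} ⊆
      {w | ENNReal.ofReal (Real.cosh (θ * t)) ≤
        ENNReal.ofReal (Real.cosh ‖∑ i ∈ Finset.range N, θ • Y (w i)‖)} := by
    intro w hw
    refine ENNReal.ofReal_le_ofReal (Real.cosh_le_cosh.2 ?_)
    rw [← Finset.smul_sum, norm_smul, Real.norm_of_nonneg hθ0,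
      abs_of_nonneg (by positivity), abs_of_nonneg (by positivity)]
    exact mul_le_mul_of_nonneg_left hw hθ0
  have hpos : 0 < Real.cosh (θ * t) := Real.cosh_pos _
  calc _ ≤ (Measure.infinitePi fun _ : ℕ => ν) {w | ENNReal.ofReal (Real.cosh (θ * t)) ≤
        ENNReal.ofReal (Real.cosh ‖∑ i ∈ Finset.range N, θ • Y (w i)‖)} := measure_mono hsub
    _ ≤ ENNReal.ofReal (Real.cosh (θ * c)) ^ N / ENNReal.ofReal (Real.cosh (θ * t)) := by
        rw [ENNReal.le_div_iff_mul_le (Or.inl (by simpa using hpos)) (Or.inl ENNReal.ofReal_ne_top),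
          mul_comm]
        exact h2.trans h1
    _ = ENNReal.ofReal (Real.cosh (θ * c) ^ N / Real.cosh (θ * t)) := by
        rw [ENNReal.ofReal_div_of_pos hpos, ENNReal.ofReal_pow (Real.cosh_pos _).le]
    _ ≤ _ := by
        refine ENNReal.ofReal_le_ofReal ?_
        rw [div_le_iff₀ hpos]
        have h3 : Real.cosh (θ * c) ^ N ≤ Real.exp (N * ((θ * c) ^ 2 / 2)) := by
          rw [Real.exp_nat_mul]
          exact pow_le_pow_left₀ (Real.cosh_pos _).le (Real.cosh_le_exp_half_sq _) N
        have h4 : Real.exp (θ * t) ≤ 2 * Real.cosh (θ * t) := by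
          rw [Real.cosh_eq]
          linarith [Real.exp_pos (-(θ * t))]
        calc _ ≤ Real.exp (N * ((θ * c) ^ 2 / 2)) := h3
          _ = Real.exp (-(t ^ 2 / (2 * N * c ^ 2))) * Real.exp (θ * t) := by
              rw [← Real.exp_add]
              congr 1
              rw [hθ]
              field_simp
              ring
          _ ≤ Real.exp (-(t ^ 2 / (2 * N * c ^ 2))) * (2 * Real.cosh (θ * t)) := by gcongr
          _ = _ := by ring

end HilbertHoeffding

end DiscountedSOF

/-! ### Integration by parts on the unit sphere through rotations. -/

namespace DiscountedSOF

section SphereStein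

variable {ι : Type*} [Fintype ι]

/-- Rotation by the angle `θ` in the plane of the coordinates `i` and `j`. -/
noncomputable def planeRotation [DecidableEq ι] (i j : ι) (θ : ℝ) :
    EuclideanSpace ℝ ι →ₗ[ℝ] EuclideanSpace ℝ ι where
  toFun u := u + ((Real.cos θ - 1) * u i - Real.sin θ * u j) • EuclideanSpace.single i (1 : ℝ) +
    (Real.sin θ * u i + (Real.cos θ - 1) * u j) • EuclideanSpace.single j (1 : ℝ)
  map_add' u v := by
    simp only [PiLp.add_apply]
    module
  map_smul' c u := by
    simp only [PiLp.smul_apply, smul_eq_mul, RingHom.id_apply]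
    module

section

variable [DecidableEq ι] {i j : ι}

omit [Fintype ι] in
lemma planeRotation_apply_left (hij : i ≠ j) (θ : ℝ) (u : EuclideanSpace ℝ ι) :
    planeRotation i j θ u i = Real.cos θ * u i - Real.sin θ * u j := by
  simp [planeRotation, hij]; ring

omit [Fintype ι] in
lemma planeRotation_apply_right (hij : i ≠ j) (θ : ℝ) (u : EuclideanSpace ℝ ι) :
    planeRotation i j θ u j = Real.sin θ * u i + Real.cos θ * u j := by
  simp [planeRotation, hij.symm]; ring

lemma norm_planeRotation (hij : i ≠ j) (θ : ℝ) (u : EuclideanSpace ℝ ι) :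
    ‖planeRotation i j θ u‖ = ‖u‖ := by
  have h : ‖planeRotation i j θ u‖ ^ 2 = ‖u‖ ^ 2 := by
    have e : planeRotation i j θ u = u +
        (((Real.cos θ - 1) * u i - Real.sin θ * u j) • EuclideanSpace.single i (1 : ℝ) +
        (Real.sin θ * u i + (Real.cos θ - 1) * u j) • EuclideanSpace.single j (1 : ℝ)) := by
      simp [planeRotation, add_assoc]
    rw [e, norm_add_sq_real, norm_add_sq_real, inner_add_right, real_inner_smul_right,
      real_inner_smul_right, real_inner_smul_left, real_inner_smul_right, norm_smul, norm_smul]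
    simp only [EuclideanSpace.inner_single_right, PiLp.norm_single, mul_pow, Real.norm_eq_abs,
      sq_abs, abs_one, one_mul, conj_trivial, PiLp.single_apply, hij.symm, if_false, mul_zero]
    linear_combination (u i ^ 2 + u j ^ 2) * Real.sin_sq_add_cos_sq θ
  exact (pow_left_inj₀ (norm_nonneg _) (norm_nonneg _) two_ne_zero).1 h

/-- The derivative at every angle is the infinitesimal rotation applied to the rotated vector, so
that one integrand `ψ` describes the derivative at all angles. -/
lemma hasDerivAt_planeRotation (hij : i ≠ j) (u : EuclideanSpace ℝ ι) (θ : ℝ) :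
    HasDerivAt (fun θ => planeRotation i j θ u)
      (-(planeRotation i j θ u j) • EuclideanSpace.single i (1 : ℝ) +
        (planeRotation i j θ u i) • EuclideanSpace.single j (1 : ℝ)) θ := by
  rw [planeRotation_apply_left hij, planeRotation_apply_right hij]
  have hc := Real.hasDerivAt_cos θ
  have hs := Real.hasDerivAt_sin θ
  have h1 := (((hc.sub_const 1).mul_const (u i)).sub (hs.mul_const (u j))).smul_const
    (EuclideanSpace.single i (1 : ℝ))
  have h2 := ((hs.mul_const (u i)).add ((hc.sub_const 1).mul_const (u j))).smul_const
    (EuclideanSpace.single j (1 : ℝ))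
  have h3 := (h1.const_add u).add h2
  refine h3.congr_deriv ?_
  module

/-- Rotations in coordinate planes as linear isometries. -/
noncomputable def planeRotationEquiv (hij : i ≠ j) (θ : ℝ) :
    EuclideanSpace ℝ ι ≃ₗᵢ[ℝ] EuclideanSpace ℝ ι :=
  LinearIsometry.toLinearIsometryEquiv ⟨planeRotation i j θ, norm_planeRotation hij θ⟩ rfl

end

/-- A probability measure carried by the unit sphere and invariant under linear isometries. -/
structure IsUniformOnSphere (σ : Measure (EuclideanSpace ℝ ι)) : Prop where
  norm_eq : ∀ᵐ u ∂σ, ‖u‖ = 1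
  map_eq : ∀ f : EuclideanSpace ℝ ι ≃ₗᵢ[ℝ] EuclideanSpace ℝ ι, σ.map f = σ

namespace IsUniformOnSphere

variable {σ : Measure (EuclideanSpace ℝ ι)} [IsProbabilityMeasure σ] (hσ : IsUniformOnSphere σ)
  {F : EuclideanSpace ℝ ι → ℝ} {G : EuclideanSpace ℝ ι → EuclideanSpace ℝ ι}
  (hF : Measurable F) (hG : Measurable G)
  {a c : ℝ} (hFb : ∀ u, ‖u‖ = 1 → |F u| ≤ a) (hGb : ∀ u, ‖u‖ = 1 → ‖G u‖ ≤ c)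
  (hd : ∀ u, ‖u‖ = 1 → HasGradientAt F (G u) u)
include hσ hF hG hFb hGb hd

omit [IsProbabilityMeasure σ] hσ hF hG hFb hGb hd in
lemma abs_apply_le (u : EuclideanSpace ℝ ι) (i : ι) : |u i| ≤ ‖u‖ := by
  simpa using PiLp.norm_apply_le u i

/-- Integration by parts along a rotation. -/
lemma integral_rotation_eq_zero (i j : ι) (hij : i ≠ j) :
    ∫ u, ((u i * G u j - u j * G u i) * u i - F u * u j) ∂σ = 0 := by
  classical
  set φ : ℝ → EuclideanSpace ℝ ι → ℝ := fun θ u =>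
    F (planeRotation i j θ u) * planeRotation i j θ u i with hφ
  set ψ : EuclideanSpace ℝ ι → ℝ := fun v => (v i * G v j - v j * G v i) * v i - F v * v j with hψ
  have hψm : Measurable ψ := by fun_prop
  have hrot : ∀ θ, Measurable (planeRotation i j θ) := fun θ =>
    (planeRotationEquiv hij θ).continuous.measurable
  have hψb : ∀ u, ‖u‖ = 1 → ‖ψ u‖ ≤ 2 * c + a := by
    intro u hu
    have h1 := abs_apply_le u i
    have h2 := abs_apply_le u j
    have h3 := (abs_apply_le (G u) i).trans (hGb u hu)
    have h4 := (abs_apply_le (G u) j).trans (hGb u hu)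
    have h5 := hFb u hu
    rw [hu] at h1 h2
    have hc : 0 ≤ c := (abs_nonneg _).trans h3
    have ha : 0 ≤ a := (abs_nonneg _).trans h5
    rw [hψ, Real.norm_eq_abs]
    calc _ ≤ (|u i| * |G u j| + |u j| * |G u i|) * |u i| + |F u| * |u j| := by
          refine (abs_sub _ _).trans ?_
          rw [abs_mul, abs_mul]
          gcongr
          refine (abs_sub _ _).trans ?_
          rw [abs_mul, abs_mul]
      _ ≤ (1 * c + 1 * c) * 1 + a * 1 := by gcongr
      _ = _ := by ring
  have hφb : ∀ θ u, ‖u‖ = 1 → ‖φ θ u‖ ≤ a := by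
    intro θ u hu
    have h0 : ‖planeRotation i j θ u‖ = 1 := (norm_planeRotation hij θ u).trans hu
    have h1 := abs_apply_le (planeRotation i j θ u) i
    have h5 := hFb _ h0
    rw [h0] at h1
    rw [hφ, Real.norm_eq_abs, abs_mul]
    calc _ ≤ a * 1 := by gcongr; exact (abs_nonneg _).trans h5
      _ = a := mul_one a
  have hφm : ∀ θ, Measurable (φ θ) := fun θ => by
    have := hrot θ
    exact (hF.comp this).mul (by fun_prop)
  have hconst : ∀ θ, ∫ u, φ θ u ∂σ = ∫ u, F u * u i ∂σ := by
    intro θ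
    conv_rhs => rw [← hσ.map_eq (planeRotationEquiv hij θ)]
    rw [integral_map (planeRotationEquiv hij θ).continuous.aemeasurable (by fun_prop)]
    rfl
  -- By invariance of `σ` the integral of `φ θ` does not depend on `θ`. Differentiating under the
  -- integral sign at `θ = 0` gives the identity.
  have key := hasDerivAt_integral_of_dominated_loc_of_deriv_le (μ := σ) (F := φ)
    (F' := fun θ u => ψ (planeRotation i j θ u)) (x₀ := (0 : ℝ)) (s := Set.univ)
    (bound := fun _ => 2 * c + a) Filter.univ_mem
    (Filter.Eventually.of_forall fun θ => (hφm θ).aestronglyMeasurable)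
    (Integrable.of_bound (hφm 0).aestronglyMeasurable a
      (by filter_upwards [hσ.norm_eq] with u hu using hφb 0 u hu))
    (hψm.comp (hrot 0)).aestronglyMeasurable
    (by
      filter_upwards [hσ.norm_eq] with u hu θ _
      exact hψb _ ((norm_planeRotation hij θ u).trans hu))
    (integrable_const _)
    (by
      filter_upwards [hσ.norm_eq] with u hu θ _
      have h0 : ‖planeRotation i j θ u‖ = 1 := (norm_planeRotation hij θ u).trans hu
      have h1 := hasDerivAt_planeRotation hij u θ
      have h2 := (hd _ h0).hasFDerivAt.comp_hasDerivAt θ h1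
      have h3 : HasDerivAt (fun θ => planeRotation i j θ u i) (-(planeRotation i j θ u j)) θ := by
        simp only [planeRotation_apply_left hij, planeRotation_apply_right hij]
        have := ((Real.hasDerivAt_cos θ).mul_const (u i)).sub
          ((Real.hasDerivAt_sin θ).mul_const (u j))
        exact this.congr_deriv (by ring)
      have h4 := h2.mul h3
      refine h4.congr_deriv ?_
      simp only [hψ, map_add, map_smul, InnerProductSpace.toDual_apply_apply,
        EuclideanSpace.inner_single_right, smul_eq_mul, Function.comp_apply, one_mul, conj_trivial]
      ring)
  have h0 : HasDerivAt (fun θ => ∫ u, φ θ u ∂σ) 0 0 := by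
    simp only [hconst]
    exact hasDerivAt_const _ _
  have h1 := key.2.unique h0
  have e : ∀ u, planeRotation i j 0 u = u := fun u => by simp [planeRotation]
  simpa only [e] using h1

/-- The tangential Stein identity on the sphere. -/
lemma integral_stein (j : ι) :
    (Fintype.card ι : ℝ) * ∫ u, F u * u j ∂σ =
      ∫ u, (F u * u j + G u j - u j * Inner.inner ℝ u (G u)) ∂σ := by
  classical
  have hint : ∀ f : EuclideanSpace ℝ ι → ℝ, Measurable f → (∀ u, ‖u‖ = 1 → |f u| ≤ a + c + c) →
      Integrable f σ := fun f hf hb =>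
    Integrable.of_bound hf.aestronglyMeasurable (a + c + c)
      (by filter_upwards [hσ.norm_eq] with u hu using hb u hu)
  obtain ⟨u₀, hu₀⟩ := hσ.norm_eq.exists
  have ha : 0 ≤ a := (abs_nonneg _).trans (hFb u₀ hu₀)
  have hc : 0 ≤ c := (norm_nonneg _).trans (hGb u₀ hu₀)
  have hcoord : ∀ u : EuclideanSpace ℝ ι, ‖u‖ = 1 → ∀ i, |u i| ≤ 1 := fun u hu i =>
    (abs_apply_le u i).trans_eq hu
  have hcoordG : ∀ u : EuclideanSpace ℝ ι, ‖u‖ = 1 → ∀ i, |G u i| ≤ c := fun u hu i =>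
    (abs_apply_le (G u) i).trans (hGb u hu)
  have hIF : Integrable (fun u => F u * u j) σ := hint _ (by fun_prop) fun u hu => by
    rw [abs_mul]
    nlinarith [hFb u hu, hcoord u hu j, abs_nonneg (F u), abs_nonneg (u j)]
  have hIi : ∀ i, Integrable (fun u => (u i * G u j - u j * G u i) * u i) σ := fun i =>
    hint _ (by fun_prop) fun u hu => by
      rw [abs_mul]
      have h1 : |u i * G u j - u j * G u i| ≤ c + c := by
        refine (abs_sub _ _).trans ?_
        rw [abs_mul, abs_mul]
        have := mul_le_mul (hcoord u hu i) (hcoordG u hu j) (abs_nonneg _) zero_le_one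
        have := mul_le_mul (hcoord u hu j) (hcoordG u hu i) (abs_nonneg _) zero_le_one
        linarith
      nlinarith [hcoord u hu i, abs_nonneg (u i), abs_nonneg (u i * G u j - u j * G u i)]
  have hoff : ∀ i, i ≠ j → ∫ u, F u * u j ∂σ = ∫ u, (u i * G u j - u j * G u i) * u i ∂σ := by
    intro i hij
    have h := hσ.integral_rotation_eq_zero hF hG hFb hGb hd i j hij
    rw [integral_sub (hIi i) hIF] at h
    linarith
  -- Summing over `i ≠ j` gives `card ι - 1` copies of the integral of `F u * u j`. The missing copy
  -- is the summand `F u * u j` in the conclusion, and the term `i = j` on the right vanishes.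
  have hsum : ∑ i ∈ Finset.univ.erase j, ∫ u, F u * u j ∂σ =
      ∑ i, ∫ u, (u i * G u j - u j * G u i) * u i ∂σ := by
    rw [← Finset.sum_erase (a := j) Finset.univ (by simp)]
    exact Finset.sum_congr rfl fun i hi => hoff i (Finset.ne_of_mem_erase hi)
  rw [Finset.sum_const, Finset.card_erase_of_mem (Finset.mem_univ j), Finset.card_univ,
    nsmul_eq_mul, Nat.cast_sub (Fintype.card_pos_iff.2 ⟨j⟩), Nat.cast_one,
    ← integral_finsetSum _ fun i _ => hIi i] at hsum
  have e : ∫ u, (F u * u j + G u j - u j * Inner.inner ℝ u (G u)) ∂σ =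
      ∫ u, (F u * u j + ∑ i, (u i * G u j - u j * G u i) * u i) ∂σ := by
    refine integral_congr_ae ?_
    filter_upwards [hσ.norm_eq] with u hu
    have h1 : ∑ i, u i ^ 2 = 1 := by
      have := EuclideanSpace.real_norm_sq_eq u
      rw [hu] at this
      linarith
    have h2 : Inner.inner ℝ u (G u) = ∑ i, u i * G u i := by
      simp [PiLp.inner_apply, mul_comm]
    rw [h2]
    have h3 : ∑ i, (u i * G u j - u j * G u i) * u i =
        G u j * ∑ i, u i ^ 2 - u j * ∑ i, u i * G u i := by
      rw [Finset.mul_sum, Finset.mul_sum, ← Finset.sum_sub_distrib]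
      exact Finset.sum_congr rfl fun i _ => by ring
    rw [h3, h1]
    ring
  rw [e, integral_add hIF (integrable_finsetSum _ fun i _ => hIi i), ← hsum]
  ring

/-- Bias of the one-point estimator `F u • u` on the unit sphere. -/
lemma norm_card_smul_integral_sub_le {g : EuclideanSpace ℝ ι} {α β : ℝ}
    (hα : ∀ u, ‖u‖ = 1 → |F u - Inner.inner ℝ g u| ≤ α) (hβ : ∀ u, ‖u‖ = 1 → ‖G u - g‖ ≤ β) :
    ‖(Fintype.card ι : ℝ) • ∫ u, F u • u ∂σ - g‖ ≤ α + β := by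
  have hint : ∀ f : EuclideanSpace ℝ ι → EuclideanSpace ℝ ι, Measurable f →
      (∀ u, ‖u‖ = 1 → ‖f u‖ ≤ a + c + c) → Integrable f σ := fun f hf hb =>
    Integrable.of_bound hf.aestronglyMeasurable (a + c + c)
      (by filter_upwards [hσ.norm_eq] with u hu using hb u hu)
  have hIF : Integrable (fun u => F u • u) σ := hint _ (by fun_prop) fun u hu => by
    rw [norm_smul, hu, mul_one, Real.norm_eq_abs]
    linarith [hFb u hu, hGb u hu, norm_nonneg (G u)]
  have hIG : Integrable (fun u => F u • u + G u - (Inner.inner ℝ u (G u) : ℝ) • u) σ :=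
    hint _ (by fun_prop) fun u hu => by
      have h1 : ‖F u • u‖ ≤ a := by
        rw [norm_smul, hu, mul_one]; exact hFb u hu
      have h2 : ‖(Inner.inner ℝ u (G u) : ℝ) • u‖ ≤ c := by
        rw [norm_smul, hu, mul_one]
        refine (abs_real_inner_le_norm _ _).trans ?_
        rw [hu, one_mul]
        exact hGb u hu
      exact (norm_sub_le _ _).trans (add_le_add ((norm_add_le _ _).trans
        (add_le_add h1 (hGb u hu))) h2)
  have hst : (Fintype.card ι : ℝ) • ∫ u, F u • u ∂σ =
      ∫ u, (F u • u + G u - (Inner.inner ℝ u (G u) : ℝ) • u) ∂σ := by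
    ext j
    have h1 := (EuclideanSpace.proj (𝕜 := ℝ) j).integral_comp_comm hIF
    have h2 := (EuclideanSpace.proj (𝕜 := ℝ) j).integral_comp_comm hIG
    simp only [PiLp.proj_apply, PiLp.smul_apply, PiLp.sub_apply, PiLp.add_apply,
      smul_eq_mul] at h1 h2 ⊢
    rw [← h1, ← h2, hσ.integral_stein hF hG hFb hGb hd j]
    simp only [mul_comm]
  have hg : g = ∫ _u, g ∂σ := by simp
  rw [hst, hg, ← integral_sub hIG (integrable_const _)]
  refine (norm_integral_le_of_norm_le_const (C := α + β) ?_).trans (by simp)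
  filter_upwards [hσ.norm_eq] with u hu
  -- After subtraction of `g`, the radial part is the error of `F` against its linearization and the
  -- rest is the tangential projection of `G u - g`. A projection does not increase norms, so no
  -- factor of the dimension appears.
  have e : F u • u + G u - (Inner.inner ℝ u (G u) : ℝ) • u - g =
      (F u - Inner.inner ℝ g u) • u + (G u - g - (Inner.inner ℝ u (G u - g) : ℝ) • u) := by
    rw [inner_sub_right, real_inner_comm u g]
    module
  rw [e]
  refine (norm_add_le _ _).trans (add_le_add ?_ ?_)
  · rw [norm_smul, hu, mul_one]; exact hα u hu
  · refine le_trans ?_ (hβ u hu)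
    set w := G u - g
    refine le_of_sq_le_sq ?_ (norm_nonneg _)
    rw [norm_sub_sq_real, real_inner_smul_right, norm_smul, hu, real_inner_comm, mul_one,
      Real.norm_eq_abs, sq_abs]
    nlinarith [sq_nonneg (Inner.inner ℝ u w : ℝ)]

end IsUniformOnSphere

end SphereStein

end DiscountedSOF

/-! ### Normalized Gaussian directions and the bias of the two-point estimator. -/

namespace DiscountedSOF

section Direction

variable {m p : ℕ}

/-- Law of a matrix with independent standard normal entries. -/
noncomputable abbrev gaussLaw (m p : ℕ) : Measure (Fin m → Fin p → ℝ) :=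
  Measure.pi fun _ : Fin m => Measure.pi fun _ : Fin p => gaussianReal 0 1

lemma measurable_toVec : Measurable fun g : Fin m → Fin p → ℝ => toVec (Matrix.of g) := by
  change Measurable fun g : Fin m → Fin p → ℝ =>
    (WithLp.toLp 2 fun ij : Fin m × Fin p => g ij.1 ij.2 : GainSpace m p)
  fun_prop

/-- Identifies independent standard normal entries with the standard Gaussian of `GainSpace`, whose
invariance under isometries is available. -/
lemma map_toVec_gaussLaw :
    (gaussLaw m p).map (fun g => toVec (Matrix.of g)) = stdGaussian (GainSpace m p) := by
  have h := Measure.infinitePi_map_curry_symm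
    (fun (_ : Fin m) (_ : Fin p) => gaussianReal 0 1)
  simp only [Measure.infinitePi_eq_pi] at h
  rw [← map_pi_eq_stdGaussian, ← h, Measure.map_map (by fun_prop)
    (MeasurableEquiv.measurable _)]
  rfl

/-- The normalized direction of a matrix. -/
noncomputable def direction (g : Fin m → Fin p → ℝ) : GainSpace m p :=
  ‖toVec (Matrix.of g)‖⁻¹ • toVec (Matrix.of g)

lemma toMat_direction (g : Fin m → Fin p → ℝ) :
    toMat (direction g) = (frob (Matrix.of g))⁻¹ • Matrix.of g := by
  rw [direction, frob_eq]; rfl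

lemma measurable_direction : Measurable (direction : (Fin m → Fin p → ℝ) → GainSpace m p) :=
  measurable_toVec.norm.inv.smul measurable_toVec

lemma norm_direction_le (g : Fin m → Fin p → ℝ) : ‖direction g‖ ≤ 1 := by
  rw [direction, norm_smul, norm_inv, norm_norm]
  exact inv_mul_le_one

/-- Law of the normalized Gaussian direction. -/
noncomputable def directionLaw (m p : ℕ) : Measure (GainSpace m p) :=
  (gaussLaw m p).map direction

instance : IsProbabilityMeasure (directionLaw m p) :=
  Measure.isProbabilityMeasure_map measurable_direction.aemeasurable

/-- `direction` is 0 at the zero matrix. This has probability 0 because already one entry is almost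
surely nonzero. -/
lemma ae_norm_direction (hmp : 1 ≤ min m p) :
    ∀ᵐ g ∂gaussLaw m p, ‖direction g‖ = 1 := by
  let i : Fin m := ⟨0, by omega⟩
  let j : Fin p := ⟨0, by omega⟩
  have hne : ∀ᵐ g ∂gaussLaw m p, g i j ≠ 0 := by
    have h1 : MeasurePreserving (fun g : Fin m → Fin p → ℝ => g i j) (gaussLaw m p)
        (gaussianReal 0 1) :=
      (measurePreserving_eval (fun _ : Fin p => gaussianReal 0 1) j).comp
        (measurePreserving_eval (fun _ : Fin m => Measure.pi fun _ : Fin p => gaussianReal 0 1) i)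
    have h2 : ∀ᵐ x ∂gaussianReal 0 1, x ≠ 0 := by
      have := nullSingletonClass_gaussianReal (μ := 0) (v := 1) one_ne_zero
      exact measure_eq_zero_iff_ae_notMem.1 (measure_singleton (0 : ℝ))
    exact h1.quasiMeasurePreserving.ae h2
  filter_upwards [hne] with g hg
  have h0 : toVec (Matrix.of g) ≠ 0 := fun h => hg (by
    have := congrArg (fun v : GainSpace m p => v (i, j)) h
    simpa [toVec] using this)
  rw [direction, norm_smul, norm_inv, norm_norm, inv_mul_cancel₀ (norm_ne_zero_iff.2 h0)]

/-- The standard Gaussian is invariant under linear isometries, and these commute with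
normalization. -/
lemma isUniformOnSphere_directionLaw (hmp : 1 ≤ min m p) :
    IsUniformOnSphere (directionLaw m p) where
  norm_eq := by
    rw [directionLaw, ae_map_iff measurable_direction.aemeasurable
      (measurableSet_eq_fun (by fun_prop) (by fun_prop))]
    exact ae_norm_direction hmp
  map_eq f := by
    set nrm : GainSpace m p → GainSpace m p := fun v => ‖v‖⁻¹ • v with hn
    have hnm : Measurable nrm := by fun_prop
    have e : directionLaw m p = (stdGaussian (GainSpace m p)).map nrm := by
      rw [← map_toVec_gaussLaw, Measure.map_map hnm measurable_toVec]
      rfl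
    have hf : Measurable f := f.continuous.measurable
    rw [e, Measure.map_map hf hnm]
    conv_rhs => rw [← stdGaussian_map f]
    rw [Measure.map_map hnm hf]
    congr 1
    funext v
    simp [hn]

end Direction

namespace Plant

variable {n m p : ℕ} (P : Plant n m p)

lemma continuous_toMat : Continuous (toMat : GainSpace m p → Matrix (Fin m) (Fin p) ℝ) := by
  refine continuous_matrix fun i j => ?_
  change Continuous fun v : GainSpace m p => v (i, j)
  fun_prop

section Continuity

variable {Y : Type*} [TopologicalSpace Y] {κ : Y → Matrix (Fin m) (Fin p) ℝ}
  {ξ : Y → Fin n → ℝ} {g : Y → ℝ} (hκ : Continuous κ) (hξ : Continuous ξ) (hg : Continuous g)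
include hκ

lemma continuous_stageMat : Continuous fun y => P.stageMat (κ y) := by
  have h : Continuous fun y => κ y * P.C := hκ.matrix_mul continuous_const
  exact continuous_const.add ((h.matrix_transpose.matrix_mul continuous_const).matrix_mul h)

lemma continuous_closedLoop : Continuous fun y => P.closedLoop (κ y) :=
  continuous_const.sub ((continuous_const.matrix_mul hκ).matrix_mul continuous_const)

include hξ

lemma continuous_stageCost_traj (t : ℕ) :
    Continuous fun y => P.stageCost (κ y) (P.traj (κ y) (ξ y) t) := by
  have h1 := P.continuous_stageMat hκ
  have h2 : Continuous fun y => P.closedLoop (κ y) ^ t *ᵥ ξ y :=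
    ((P.continuous_closedLoop hκ).pow t).matrix_mulVec hξ
  simp only [stageCost_eq, traj_eq]
  exact h2.dotProduct (h1.matrix_mulVec h2)

include hg

lemma continuous_truncCost (τ : ℕ) : Continuous fun y => P.truncCost (g y) τ (κ y) (ξ y) := by
  refine continuous_finsetSum _ fun t _ => ?_
  have h1 := P.continuous_stageMat hκ
  have h2 : Continuous fun y => P.damped (g y) (κ y) ^ t *ᵥ ξ y :=
    ((hg.sqrt.smul (P.continuous_closedLoop hκ)).pow t).matrix_mulVec hξ
  simp only [stageCost_eq, dampedTraj_eq]
  exact h2.dotProduct (h1.matrix_mulVec h2)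

end Continuity

/-- The infinite-horizon discounted cost from a given initial state. -/
noncomputable def rolloutCost (γ : ℝ) (K : Matrix (Fin m) (Fin p) ℝ) (x : Fin n → ℝ) : ℝ :=
  (∑' t : ℕ, ENNReal.ofReal (γ ^ t * P.stageCost K (P.traj K x t))).toReal

variable {P} {γ ν : ℝ} {K : Matrix (Fin m) (Fin p) ℝ} {b : Bounds}
  {𝒟 : Measure (Fin n → ℝ)} {d : ℝ}

lemma Stable.rolloutCost_eq (h : P.Stable γ K) (hγ : 0 ≤ γ) (hb : b.Valid P) (x : Fin n → ℝ) :
    P.rolloutCost γ K x = qf (P.valueMat γ K) x := by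
  rw [rolloutCost]
  simp only [discounted_stageCost_eq hγ]
  rw [← ENNReal.ofReal_tsum_of_nonneg (fun t => qf_nonneg (hb.posSemidef_stageMat K) _)
    (h.hasSum_qf x).summable, (h.hasSum_qf x).tsum_eq, ENNReal.toReal_ofReal]
  exact qf_nonneg (h.posSemidef_valueMat hb) x

lemma measurable_rolloutCost (P : Plant n m p) (γ : ℝ) :
    Measurable fun q : GainSpace m p × (Fin n → ℝ) => P.rolloutCost γ (toMat q.1) q.2 := by
  refine Measurable.ennreal_toReal (Measurable.tsum fun t => ?_)
  exact ((P.continuous_stageCost_traj (continuous_toMat.comp continuous_fst)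
    continuous_snd t).measurable.const_mul _).ennreal_ofReal

variable [IsProbabilityMeasure 𝒟]

lemma measurable_cost (P : Plant n m p) (𝒟 : Measure (Fin n → ℝ)) [IsProbabilityMeasure 𝒟]
    (γ : ℝ) : Measurable fun v : GainSpace m p => P.cost 𝒟 γ (toMat v) := by
  refine Measurable.ennreal_toReal ?_
  refine Measurable.lintegral_prod_right' (f := fun q : GainSpace m p × (Fin n → ℝ) =>
    ∑' t : ℕ, ENNReal.ofReal (γ ^ t * P.stageCost (toMat q.1) (P.traj (toMat q.1) q.2 t))) ?_
  refine Measurable.tsum fun t => ?_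
  exact ((P.continuous_stageCost_traj (continuous_toMat.comp continuous_fst)
    continuous_snd t).measurable.const_mul _).ennreal_ofReal

/-- The derivative of any real function on a finite-dimensional space is measurable, so the points
where the cost is not differentiable do no harm. -/
lemma measurable_costGrad (P : Plant n m p) (𝒟 : Measure (Fin n → ℝ)) (γ : ℝ) :
    Measurable fun v : GainSpace m p => P.costGrad 𝒟 γ (toMat v) := by
  change Measurable fun v : GainSpace m p => (InnerProductSpace.toDual ℝ (GainSpace m p)).symm
    (fderiv ℝ (fun w : GainSpace m p => P.cost 𝒟 γ (toMat w)) v)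
  exact (LinearIsometryEquiv.continuous _).measurable.comp (measurable_fderiv ℝ _)

/-- Bias of the two-point estimator of the gradient of the cost. -/
lemma Level.norm_smoothed_sub_le (h : P.Level b γ K ν) (S : P.Setting b 𝒟 d γ) {r : ℝ}
    (hr : 0 < r) (hr' : r ≤ b.rad ν) :
    ‖((m * p : ℕ) : ℝ) • ∫ u, ((P.cost 𝒟 γ (K + r • toMat u) - P.cost 𝒟 γ (K - r • toMat u)) /
        (2 * r)) • u ∂directionLaw m p - P.costGrad 𝒟 γ K‖ ≤ 2 / 3 * b.smooth m p ν * r := by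
  set g := P.costGrad 𝒟 γ K with hg
  set F : GainSpace m p → ℝ := fun u =>
    (P.cost 𝒟 γ (K + r • toMat u) - P.cost 𝒟 γ (K - r • toMat u)) / (2 * r) with hF
  set G : GainSpace m p → GainSpace m p := fun u =>
    (1 / 2 : ℝ) • (P.costGrad 𝒟 γ (K + r • toMat u) + P.costGrad 𝒟 γ (K - r • toMat u)) with hG
  have hs := h.smooth_pos S.dim_pos
  have hpm : ∀ u : GainSpace m p, K - r • toMat u = K + toMat (-(r • u)) := fun u => by
    simp [sub_eq_add_neg]
  have hpp : ∀ u : GainSpace m p, K + r • toMat u = K + toMat (r • u) := fun u => by simp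
  have hn : ∀ u : GainSpace m p, ‖u‖ = 1 → ‖r • u‖ = r := fun u hu => by
    rw [norm_smul, hu, mul_one, Real.norm_of_nonneg hr.le]
  have hn' : ∀ u : GainSpace m p, ‖u‖ = 1 → ‖-(r • u)‖ = r := fun u hu => by
    rw [norm_neg, hn u hu]
  -- In the symmetric difference the value at `K` cancels, and two remainders `L r² / 6` are divided
  -- by `2 r`. Together with the gradient error `L r / 2` below, this makes up the bias `2/3 L r`.
  have hα : ∀ u, ‖u‖ = 1 → |F u - Inner.inner ℝ g u| ≤ b.smooth m p ν * r / 6 := by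
    intro u hu
    have h1 := h.abs_cost_sub_inner_le S ((hn u hu).trans_le hr')
    have h2 := h.abs_cost_sub_inner_le S ((hn' u hu).trans_le hr')
    rw [hn u hu, real_inner_smul_right] at h1
    rw [hn' u hu, inner_neg_right, real_inner_smul_right] at h2
    have e : F u - Inner.inner ℝ g u = ((P.cost 𝒟 γ (K + toMat (r • u)) - P.cost 𝒟 γ K -
        r * Inner.inner ℝ g u) - (P.cost 𝒟 γ (K + toMat (-(r • u))) - P.cost 𝒟 γ K -
        -(r * Inner.inner ℝ g u))) / (2 * r) := by
      simp only [hF, hpm, hpp]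
      field_simp
      ring
    rw [e, abs_div, abs_of_pos (by positivity : 0 < 2 * r), div_le_iff₀ (by positivity)]
    refine (abs_sub _ _).trans ((add_le_add h1 h2).trans_eq ?_)
    ring
  have hβ : ∀ u, ‖u‖ = 1 → ‖G u - g‖ ≤ b.smooth m p ν * r / 2 := by
    intro u hu
    have h1 := h.norm_costGrad_add_sub_le S ((hn u hu).trans_le hr')
    have h2 := h.norm_costGrad_add_sub_le S ((hn' u hu).trans_le hr')
    rw [hn u hu] at h1
    rw [hn' u hu] at h2
    have e : G u - g = (1 / 2 : ℝ) • ((P.costGrad 𝒟 γ (K + toMat (r • u)) - g) +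
        (P.costGrad 𝒟 γ (K + toMat (-(r • u))) - g)) := by
      simp only [hG, hpm, hpp]
      module
    rw [e, norm_smul, Real.norm_of_nonneg (by norm_num)]
    have := norm_add_le (P.costGrad 𝒟 γ (K + toMat (r • u)) - g)
      (P.costGrad 𝒟 γ (K + toMat (-(r • u))) - g)
    linarith
  have hFm : Measurable F := by
    have h0 := measurable_cost P 𝒟 γ
    have h1 : Measurable fun u : GainSpace m p => P.cost 𝒟 γ (K + r • toMat u) :=
      h0.comp (g := fun v : GainSpace m p => P.cost 𝒟 γ (toMat v))
        (f := fun u => toVec K + r • u) (by fun_prop)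
    have h2 : Measurable fun u : GainSpace m p => P.cost 𝒟 γ (K - r • toMat u) :=
      h0.comp (g := fun v : GainSpace m p => P.cost 𝒟 γ (toMat v))
        (f := fun u => toVec K - r • u) (by fun_prop)
    exact (h1.sub h2).div_const _
  have hGm : Measurable G := by
    have h0 := measurable_costGrad P 𝒟 γ
    have h1 : Measurable fun u : GainSpace m p => P.costGrad 𝒟 γ (K + r • toMat u) :=
      h0.comp (g := fun v : GainSpace m p => P.costGrad 𝒟 γ (toMat v))
        (f := fun u => toVec K + r • u) (by fun_prop)
    have h2 : Measurable fun u : GainSpace m p => P.costGrad 𝒟 γ (K - r • toMat u) :=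
      h0.comp (g := fun v : GainSpace m p => P.costGrad 𝒟 γ (toMat v))
        (f := fun u => toVec K - r • u) (by fun_prop)
    exact (h1.add h2).const_smul (1 / 2 : ℝ)
  have hFb : ∀ u, ‖u‖ = 1 → |F u| ≤ ‖g‖ + b.smooth m p ν * r / 6 := by
    intro u hu
    have h1 := hα u hu
    have h2 := abs_real_inner_le_norm g u
    rw [hu, mul_one] at h2
    have h3 := abs_sub_abs_le_abs_sub (F u) (Inner.inner ℝ g u)
    linarith
  have hGb : ∀ u, ‖u‖ = 1 → ‖G u‖ ≤ ‖g‖ + b.smooth m p ν * r / 2 := by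
    intro u hu
    have h3 := norm_sub_norm_le (G u) g
    linarith [hβ u hu]
  have hd : ∀ u, ‖u‖ = 1 → HasGradientAt F (G u) u := by
    intro u hu
    have h1 : HasFDerivAt (fun w : GainSpace m p => P.cost 𝒟 γ (toMat (toVec K + r • w)))
        ((InnerProductSpace.toDual ℝ _ (P.costGrad 𝒟 γ (K + r • toMat u))).comp
          (r • ContinuousLinearMap.id ℝ (GainSpace m p))) u := by
      have hst : P.Stable γ (K + toMat (r • u)) := h.stable_add
        ((norm_toMat_le _).trans ((hn u hu).trans_le hr'))
      exact HasFDerivAt.comp (g := fun v : GainSpace m p => P.cost 𝒟 γ (toMat v))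
        (f := fun w : GainSpace m p => toVec K + r • w) u
        (hst.hasGradientAt S).hasFDerivAt (((hasFDerivAt_id u).const_smul r).const_add (toVec K))
    have h2 : HasFDerivAt (fun w : GainSpace m p => P.cost 𝒟 γ (toMat (toVec K - r • w)))
        ((InnerProductSpace.toDual ℝ _ (P.costGrad 𝒟 γ (K - r • toMat u))).comp
          (-(r • ContinuousLinearMap.id ℝ (GainSpace m p)))) u := by
      have hst : P.Stable γ (K + toMat (-(r • u))) := h.stable_add
        ((norm_toMat_le _).trans ((hn' u hu).trans_le hr'))
      rw [← hpm] at hst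
      exact HasFDerivAt.comp (g := fun v : GainSpace m p => P.cost 𝒟 γ (toMat v))
        (f := fun w : GainSpace m p => toVec K - r • w) u
        (hst.hasGradientAt S).hasFDerivAt (((hasFDerivAt_id u).const_smul r).const_sub (toVec K))
    rw [hasGradientAt_iff_hasFDerivAt]
    have h3 := (h1.sub h2).mul_const (2 * r)⁻¹
    refine HasFDerivAt.congr_fderiv (f := F) h3 ?_
    ext w
    simp only [hG, smul_apply, sub_apply,
      ContinuousLinearMap.comp_apply, neg_apply, ContinuousLinearMap.id_apply,
      InnerProductSpace.toDual_apply_apply, inner_smul_right, inner_neg_right, real_inner_smul_left,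
      inner_add_left, smul_eq_mul]
    field_simp
    ring
  have hfin := (isUniformOnSphere_directionLaw S.dim_pos).norm_card_smul_integral_sub_le
    hFm hGm hFb hGb hd hα hβ
  rw [Fintype.card_prod, Fintype.card_fin, Fintype.card_fin] at hfin
  refine hfin.trans_eq ?_
  ring

end Plant

end DiscountedSOF

/-! ### Truncation error and concentration of the gradient estimate. -/

namespace DiscountedSOF

namespace Plant

variable {n m p : ℕ} {P : Plant n m p} {γ ν : ℝ} {K : Matrix (Fin m) (Fin p) ℝ} {b : Bounds}
  {𝒟 : Measure (Fin n → ℝ)} {d : ℝ}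

/-- Exponential decay of the cost-to-go along a trajectory. -/
lemma Stable.qf_valueMat_pow_le (h : P.Stable γ K) (hb : b.Valid P) {v : ℝ} (hv : b.ℓ₀ ≤ v)
    (hV : ∀ x, qf (P.valueMat γ K) x ≤ v * en x ^ 2) (τ : ℕ) (x : Fin n → ℝ) :
    qf (P.valueMat γ K) (P.damped γ K ^ τ *ᵥ x) ≤
      (1 - b.ℓ₀ / v) ^ τ * qf (P.valueMat γ K) x := by
  have hv0 : 0 < v := hb.pos.trans_le hv
  have hq : 0 ≤ 1 - b.ℓ₀ / v := sub_nonneg.2 ((div_le_one hv0).2 hv)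
  induction τ with
  | zero => simp
  | succ τ ih =>
    rw [pow_succ', ← Matrix.mulVec_mulVec, h.qf_valueMat_damped]
    set y := P.damped γ K ^ τ *ᵥ x
    have h1 := hb.qf_stageMat_ge' K y
    have h2 : b.ℓ₀ / v * qf (P.valueMat γ K) y ≤ b.ℓ₀ * en y ^ 2 := by
      rw [div_mul_eq_mul_div, div_le_iff₀ hv0]
      have := mul_le_mul_of_nonneg_left (hV y) hb.pos.le
      linarith
    calc _ ≤ (1 - b.ℓ₀ / v) * qf (P.valueMat γ K) y := by linarith
      _ ≤ (1 - b.ℓ₀ / v) * ((1 - b.ℓ₀ / v) ^ τ * qf (P.valueMat γ K) x) := by gcongr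
      _ = _ := by ring

/-- From `1 - x ≤ exp (-x)`. The rate is stated for any `v ≥ ν` because perturbed gains decay with
`v = 2 ν` and unperturbed ones with `v = ν`. -/
lemma Level.one_sub_pow_le (h : P.Level b γ K ν) {v : ℝ} (hv : ν ≤ v) {τ : ℕ} {X : ℝ} (hX : 0 < X)
    (hτ : v / b.ℓ₀ * Real.log X ≤ τ) : (1 - b.ℓ₀ / v) ^ τ ≤ 1 / X := by
  have h0 := h.valid.pos
  have hv0 : 0 < v := h.level_pos.trans_le hv
  have hq : 0 ≤ 1 - b.ℓ₀ / v := sub_nonneg.2 ((div_le_one hv0).2 (h.level_ge.trans hv))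
  calc (1 - b.ℓ₀ / v) ^ τ ≤ Real.exp (-(b.ℓ₀ / v)) ^ τ := by
        gcongr
        linarith [Real.add_one_le_exp (-(b.ℓ₀ / v))]
    _ = Real.exp (-(b.ℓ₀ / v * τ)) := by rw [← Real.exp_nat_mul]; congr 1; ring
    _ ≤ Real.exp (-Real.log X) := by
        gcongr
        calc Real.log X = b.ℓ₀ / v * (v / b.ℓ₀ * Real.log X) := by field_simp
          _ ≤ _ := by gcongr
    _ = 1 / X := by rw [Real.exp_neg, Real.exp_log hX, one_div]

/-- One sample of the two-point estimator, with rollouts of infinite length. -/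
noncomputable def sampleGrad (P : Plant n m p) (γ : ℝ) (K : Matrix (Fin m) (Fin p) ℝ) (r : ℝ)
    (w : (Fin m → Fin p → ℝ) × (Fin n → ℝ)) : GainSpace m p :=
  ((m * p : ℝ) / (2 * r)) • ((P.rolloutCost γ (K + r • toMat (direction w.1)) w.2 -
    P.rolloutCost γ (K - r • toMat (direction w.1)) w.2) • direction w.1)

/-- One sample of the two-point estimator, with rollouts of length `τ`. -/
noncomputable def truncSampleGrad (P : Plant n m p) (γ : ℝ) (K : Matrix (Fin m) (Fin p) ℝ) (r : ℝ)
    (τ : ℕ) (w : (Fin m → Fin p → ℝ) × (Fin n → ℝ)) : GainSpace m p :=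
  ((m * p : ℝ) / (2 * r)) • ((P.truncCost γ τ (K + r • toMat (direction w.1)) w.2 -
    P.truncCost γ τ (K - r • toMat (direction w.1)) w.2) • direction w.1)

lemma toVec_gradEst (r : ℝ) (τ N : ℕ) (w : ℕ → (Fin m → Fin p → ℝ) × (Fin n → ℝ)) :
    toVec (P.gradEst γ K r τ N w) =
      (N : ℝ)⁻¹ • ∑ i ∈ Finset.range N, P.truncSampleGrad γ K r τ (w i) := by
  have hsum : ∀ f : ℕ → Matrix (Fin m) (Fin p) ℝ,
      toVec (∑ i ∈ Finset.range N, f i) = ∑ i ∈ Finset.range N, toVec (f i) := fun f =>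
    map_sum (AddMonoidHom.mk' (toVec : Matrix (Fin m) (Fin p) ℝ → GainSpace m p) toVec_add) f _
  have hdir : ∀ i, (frob (Matrix.of (w i).1))⁻¹ • Matrix.of (w i).1 = toMat (direction (w i).1) :=
    fun i => (toMat_direction _).symm
  rw [gradEst]
  simp only [hdir]
  rw [toVec_smul, hsum, Finset.smul_sum, Finset.smul_sum]
  refine Finset.sum_congr rfl fun i _ => ?_
  rw [toVec_smul, toVec_toMat, truncSampleGrad, smul_smul (N : ℝ)⁻¹]
  congr 1
  simp only [div_eq_mul_inv, mul_inv]
  ring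

lemma measurable_sampleGrad (P : Plant n m p) (γ : ℝ) (K : Matrix (Fin m) (Fin p) ℝ) (r : ℝ) :
    Measurable (P.sampleGrad γ K r) := by
  have h0 := measurable_rolloutCost P γ
  have hd : Measurable fun w : (Fin m → Fin p → ℝ) × (Fin n → ℝ) => direction w.1 :=
    measurable_direction.comp measurable_fst
  have f1 : Measurable fun w : (Fin m → Fin p → ℝ) × (Fin n → ℝ) =>
      (toVec K + r • direction w.1, w.2) :=
    ((hd.const_smul r).const_add _).prodMk measurable_snd
  have f2 : Measurable fun w : (Fin m → Fin p → ℝ) × (Fin n → ℝ) =>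
      (toVec K - r • direction w.1, w.2) :=
    ((hd.const_smul r).const_sub _).prodMk measurable_snd
  have h1 := h0.comp f1
  have h2 := h0.comp f2
  have h3 := ((h1.sub h2).smul hd).const_smul ((m * p : ℝ) / (2 * r))
  exact h3

section

variable (h : P.Level b γ K ν) {r : ℝ} (hr : 0 < r) (hr' : r ≤ b.rad ν)
include h hr hr'

omit h hr' in
lemma norm_perturbation_le {u : GainSpace m p} (hu : ‖u‖ ≤ 1) :
    ‖r • toMat u‖ ≤ r ∧ ‖-(r • toMat u)‖ ≤ r := by
  have h1 : ‖r • toMat u‖ ≤ r := by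
    rw [norm_smul, Real.norm_of_nonneg hr.le]
    exact mul_le_of_le_one_right hr.le ((norm_toMat_le u).trans hu)
  exact ⟨h1, by rwa [norm_neg]⟩

lemma Level.stable_perturbation {u : GainSpace m p} (hu : ‖u‖ ≤ 1) :
    P.Stable γ (K + r • toMat u) ∧ P.Stable γ (K - r • toMat u) := by
  obtain ⟨h1, h2⟩ := norm_perturbation_le hr hu
  refine ⟨h.stable_add (h1.trans hr'), ?_⟩
  rw [sub_eq_add_neg]
  exact h.stable_add (h2.trans hr')

/-- The two perturbed value matrices differ by at most `lip * r`, which cancels the factor `1 / r`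
of the estimator. The range of a sample therefore does not depend on `r`. -/
lemma Level.norm_sampleGrad_le (hγ : 0 ≤ γ) (w : (Fin m → Fin p → ℝ) × (Fin n → ℝ))
    (hx : en w.2 ≤ d) : ‖P.sampleGrad γ K r w‖ ≤ m * p * b.lip ν / 2 * d ^ 2 := by
  have hu := norm_direction_le w.1
  obtain ⟨h1, h2⟩ := norm_perturbation_le hr hu
  obtain ⟨s1, s2⟩ := h.stable_perturbation hr hr' hu
  have hl := h.lip_pos
  rw [sampleGrad, s1.rolloutCost_eq hγ h.valid, s2.rolloutCost_eq hγ h.valid, ← qf_sub]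
  have h3 : ‖P.valueMat γ (K + r • toMat (direction w.1)) -
      P.valueMat γ (K - r • toMat (direction w.1))‖ ≤ b.lip ν * r := by
    have e1 := h.norm_valueMat_add_sub_le_lip (h1.trans hr')
    have e2 := h.norm_valueMat_add_sub_le_lip (h2.trans hr')
    rw [← sub_eq_add_neg] at e2
    calc _ ≤ ‖P.valueMat γ (K + r • toMat (direction w.1)) - P.valueMat γ K‖ +
          ‖P.valueMat γ (K - r • toMat (direction w.1)) - P.valueMat γ K‖ := by
          rw [← sub_sub_sub_cancel_right _ _ (P.valueMat γ K)]
          exact norm_sub_le _ _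
      _ ≤ b.lip ν / 2 * r + b.lip ν / 2 * r := by
          refine add_le_add (e1.trans ?_) (e2.trans ?_) <;> gcongr
      _ = _ := by ring
  rw [norm_smul, norm_smul, Real.norm_of_nonneg (by positivity), Real.norm_eq_abs]
  have h4 := abs_qf_le (P.valueMat γ (K + r • toMat (direction w.1)) -
      P.valueMat γ (K - r • toMat (direction w.1))) w.2
  have hx0 := en_nonneg w.2
  calc _ ≤ m * p / (2 * r) * ((b.lip ν * r * d ^ 2) * 1) := by
        gcongr
        refine h4.trans ?_
        gcongr
    _ = _ := by field_simp

/-- Error of the truncation of the rollouts. -/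
lemma Level.norm_truncSampleGrad_sub_le (hγ : 0 ≤ γ) (hmp : 1 ≤ min m p) (hd : 0 < d)
    (hr2 : r ≤ ν / b.lip ν) {ε : ℝ} (hε : 0 < ε) {τ : ℕ}
    (hτ : 2 * ν / b.ℓ₀ * Real.log (36 * d ^ 2 * ν ^ 2 * m * p / (r * ε * b.ℓ₀)) ≤ τ)
    (w : (Fin m → Fin p → ℝ) × (Fin n → ℝ)) (hx : en w.2 ≤ d) :
    ‖P.truncSampleGrad γ K r τ w - P.sampleGrad γ K r w‖ ≤ ε / 18 := by
  have hm : (1 : ℝ) ≤ m := by exact_mod_cast (le_min_iff.1 hmp).1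
  have hp : (1 : ℝ) ≤ p := by exact_mod_cast (le_min_iff.1 hmp).2
  have hν := h.level_pos
  have h0 := h.valid.pos
  have hu := norm_direction_le w.1
  obtain ⟨h1, h2⟩ := norm_perturbation_le hr hu
  have hx0 := en_nonneg w.2
  set X : ℝ := 36 * d ^ 2 * ν ^ 2 * m * p / (r * ε * b.ℓ₀) with hX
  have hX0 : 0 < X := by positivity
  have hpow : (1 - b.ℓ₀ / (2 * ν)) ^ τ ≤ 1 / X := h.one_sub_pow_le (by linarith) hX0 hτ
  have key : ∀ Δ : Matrix (Fin m) (Fin p) ℝ, ‖Δ‖ ≤ r →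
      |P.truncCost γ τ (K + Δ) w.2 - P.rolloutCost γ (K + Δ) w.2| ≤ 1 / X * (2 * ν * d ^ 2) := by
    intro Δ hΔ
    have hst := h.stable_add (hΔ.trans hr')
    -- Since `r ≤ ν / lip`, the perturbation adds at most `ν / 2`. The bound `2 ν` fixes the decay
    -- rate, and is the reason for `2 * ν / b.ℓ₀` in the rollout length.
    have hV : ‖P.valueMat γ (K + Δ)‖ ≤ 2 * ν := by
      have e1 := h.norm_valueMat_add_sub_le_lip (hΔ.trans hr')
      have e2 := norm_le_norm_add_norm_sub' (P.valueMat γ (K + Δ)) (P.valueMat γ K)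
      have e3 : b.lip ν / 2 * ‖Δ‖ ≤ b.lip ν / 2 * (ν / b.lip ν) := by
        have := h.lip_pos
        gcongr
        exact hΔ.trans hr2
      have e4 : b.lip ν / 2 * (ν / b.lip ν) = ν / 2 := by
        have := h.lip_pos.ne'
        field_simp
      have e5 := h.norm_valueMat_le
      linarith
    have hVx : ∀ x, qf (P.valueMat γ (K + Δ)) x ≤ 2 * ν * en x ^ 2 := fun x =>
      (le_abs_self _).trans ((abs_qf_le _ x).trans (by gcongr))
    have hnn := qf_nonneg (hst.posSemidef_valueMat h.valid)
    rw [hst.truncCost_eq, hst.rolloutCost_eq hγ h.valid, sub_sub_cancel_left, abs_neg,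
      abs_of_nonneg (hnn _)]
    refine (hst.qf_valueMat_pow_le h.valid (by linarith [h.level_ge]) hVx τ w.2).trans ?_
    gcongr
    · exact hnn _
    · exact (hVx w.2).trans (by gcongr)
  have k1 := key _ h1
  have k2 := key _ h2
  rw [← sub_eq_add_neg] at k2
  rw [truncSampleGrad, sampleGrad, ← smul_sub, ← sub_smul, norm_smul, norm_smul,
    Real.norm_of_nonneg (by positivity), Real.norm_eq_abs]
  set a1 := P.truncCost γ τ (K + r • toMat (direction w.1)) w.2
  set a2 := P.truncCost γ τ (K - r • toMat (direction w.1)) w.2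
  set b1 := P.rolloutCost γ (K + r • toMat (direction w.1)) w.2
  set b2 := P.rolloutCost γ (K - r • toMat (direction w.1)) w.2
  have e : |a1 - a2 - (b1 - b2)| ≤ 2 * (1 / X * (2 * ν * d ^ 2)) := by
    have : a1 - a2 - (b1 - b2) = (a1 - b1) - (a2 - b2) := by ring
    rw [this]
    exact (abs_sub _ _).trans (by linarith)
  calc _ ≤ m * p / (2 * r) * (2 * (1 / X * (2 * ν * d ^ 2)) * 1) := by gcongr
    -- The argument `X` of the logarithm is chosen so that all other parameters cancel here.
    _ = b.ℓ₀ / ν * (ε / 18) := by rw [hX]; field_simp; ring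
    _ ≤ 1 * (ε / 18) := by
        gcongr
        exact (div_le_one hν).2 h.level_ge
    _ = _ := one_mul _

variable [IsProbabilityMeasure 𝒟] (S : P.Setting b 𝒟 d γ)
include S

/-- Bias of the two-point estimator with infinite rollouts. -/
lemma Level.norm_integral_sampleGrad_sub_le :
    ‖∫ w, P.sampleGrad γ K r w ∂(gaussLaw m p).prod 𝒟 - P.costGrad 𝒟 γ K‖ ≤
      2 / 3 * b.smooth m p ν * r := by
  have hγ := S.disc_pos.le
  have hint : Integrable (P.sampleGrad γ K r) ((gaussLaw m p).prod 𝒟) := by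
    refine Integrable.of_bound (measurable_sampleGrad P γ K r).aestronglyMeasurable
      (m * p * b.lip ν / 2 * d ^ 2) ?_
    have hae : ∀ᵐ w ∂(gaussLaw m p).prod 𝒟, en w.2 ≤ d :=
      Measure.quasiMeasurePreserving_snd.ae S.law.ae_en_le
    filter_upwards [hae] with w hw using h.norm_sampleGrad_le hr hr' hγ w hw
  have e : ∫ w, P.sampleGrad γ K r w ∂(gaussLaw m p).prod 𝒟 =
      ((m * p : ℕ) : ℝ) • ∫ u, ((P.cost 𝒟 γ (K + r • toMat u) - P.cost 𝒟 γ (K - r • toMat u)) /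
        (2 * r)) • u ∂directionLaw m p := by
    have hmeas : Measurable fun u : GainSpace m p =>
        ((P.cost 𝒟 γ (K + r • toMat u) - P.cost 𝒟 γ (K - r • toMat u)) / (2 * r)) • u := by
      have h0 := measurable_cost P 𝒟 γ
      have h1 : Measurable fun u : GainSpace m p => P.cost 𝒟 γ (K + r • toMat u) :=
        h0.comp (g := fun v : GainSpace m p => P.cost 𝒟 γ (toMat v))
          (f := fun u => toVec K + r • u) (by fun_prop)
      have h2 : Measurable fun u : GainSpace m p => P.cost 𝒟 γ (K - r • toMat u) :=
        h0.comp (g := fun v : GainSpace m p => P.cost 𝒟 γ (toMat v))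
          (f := fun u => toVec K - r • u) (by fun_prop)
      exact ((h1.sub h2).div_const _).smul measurable_id
    rw [integral_prod _ hint, directionLaw, integral_map measurable_direction.aemeasurable
      hmeas.aestronglyMeasurable, ← integral_smul]
    refine integral_congr_ae (Filter.Eventually.of_forall fun g => ?_)
    obtain ⟨s1, s2⟩ := h.stable_perturbation hr hr' (norm_direction_le g)
    simp only [sampleGrad, s1.rolloutCost_eq hγ h.valid, s2.rolloutCost_eq hγ h.valid]
    rw [integral_smul, integral_smul_const, integral_sub (S.law.integrable_qf _)
      (S.law.integrable_qf _), S.law.integral_qf, S.law.integral_qf,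
      s1.cost_eq hγ h.valid S.law, s2.cost_eq hγ h.valid S.law, smul_smul, smul_smul]
    congr 1
    push_cast
    ring
  rw [e]
  exact h.norm_smoothed_sub_le S hr hr'

omit hr' in
/-- Concentration of the gradient estimate. -/
lemma Level.measure_gradEst_sub_gt_le (hd : 0 < d) {ε δ₀ : ℝ} (hε : 0 < ε) (hδ₀ : 0 < δ₀)
    (hδ₀' : δ₀ ≤ 1) (hrle : r ≤ min (b.rad ν) (min (ν / b.lip ν) (ε / (9 * b.smooth m p ν))))
    {τ N : ℕ}
    (hτ : 2 * ν / b.ℓ₀ * Real.log (36 * d ^ 2 * ν ^ 2 * m * p / (r * ε * b.ℓ₀)) ≤ τ)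
    (hN : 81 * (m * p * b.lip ν) ^ 2 * (d ^ 2 + 1) ^ 2 / ε ^ 2 * Real.log (15 / δ₀) ≤ N) :
    (Measure.infinitePi fun _ : ℕ => (gaussLaw m p).prod 𝒟)
      {w | ε / 3 < ‖toVec (P.gradEst γ K r τ N w) - P.costGrad 𝒟 γ K‖} ≤ ENNReal.ofReal δ₀ := by
  obtain ⟨hr1, hr23⟩ := le_min_iff.1 hrle
  obtain ⟨hr2, hr3⟩ := le_min_iff.1 hr23
  have hmp := S.dim_pos
  have hm : (1 : ℝ) ≤ m := by exact_mod_cast (le_min_iff.1 hmp).1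
  have hp : (1 : ℝ) ≤ p := by exact_mod_cast (le_min_iff.1 hmp).2
  have hγ := S.disc_pos.le
  have hl := h.lip_pos
  have hlog : 0 < Real.log (15 / δ₀) := Real.log_pos (by rw [lt_div_iff₀ hδ₀]; linarith)
  have hN0 : (0 : ℝ) < N := lt_of_lt_of_le (by positivity) hN
  set E := ∫ w, P.sampleGrad γ K r w ∂(gaussLaw m p).prod 𝒟 with hE
  have hbias : ‖E - P.costGrad 𝒟 γ K‖ ≤ 2 / 27 * ε := by
    refine (h.norm_integral_sampleGrad_sub_le hr hr1 S).trans ?_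
    have hs := h.smooth_pos hmp
    rw [le_div_iff₀ (by positivity)] at hr3
    linarith
  set c : ℝ := m * p * b.lip ν * d ^ 2 with hc
  have hc0 : 0 < c := by positivity
  have hae : ∀ᵐ w ∂(gaussLaw m p).prod 𝒟, en w.2 ≤ d :=
    Measure.quasiMeasurePreserving_snd.ae S.law.ae_en_le
  have hint : Integrable (P.sampleGrad γ K r) ((gaussLaw m p).prod 𝒟) := by
    refine Integrable.of_bound (measurable_sampleGrad P γ K r).aestronglyMeasurable
      (m * p * b.lip ν / 2 * d ^ 2) ?_
    filter_upwards [hae] with w hw using h.norm_sampleGrad_le hr hr1 hγ w hw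
  have hEc : ‖E‖ ≤ c / 2 := by
    refine (norm_integral_le_of_norm_le_const (C := c / 2) ?_).trans (by simp)
    filter_upwards [hae] with w hw
    refine (h.norm_sampleGrad_le hr hr1 hγ w hw).trans_eq ?_
    rw [hc]; ring
  have hcenter : ∀ᵐ w ∂(gaussLaw m p).prod 𝒟, ‖P.sampleGrad γ K r w - E‖ ≤ c := by
    filter_upwards [hae] with w hw
    have h1 := h.norm_sampleGrad_le hr hr1 hγ w hw
    have h2 := norm_sub_le (P.sampleGrad γ K r w) E
    have h3 : m * p * b.lip ν / 2 * d ^ 2 = c / 2 := by rw [hc]; ring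
    linarith
  have hconc := measure_norm_sum_ge_le (ν := (gaussLaw m p).prod 𝒟)
    (Y := fun w => P.sampleGrad γ K r w - E) ((measurable_sampleGrad P γ K r).sub_const E) hc0
    hcenter (by rw [integral_sub hint (integrable_const _)]; simp [hE])
    (N := N) (by exact_mod_cast hN0) (t := N * ε / 6) (by positivity)
  have haeall : ∀ᵐ w ∂(Measure.infinitePi fun _ : ℕ => (gaussLaw m p).prod 𝒟),
      ∀ i, en (w i).2 ≤ d :=
    ae_all_iff.2 fun i =>
      (measurePreserving_eval_infinitePi (fun _ : ℕ => (gaussLaw m p).prod 𝒟)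
        i).quasiMeasurePreserving.ae hae
  calc _ ≤ (Measure.infinitePi fun _ : ℕ => (gaussLaw m p).prod 𝒟)
        {w | N * ε / 6 ≤ ‖∑ i ∈ Finset.range N, (P.sampleGrad γ K r (w i) - E)‖} := by
        refine measure_mono_ae ?_
        filter_upwards [haeall] with w hw hbad
        have hbad' : ε / 3 < ‖toVec (P.gradEst γ K r τ N w) - P.costGrad 𝒟 γ K‖ := hbad
        by_contra hcon
        have hcon' : ‖∑ i ∈ Finset.range N, (P.sampleGrad γ K r (w i) - E)‖ < N * ε / 6 :=
          not_le.1 hcon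
        -- Truncation, fluctuation and bias. Their budgets `ε / 18`, `ε / 6` and `2 ε / 27` add up
        -- to `8 ε / 27 < ε / 3`.
        have hdec : toVec (P.gradEst γ K r τ N w) - P.costGrad 𝒟 γ K =
            (N : ℝ)⁻¹ • ∑ i ∈ Finset.range N,
              (P.truncSampleGrad γ K r τ (w i) - P.sampleGrad γ K r (w i)) +
            (N : ℝ)⁻¹ • ∑ i ∈ Finset.range N, (P.sampleGrad γ K r (w i) - E) +
            (E - P.costGrad 𝒟 γ K) := by
          rw [toVec_gradEst, Finset.sum_sub_distrib, Finset.sum_sub_distrib, Finset.sum_const,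
            Finset.card_range, ← Nat.cast_smul_eq_nsmul ℝ, smul_sub, smul_sub, smul_smul,
            inv_mul_cancel₀ hN0.ne', one_smul]
          abel
        have h1 : ‖(N : ℝ)⁻¹ • ∑ i ∈ Finset.range N,
              (P.truncSampleGrad γ K r τ (w i) - P.sampleGrad γ K r (w i))‖ ≤ ε / 18 := by
          rw [norm_smul, norm_inv, Real.norm_of_nonneg hN0.le, inv_mul_le_iff₀ hN0]
          refine (norm_sum_le_of_le _ fun i _ =>
            h.norm_truncSampleGrad_sub_le hr hr1 hγ hmp hd hr2 hε hτ (w i) (hw i)).trans_eq ?_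
          simp
        have h2 : ‖(N : ℝ)⁻¹ • ∑ i ∈ Finset.range N, (P.sampleGrad γ K r (w i) - E)‖ ≤ ε / 6 := by
          rw [norm_smul, norm_inv, Real.norm_of_nonneg hN0.le, inv_mul_le_iff₀ hN0]
          linarith
        rw [hdec] at hbad'
        have h3 := norm_add₃_le (a := (N : ℝ)⁻¹ • ∑ i ∈ Finset.range N,
              (P.truncSampleGrad γ K r τ (w i) - P.sampleGrad γ K r (w i)))
            (b := (N : ℝ)⁻¹ • ∑ i ∈ Finset.range N, (P.sampleGrad γ K r (w i) - E))
            (c := E - P.costGrad 𝒟 γ K)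
        linarith
    _ ≤ _ := hconc
    _ ≤ _ := by
        refine ENNReal.ofReal_le_ofReal ?_
        have h1 : Real.log (15 / δ₀) ≤ (N * ε / 6) ^ 2 / (2 * N * c ^ 2) := by
          have e1 : (N * ε / 6) ^ 2 / (2 * N * c ^ 2) = N * (ε ^ 2 / (72 * c ^ 2)) := by
            field_simp; ring
          rw [e1]
          -- The Hoeffding exponent is `N ε² / (72 c²)`. The prescribed `N` exceeds what is needed,
          -- as `81 ≥ 72` and `d² + 1 ≥ d²`.
          calc Real.log (15 / δ₀) ≤ 81 * (m * p * b.lip ν) ^ 2 * (d ^ 2 + 1) ^ 2 / ε ^ 2 *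
                Real.log (15 / δ₀) * (ε ^ 2 / (72 * c ^ 2)) := by
                have e2 : 81 * (m * p * b.lip ν) ^ 2 * (d ^ 2 + 1) ^ 2 / ε ^ 2 *
                    Real.log (15 / δ₀) * (ε ^ 2 / (72 * c ^ 2)) =
                    (81 / 72 * ((d ^ 2 + 1) / d ^ 2) ^ 2) * Real.log (15 / δ₀) := by
                  rw [hc]; field_simp
                rw [e2]
                refine le_mul_of_one_le_left hlog.le ?_
                have e3 : 1 ≤ (d ^ 2 + 1) / d ^ 2 := by
                  rw [le_div_iff₀ (by positivity)]; linarith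
                nlinarith [one_le_pow₀ (n := 2) e3]
            _ ≤ _ := by gcongr
        calc 2 * Real.exp (-((N * ε / 6) ^ 2 / (2 * N * c ^ 2)))
            ≤ 2 * Real.exp (-Real.log (15 / δ₀)) := by gcongr
          _ = 2 * (δ₀ / 15) := by
              rw [Real.exp_neg, Real.exp_log (by positivity), inv_div]
          _ ≤ δ₀ := by linarith

end

end Plant

end DiscountedSOF

/-! ### Accuracy of the cost estimate. -/

namespace DiscountedSOF

/-- Two-sided Hoeffding inequality for the mean of a bounded nonnegative sample. -/
lemma measure_mean_sub_gt_le {X : Type*} [MeasurableSpace X] {μ : Measure X}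
    [IsProbabilityMeasure μ] {Y : X → ℝ} (hY : Measurable Y) {c : ℝ} (hc : 0 < c)
    (hb : ∀ᵐ w ∂μ, Y w ∈ Set.Icc 0 c) {N : ℕ} (hN : 0 < N) {t : ℝ} (ht : 0 ≤ t) :
    (Measure.infinitePi fun _ : ℕ => μ)
      {w | t < |1 / (N : ℝ) * ∑ i ∈ Finset.range N, Y (w i) - ∫ x, Y x ∂μ|} ≤
      ENNReal.ofReal (2 * Real.exp (-(2 * N * t ^ 2 / c ^ 2))) := by
  have hN' : (0 : ℝ) < N := by exact_mod_cast hN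
  set E := ∫ x, Y x ∂μ with hE
  set Pr : Measure (ℕ → X) := Measure.infinitePi fun _ : ℕ => μ with hPr
  have hsub : HasSubgaussianMGF (fun x => Y x - E) ((‖c - 0‖₊ / 2) ^ 2) μ :=
    hasSubgaussianMGF_of_mem_Icc hY.aemeasurable hb
  have hcoe : (((‖c - 0‖₊ / 2) ^ 2 : NNReal) : ℝ) = c ^ 2 / 4 := by
    push_cast
    rw [sub_zero, Real.norm_of_nonneg hc.le]
    ring
  have hlift : ∀ Z : X → ℝ, Measurable Z → HasSubgaussianMGF Z ((‖c - 0‖₊ / 2) ^ 2) μ →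
      Pr.real {w | N * t ≤ ∑ i ∈ Finset.range N, Z (w i)} ≤
        Real.exp (-(2 * N * t ^ 2 / c ^ 2)) := by
    intro Z hZ hs
    have hind : iIndepFun (fun (i : ℕ) (w : ℕ → X) => Z (w i)) Pr :=
      iIndepFun_infinitePi (X := fun _ => Z) fun _ => hZ
    have hsub' : ∀ i < N, HasSubgaussianMGF (fun w : ℕ → X => Z (w i))
        ((‖c - 0‖₊ / 2) ^ 2) Pr := fun i _ => by
      have hmp := measurePreserving_eval_infinitePi (fun _ : ℕ => μ) i
      exact HasSubgaussianMGF.of_map (Y := Function.eval i) (X := Z) hmp.measurable.aemeasurable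
        (by rw [hmp.map_eq]; exact hs)
    refine (HasSubgaussianMGF.measure_sum_range_ge_le_of_iIndepFun hind hsub'
      (ε := N * t) (by positivity)).trans_eq ?_
    rw [hcoe]
    congr 1
    field_simp
    ring
  have h1 := hlift _ (hY.sub_const E) hsub
  have h2 := hlift _ (hY.sub_const E).neg hsub.neg
  have hset : {w : ℕ → X | t < |1 / (N : ℝ) * ∑ i ∈ Finset.range N, Y (w i) - E|} ⊆
      {w | N * t ≤ ∑ i ∈ Finset.range N, (Y (w i) - E)} ∪
        {w | N * t ≤ ∑ i ∈ Finset.range N, (-(fun x => Y x - E)) (w i)} := by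
    intro w hw
    have hw' : t < |1 / (N : ℝ) * ∑ i ∈ Finset.range N, Y (w i) - E| := hw
    have e : ∑ i ∈ Finset.range N, (Y (w i) - E) =
        N * (1 / (N : ℝ) * ∑ i ∈ Finset.range N, Y (w i) - E) := by
      rw [Finset.sum_sub_distrib, Finset.sum_const, Finset.card_range, nsmul_eq_mul]
      field_simp
    have e' : ∑ i ∈ Finset.range N, (-(fun x => Y x - E)) (w i) =
        N * -(1 / (N : ℝ) * ∑ i ∈ Finset.range N, Y (w i) - E) := by
      simp only [Pi.neg_apply, Finset.sum_neg_distrib]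
      rw [e]
      ring
    rcases lt_abs.1 hw' with h | h
    · left
      rw [Set.mem_ofPred_eq, e]
      gcongr
    · right
      rw [Set.mem_ofPred_eq, e']
      gcongr
  refine (measure_mono hset).trans ((measure_union_le _ _).trans ?_)
  rw [two_mul, ENNReal.ofReal_add (Real.exp_pos _).le (Real.exp_pos _).le]
  refine add_le_add ?_ ?_
  · rw [← ofReal_measureReal]
    exact ENNReal.ofReal_le_ofReal h1
  · rw [← ofReal_measureReal]
    exact ENNReal.ofReal_le_ofReal h2

namespace Plant

variable {n m p : ℕ} {P : Plant n m p} {γ ν : ℝ} {K : Matrix (Fin m) (Fin p) ℝ} {b : Bounds}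
  {𝒟 : Measure (Fin n → ℝ)} {d : ℝ}

/-- The residual cost fraction after the prescribed rollout length. -/
lemma Level.residual_pow_lt (h : P.Level b γ K ν) (hν : b.ℓ₀ < ν) {D : ℝ} (hD : 1 ≤ D) {τ : ℕ}
    (hτ : 2 * ν / b.ℓ₀ * Real.log (ν * D / b.ℓ₀) ≤ τ) : (1 - b.ℓ₀ / ν) ^ τ < 1 / 3 := by
  have h0 := h.valid.pos
  have hν0 := h.level_pos
  set a := ν / b.ℓ₀ with ha
  have ha1 : 1 < a := (one_lt_div h0).2 hν
  have ea : b.ℓ₀ / ν = a⁻¹ := by rw [ha, inv_div]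
  have hq0 : 0 ≤ 1 - a⁻¹ := sub_nonneg.2 (inv_le_one_of_one_le₀ ha1.le)
  have hq1 : 1 - a⁻¹ ≤ 1 := by linarith [inv_pos.2 (zero_lt_one.trans ha1)]
  have hlog : 2 * a * Real.log a ≤ τ := by
    refine le_trans ?_ hτ
    have e1 : 2 * ν / b.ℓ₀ = 2 * a := by rw [ha]; ring
    have e2 : ν * D / b.ℓ₀ = a * D := by rw [ha]; ring
    rw [e1, e2]
    gcongr
    nlinarith
  rw [ea]
  -- Three ranges of `a = ν / ℓ₀ > 1`. Below `3/2` a single step leaves less than `1/3`. On `[3/2,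
  -- 2]` one has `2 a log a > 1`, so `τ ≥ 2` and at most `1/4` is left. Beyond 2 the exponential
  -- bound gives `a⁻² ≤ 1/4`. The strict inequality `a > 1` matters: for `a = D = 1` the length `τ =
  -- 0` is allowed, and then everything is left.
  rcases lt_or_ge a (3 / 2) with h1 | h1
  · have hτ1 : 1 ≤ τ := by
      have : (0 : ℝ) < τ := lt_of_lt_of_le (by have := Real.log_pos ha1; positivity) hlog
      exact_mod_cast this
    calc (1 - a⁻¹) ^ τ ≤ (1 - a⁻¹) ^ 1 := pow_le_pow_of_le_one hq0 hq1 hτ1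
      _ < 1 / 3 := by
        have : (3 / 2 : ℝ)⁻¹ < a⁻¹ := inv_strictAnti₀ (by linarith) h1
        norm_num at this ⊢
        linarith
  rcases le_total a 2 with h2 | h2
  · have hτ2 : 2 ≤ τ := by
      have e : (1 / 3 : ℝ) < Real.log (3 / 2) := by
        have := Real.log_lt_sub_one_of_pos (x := 2 / 3) (by norm_num) (by norm_num)
        rw [show (3 / 2 : ℝ) = (2 / 3)⁻¹ by norm_num, Real.log_inv]
        linarith
      have e2 : Real.log (3 / 2) ≤ Real.log a := Real.log_le_log (by norm_num) h1
      have : (1 : ℝ) < τ := lt_of_lt_of_le (by nlinarith) hlog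
      exact_mod_cast this
    have h3 : 1 - a⁻¹ ≤ 1 / 2 := by
      have : (2 : ℝ)⁻¹ ≤ a⁻¹ := inv_anti₀ (by linarith) h2
      norm_num at this ⊢
      linarith
    calc (1 - a⁻¹) ^ τ ≤ (1 - a⁻¹) ^ 2 := pow_le_pow_of_le_one hq0 hq1 hτ2
      _ ≤ (1 / 2) ^ 2 := by gcongr
      _ < 1 / 3 := by norm_num
  · have h3 := h.one_sub_pow_le le_rfl (τ := τ) (X := a ^ 2) (by positivity) (by
      rw [Real.log_pow]
      push_cast
      linarith)
    rw [ea] at h3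
    refine h3.trans_lt (one_div_lt_one_div_of_lt (by norm_num) ?_)
    nlinarith

/-- The matrix of the truncated cost as a quadratic form in the initial state. -/
noncomputable def truncMat (P : Plant n m p) (γ : ℝ) (K : Matrix (Fin m) (Fin p) ℝ) (τ : ℕ) :
    Matrix (Fin n) (Fin n) ℝ :=
  P.valueMat γ K - (P.damped γ K ^ τ)ᵀ * P.valueMat γ K * P.damped γ K ^ τ

lemma Stable.qf_truncMat (h : P.Stable γ K) (τ : ℕ) (x : Fin n → ℝ) :
    qf (P.truncMat γ K τ) x = P.truncCost γ τ K x := by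
  rw [truncMat, qf_sub, qf_conj, h.truncCost_eq]

lemma truncCost_nonneg (hb : b.Valid P) (τ : ℕ) (x : Fin n → ℝ) : 0 ≤ P.truncCost γ τ K x := by
  refine Finset.sum_nonneg fun t _ => ?_
  rw [stageCost_eq]
  exact qf_nonneg (hb.posSemidef_stageMat K) _

lemma Stable.posSemidef_truncMat (h : P.Stable γ K) (hb : b.Valid P) (τ : ℕ) :
    (P.truncMat γ K τ).PosSemidef := by
  refine Matrix.PosSemidef.of_dotProduct_mulVec_nonneg ?_ fun x => ?_
  · have hV := h.valueMat_symm hb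
    change (P.truncMat γ K τ)ᴴ = _
    rw [Matrix.conjTranspose_eq_transpose_of_trivial, truncMat]
    simp only [Matrix.transpose_sub, Matrix.transpose_mul, Matrix.transpose_transpose, hV,
      Matrix.mul_assoc]
  · have := h.qf_truncMat τ x ▸ truncCost_nonneg hb τ x
    simpa [qf] using this

variable [IsProbabilityMeasure 𝒟]

/-- The cost estimate is accurate up to half of the cost, with high probability. -/
lemma Level.measure_costEst_le (h : P.Level b γ K ν) (S : P.Setting b 𝒟 d γ) (hn : 1 ≤ n)
    (hν : b.ℓ₀ < ν) {δ₁ : ℝ} (hδ₁ : 0 < δ₁) (hδ₁' : δ₁ < 1) {τ N : ℕ}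
    (hτ : 2 * ν / b.ℓ₀ * Real.log (ν * d ^ 2 / b.ℓ₀) ≤ τ)
    (hN : 8 * d ^ 4 * Real.log (2 / δ₁) ≤ N) :
    (Measure.infinitePi fun _ : ℕ => 𝒟)
      {z | ¬ (P.cost 𝒟 γ K < 2 * P.costEst γ τ N K z ∧
        2 * P.costEst γ τ N K z ≤ 3 * P.cost 𝒟 γ K)} ≤ ENNReal.ofReal δ₁ := by
  have h0 := h.valid.pos
  have hn' : (1 : ℝ) ≤ n := by exact_mod_cast hn
  have hd1 : 1 ≤ d ^ 2 := hn'.trans S.law.dim_le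
  have hd0 : d ≠ 0 := by rintro rfl; norm_num at hd1
  have hst := h.stable
  have hJ := hst.cost_eq S.disc_pos.le h.valid S.law
  set J := P.cost 𝒟 γ K with hJdef
  have hJ0 : 0 < J := by
    rw [hJ]
    exact lt_of_lt_of_le (by positivity) (hst.trace_valueMat_ge h.valid)
  set T := (P.truncMat γ K τ).trace with hT
  have hq := h.residual_pow_lt hν hd1 hτ
  have hTle : T ≤ J := by
    rw [hJ]
    refine trace_le_of_qf_le fun x => ?_
    rw [hst.qf_truncMat, hst.truncCost_eq]
    linarith [qf_nonneg (hst.posSemidef_valueMat h.valid) (P.damped γ K ^ τ *ᵥ x)]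
  -- `T` is the mean of the truncated cost; less than a third of the cost lies beyond the horizon.
  have hTgt : 2 / 3 * J < T := by
    refine lt_of_lt_of_le (b := (1 - (1 - b.ℓ₀ / ν) ^ τ) * J) (by gcongr; linarith) ?_
    rw [hJ, ← smul_eq_mul, ← Matrix.trace_smul]
    refine trace_le_of_qf_le fun x => ?_
    rw [qf_smul, hst.qf_truncMat, hst.truncCost_eq]
    have h1 := hst.qf_valueMat_pow_le h.valid h.level_ge h.qf_valueMat_le τ x
    have h2 := qf_nonneg (hst.posSemidef_valueMat h.valid) x
    nlinarith
  have hT0 : 0 < T := by linarith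
  have hY : Measurable (P.truncCost γ τ K) :=
    (P.continuous_truncCost (κ := fun _ => K) (g := fun _ => γ) continuous_const continuous_id
      continuous_const τ).measurable
  have hmean : ∫ x, P.truncCost γ τ K x ∂𝒟 = T := by
    rw [hT, ← S.law.integral_qf]
    simp only [hst.qf_truncMat]
  have hlog : 0 < Real.log (2 / δ₁) := Real.log_pos (by rw [lt_div_iff₀ hδ₁]; linarith)
  have hN0 : (0 : ℝ) < N := lt_of_lt_of_le (by positivity) hN
  -- The sample range `T d²` and the tolerance `T / 4` are both proportional to `T`. The exponent
  -- becomes `N / (8 d⁴)`, so the sample size does not depend on the level `ν`.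
  have key := measure_mean_sub_gt_le (μ := 𝒟) hY (c := T * d ^ 2) (by positivity) (by
      filter_upwards [S.law.ae_en_le] with x hx
      refine ⟨truncCost_nonneg h.valid τ x, ?_⟩
      rw [← hst.qf_truncMat]
      refine (qf_le_trace (hst.posSemidef_truncMat h.valid τ) x).trans ?_
      have := en_nonneg x
      gcongr) (N := N) (by exact_mod_cast hN0) (t := T / 4) (by positivity)
  refine (measure_mono ?_).trans (key.trans (ENNReal.ofReal_le_ofReal ?_))
  · intro z hz
    rw [Set.mem_ofPred_eq]
    by_contra hcon
    rw [hmean, not_lt, abs_le] at hcon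
    refine hz ?_
    rw [costEst]
    -- An estimate within `T / 4` of `T` satisfies `2 Ĵ ≥ 3/2 T > J` and `2 Ĵ ≤ 5/2 T ≤ 3 J`.
    constructor <;> linarith
  · have e : 2 * (N : ℝ) * (T / 4) ^ 2 / (T * d ^ 2) ^ 2 = N / (8 * d ^ 4) := by
      field_simp
      ring
    have h1 : Real.log (2 / δ₁) ≤ N / (8 * d ^ 4) := by
      rw [le_div_iff₀ (by positivity)]
      linarith
    rw [e]
    calc 2 * Real.exp (-(N / (8 * d ^ 4))) ≤ 2 * Real.exp (-Real.log (2 / δ₁)) := by gcongr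
      _ = δ₁ := by
        rw [Real.exp_neg, Real.exp_log (by positivity)]
        field_simp

end Plant

end DiscountedSOF

/-! ### Gradient descent with inexact gradients, and increase of the discount factor. -/

namespace DiscountedSOF

namespace Plant

variable {n m p : ℕ} {P : Plant n m p} {γ ν ε : ℝ} {K : Matrix (Fin m) (Fin p) ℝ} {b : Bounds}
  {𝒟 : Measure (Fin n → ℝ)} {d : ℝ}

section Descent

variable (h : P.Level b γ K ν) (hε : 0 < ε)
include h hε

omit hε in
lemma Level.gradBound_nonneg : 0 ≤ b.gradBound m p ν := by
  have hκ := h.one_le_kappa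
  have hψ := h.valid.one_le_psi
  have hφ := h.valid.one_le_phi
  have hl := h.valid.l1_pos
  have hν := h.level_pos
  rw [Bounds.gradBound]
  positivity

lemma Level.step_pos (hmp : 1 ≤ min m p) : 0 < b.step m p ε ν := by
  have h1 := h.gradBound_nonneg
  have h2 := h.rad_pos
  have h3 := h.smooth_pos hmp
  exact lt_min (by positivity) (by positivity)

lemma Level.iterBound_pos (hmp : 1 ≤ min m p) : 0 < b.iterBound m p ε ν := by
  have h1 := h.step_pos hε hmp
  have h2 := h.level_pos
  rw [Bounds.iterBound]
  positivity

variable [IsProbabilityMeasure 𝒟] (S : P.Setting b 𝒟 d γ)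
include S

/-- One gradient step with a large and accurate gradient estimate. -/
lemma Level.descent {g : Matrix (Fin m) (Fin p) ℝ}
    (hg : ‖toVec g - P.costGrad 𝒟 γ K‖ ≤ ε / 3) (hbig : 2 * ε / 3 < frob g) :
    P.Level b γ (K - b.step m p ε ν • g) ν ∧
      P.cost 𝒟 γ (K - b.step m p ε ν • g) ≤ P.cost 𝒟 γ K - b.step m p ε ν * ε ^ 2 / 9 := by
  set η := b.step m p ε ν with hη
  have hη0 : 0 < η := h.step_pos hε S.dim_pos
  have hL := h.smooth_pos S.dim_pos
  have hG := h.gradBound_nonneg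
  have hη1 : η * (b.gradBound m p ν + ε) ≤ b.rad ν := by
    rw [← le_div_iff₀ (by positivity)]
    exact min_le_left _ _
  have hη2 : η * (2 * b.smooth m p ν) ≤ 1 := by
    rw [← le_div_iff₀ (by positivity)]
    exact min_le_right _ _
  rw [frob_eq] at hbig
  set v := toVec g with hv
  have hgv : g = toMat v := rfl
  have hnv : ‖v‖ ≤ b.gradBound m p ν + ε := by
    have h1 := h.norm_costGrad_le S
    have h2 := norm_le_norm_add_norm_sub' v (P.costGrad 𝒟 γ K)
    linarith
  have hstep : ‖-(η • v)‖ ≤ b.rad ν := by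
    rw [norm_neg, norm_smul, Real.norm_of_nonneg hη0.le]
    exact (mul_le_mul_of_nonneg_left hnv hη0.le).trans hη1
  have heq : K - η • g = K + toMat (-(η • v)) := by
    rw [hgv, toMat_neg, toMat_smul, sub_eq_add_neg]
  have hexp := (abs_le.1 (h.abs_cost_sub_inner_le S hstep)).2
  rw [← heq] at hexp
  have hinner : Inner.inner ℝ (P.costGrad 𝒟 γ K) (-(η • v)) ≤ -η * ‖v‖ ^ 2 + η * (ε / 3 * ‖v‖) := by
    rw [inner_neg_right, inner_smul_right]
    have e1 : Inner.inner ℝ (P.costGrad 𝒟 γ K) v =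
        ‖v‖ ^ 2 - Inner.inner ℝ (v - P.costGrad 𝒟 γ K) v := by
      rw [inner_sub_left, real_inner_self_eq_norm_sq]
      ring
    have e2 := (real_inner_le_norm (v - P.costGrad 𝒟 γ K) v).trans
      (mul_le_mul_of_nonneg_right hg (norm_nonneg v))
    rw [e1]
    nlinarith
  have hcost : P.cost 𝒟 γ (K - η • g) ≤ P.cost 𝒟 γ K - η * ε ^ 2 / 9 := by
    rw [norm_neg, norm_smul, Real.norm_of_nonneg hη0.le] at hexp
    -- The second-order term is absorbed by `η L ≤ 1/2`. The decrease `η (11/12 ‖v‖² - ε/3 ‖v‖)`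
    -- that remains is at least `5/27 η ε²` when `‖v‖ > 2 ε / 3`.
    have e3 : b.smooth m p ν / 6 * (η * ‖v‖) ^ 2 ≤ η / 12 * ‖v‖ ^ 2 := by
      have : b.smooth m p ν / 6 * (η * ‖v‖) ^ 2 =
          (η * (2 * b.smooth m p ν)) * (η / 12 * ‖v‖ ^ 2) := by ring
      rw [this]
      exact mul_le_of_le_one_left (by positivity) hη2
    have e4 : ε ^ 2 / 9 ≤ 11 / 12 * ‖v‖ ^ 2 - ε / 3 * ‖v‖ := by nlinarith
    nlinarith
  refine ⟨⟨h.valid, h.disc_le, h.level_ge, ?_, ?_⟩, hcost⟩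
  · rw [heq]
    exact h.stable_add ((norm_toMat_le _).trans hstep)
  · have hst : P.Stable γ (K - η • g) := by
      rw [heq]
      exact h.stable_add ((norm_toMat_le _).trans hstep)
    rw [← hst.cost_eq S.disc_pos.le h.valid S.law]
    refine hcost.trans ?_
    rw [h.stable.cost_eq S.disc_pos.le h.valid S.law]
    have := h.trace_le
    have : 0 ≤ η * ε ^ 2 / 9 := by positivity
    linarith

omit h in
/-- Gradient descent with accurate gradient estimates meets the stopping test. -/
lemma Level.exists_meets_test {κ g : ℕ → Matrix (Fin m) (Fin p) ℝ} (h : P.Level b γ (κ 0) ν)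
    (hκ : ∀ j, κ (j + 1) = κ j - b.step m p ε ν • g j)
    (hg : ∀ j ≤ ⌊b.iterBound m p ε ν⌋₊, P.Level b γ (κ j) ν →
      ‖toVec (g j) - P.costGrad 𝒟 γ (κ j)‖ ≤ ε / 3) :
    ∃ j, frob (g j) ≤ 2 * ε / 3 ∧ (∀ i < j, ¬ frob (g i) ≤ 2 * ε / 3) ∧
      P.Level b γ (κ j) ν ∧ ‖P.costGrad 𝒟 γ (κ j)‖ ≤ ε := by
  set M := b.iterBound m p ε ν with hM
  have hM0 : 0 < M := h.iterBound_pos hε S.dim_pos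
  have hη0 := h.step_pos hε S.dim_pos
  have hν := h.level_pos
  -- `M` is the number of guaranteed decreases that would use up the whole budget `ν`.
  have hdrop : b.step m p ε ν * ε ^ 2 / 9 = ν / M := by
    rw [hM, Bounds.iterBound]
    field_simp
  have key : ∀ j ≤ ⌊M⌋₊ + 1, (∀ i < j, ¬ frob (g i) ≤ 2 * ε / 3) →
      P.Level b γ (κ j) ν ∧ P.cost 𝒟 γ (κ j) ≤ ν - j * (ν / M) := by
    intro j
    induction j with
    | zero =>
      intro _ _
      refine ⟨h, ?_⟩
      rw [h.stable.cost_eq S.disc_pos.le h.valid S.law]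
      simpa using h.trace_le
    | succ j ih =>
      intro hj hns
      obtain ⟨h1, h2⟩ := ih (by omega) fun i hi => hns i (by omega)
      obtain ⟨h3, h4⟩ := h1.descent hε S (hg j (by omega) h1) (not_le.1 (hns j (by omega)))
      rw [← hκ] at h3 h4
      refine ⟨h3, ?_⟩
      rw [hdrop] at h4
      push_cast
      linarith
  -- If the test failed at all of the steps `0, …, ⌊M⌋`, then `⌊M⌋ + 1 > M` decreases would make the
  -- nonnegative cost negative. Hence at most `⌊M⌋ + 1` gradient estimates are ever used.
  have hex : ∃ j, frob (g j) ≤ 2 * ε / 3 ∧ j ≤ ⌊M⌋₊ := by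
    by_contra! hcon
    obtain ⟨h1, h2⟩ := key (⌊M⌋₊ + 1) le_rfl fun i hi hle => by
      have := hcon i hle
      omega
    have h3 : 0 ≤ P.cost 𝒟 γ (κ (⌊M⌋₊ + 1)) := ENNReal.toReal_nonneg
    have h4 : M < (⌊M⌋₊ : ℝ) + 1 := Nat.lt_floor_add_one M
    have h5 : ν < ((⌊M⌋₊ : ℝ) + 1) * (ν / M) := by
      rw [← mul_div_assoc, lt_div_iff₀ hM0]
      nlinarith
    push_cast at h2
    linarith
  classical
  obtain ⟨j₀, hj₀, hj₀M⟩ := hex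
  have hex' : ∃ j, frob (g j) ≤ 2 * ε / 3 := ⟨j₀, hj₀⟩
  obtain ⟨j, hspec, hmin⟩ : ∃ j, frob (g j) ≤ 2 * ε / 3 ∧ ∀ i < j, ¬ frob (g i) ≤ 2 * ε / 3 :=
    ⟨Nat.find hex', Nat.find_spec hex', fun i hi => Nat.find_min hex' hi⟩
  have hjM : j ≤ ⌊M⌋₊ := (not_lt.1 fun hlt => hmin _ hlt hj₀).trans hj₀M
  have hlev := (key j (by omega) hmin).1
  refine ⟨j, hspec, hmin, hlev, ?_⟩
  have h1 := hg j hjM hlev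
  rw [frob_eq] at hspec
  have h2 := norm_le_norm_add_norm_sub (toVec (g j)) (P.costGrad 𝒟 γ (κ j))
  linarith

/-- There are nearly stationary gains. -/
lemma Level.exists_norm_costGrad_le : ∃ K', P.Stable γ K' ∧ ‖P.costGrad 𝒟 γ K'‖ ≤ ε := by
  let κ : ℕ → Matrix (Fin m) (Fin p) ℝ := fun j =>
    Nat.rec K (fun _ K' => K' - b.step m p ε ν • toMat (P.costGrad 𝒟 γ K')) j
  obtain ⟨j, -, -, h1, h2⟩ := Level.exists_meets_test hε S (κ := κ)
    (g := fun j => toMat (P.costGrad 𝒟 γ (κ j))) h (fun j => rfl) fun j _ _ => by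
      rw [toVec_toMat, sub_self, norm_zero]
      positivity
  exact ⟨κ j, h1.stable, h2⟩

end Descent

lemma damped_mul {t : ℝ} (ht : 0 ≤ t) (γ : ℝ) (K : Matrix (Fin m) (Fin p) ℝ) :
    P.damped (t * γ) K = √t • P.damped γ K := by
  rw [damped, damped, Real.sqrt_mul ht, smul_smul]

/-- Effect of an increase of the discount factor on stability and cost. -/
lemma Stable.mul_disc (h : P.Stable γ K) (hb : b.Valid P) {ζ α : ℝ} (hζ : 0 ≤ ζ) (hζ' : ζ < 1)
    (hα : 0 ≤ α) (hM : ∀ x, α * qf (P.valueMat γ K) x ≤ (1 + α) * qf (P.stageMat K) x) :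
    P.Stable ((1 + ζ * α) * γ) K ∧
      (P.valueMat ((1 + ζ * α) * γ) K).trace ≤ (P.valueMat γ K).trace / (1 - ζ) := by
  have h0 := hb.pos
  have hζ1 : 0 < 1 - ζ := by linarith
  have hV := qf_nonneg (h.posSemidef_valueMat hb)
  -- With `V` and `Q_K` evaluated at `x`, the new value after one step is `(1 + ζ α)(V - Q_K) = V -
  -- Q_K + ζ (α V - α Q_K)`, and `hM` bounds the last bracket by `Q_K`.
  have step : ∀ x, qf (P.valueMat γ K) (P.damped ((1 + ζ * α) * γ) K *ᵥ x) ≤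
      qf (P.valueMat γ K) x - (1 - ζ) * qf (P.stageMat K) x := by
    intro x
    rw [damped_mul (by positivity), Matrix.smul_mulVec, qf_smul_vec, Real.sq_sqrt (by positivity),
      h.qf_valueMat_damped]
    have := mul_le_mul_of_nonneg_left (hM x) hζ
    linarith
  have hst : P.Stable ((1 + ζ * α) * γ) K := by
    refine ⟨_, PowSqBound.of_lyapunov (P := P.valueMat γ K) (c := (1 - ζ) * b.ℓ₀) (by positivity)
      hV fun x => (step x).trans ?_⟩
    have := mul_le_mul_of_nonneg_left (hb.qf_stageMat_ge' K x) hζ1.le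
    linarith
  refine ⟨hst, ?_⟩
  rw [div_eq_inv_mul, ← smul_eq_mul (1 - ζ)⁻¹, ← Matrix.trace_smul]
  refine trace_le_of_qf_le fun x => ?_
  rw [qf_smul]
  refine le_of_tendsto' (hst.hasSum_qf x).tendsto_sum_nat fun N => ?_
  rw [← div_eq_inv_mul, le_div_iff₀ hζ1]
  -- The old value function pays for `1 - ζ` times the running cost of the new trajectory.
  -- Telescoping gives the factor `1 / (1 - ζ)`.
  have : ∀ N : ℕ, (∑ t ∈ Finset.range N,
      qf (P.stageMat K) (P.damped ((1 + ζ * α) * γ) K ^ t *ᵥ x)) * (1 - ζ) ≤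
      qf (P.valueMat γ K) x -
        qf (P.valueMat γ K) (P.damped ((1 + ζ * α) * γ) K ^ N *ᵥ x) := by
    intro N
    induction N with
    | zero => simp
    | succ N ih =>
      rw [Finset.sum_range_succ, pow_succ', ← Matrix.mulVec_mulVec]
      have := step (P.damped ((1 + ζ * α) * γ) K ^ N *ᵥ x)
      linarith
  have h1 := hV (P.damped ((1 + ζ * α) * γ) K ^ N *ᵥ x)
  linarith [this N]

lemma closedLoop_zero : P.closedLoop 0 = P.A := by simp [closedLoop]

lemma specRad_zero : specRad (0 : Matrix (Fin n) (Fin n) ℝ) = 0 := by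
  rw [specRad]
  have : (0 : Matrix (Fin n) (Fin n) ℝ).map (algebraMap ℝ ℂ) = 0 := by
    ext i j
    simp
  rw [this, spectrum.spectralRadius_zero, ENNReal.toReal_zero]

lemma A_ne_zero (hA : 1 ≤ specRad P.A) : P.A ≠ 0 := by
  intro h
  rw [h, specRad_zero] at hA
  linarith

lemma one_le_dim (hA : 1 ≤ specRad P.A) : 1 ≤ n := by
  by_contra! hn
  obtain rfl : n = 0 := by omega
  exact A_ne_zero hA (Subsingleton.elim _ _)

/-- Without inputs or outputs the closed loop is `A` itself, which is not stable. -/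
lemma one_le_min_of_stabilizable (hA : 1 ≤ specRad P.A)
    (hstab : ∃ K, specRad (P.closedLoop K) < 1) : 1 ≤ min m p := by
  obtain ⟨K, hK⟩ := hstab
  by_contra! hmp
  have h0 : P.B * K * P.C = 0 := by
    rcases (by omega : m = 0 ∨ p = 0) with rfl | rfl
    · rw [Subsingleton.elim K 0, Matrix.mul_zero, Matrix.zero_mul]
    · rw [Subsingleton.elim P.C 0, Matrix.mul_zero]
  rw [closedLoop, h0, sub_zero] at hK
  linarith

lemma disc_lt_one (hA : 1 ≤ specRad P.A) (hγ' : γ < 1 / specRad P.A ^ 2) : γ < 1 := by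
  refine hγ'.trans_le ?_
  rw [div_le_one (by positivity)]
  exact one_le_pow₀ hA

lemma stable_zero (hA : 1 ≤ specRad P.A) (hγ : 0 < γ) (hγ' : γ < 1 / specRad P.A ^ 2) :
    P.Stable γ 0 := by
  rw [← mem_stabSet_iff hγ]
  change √γ * specRad (P.closedLoop 0) < 1
  rw [closedLoop_zero]
  have h0 : 0 < specRad P.A := by linarith
  rw [lt_div_iff₀ (by positivity)] at hγ'
  have : (√γ * specRad P.A) ^ 2 < 1 := by rwa [mul_pow, Real.sq_sqrt hγ.le]
  exact (sq_lt_one_iff₀ (by positivity)).1 this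

/-- Keeping two terms of the Lyapunov series gives `V ⪰ ℓ₀ (1 + A'ᵀ A')` with `A' ≠ 0`. The strict
inequality at `K = 0` starts the invariant `ν > ℓ₀` on which `residual_pow_lt` depends. -/
lemma Stable.lt_trace_valueMat_zero (h : P.Stable γ 0) (hb : b.Valid P) (hA : 1 ≤ specRad P.A)
    (hγ : 0 < γ) : b.ℓ₀ < (P.valueMat γ 0).trace := by
  have h0 := hb.pos
  set A' := P.damped γ 0 with hA'
  have h1 : (b.ℓ₀ • (1 + A'ᵀ * 1 * A')).trace ≤ (P.valueMat γ 0).trace := by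
    refine trace_le_of_qf_le fun x => ?_
    rw [qf_smul, qf_add, qf_conj, qf_one, qf_one, mul_add]
    have e1 := h.qf_valueMat_ge hb (A' *ᵥ x)
    rw [h.qf_valueMat_damped] at e1
    have e2 := hb.qf_stageMat_ge' 0 x
    linarith
  have h2 : (A'ᵀ * 1 * A').trace = fsq A' := by
    rw [trace_conj, fsq_eq_sum_en]
    simp [qf_one]
  have h3 : 0 < fsq A' := by
    refine (fsq_nonneg _).lt_of_ne fun h4 => A_ne_zero hA ?_
    have h5 := norm_sq_le_fsq A'
    rw [← h4] at h5
    have h6 : A' = 0 := norm_eq_zero.1 (pow_eq_zero_iff two_ne_zero |>.1 (le_antisymm h5 (sq_nonneg _)))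
    rw [hA', damped, closedLoop_zero] at h6
    exact (smul_eq_zero.1 h6).resolve_left (Real.sqrt_pos.2 hγ).ne'
  rw [Matrix.trace_smul, Matrix.trace_add, h2, Matrix.trace_one, Fintype.card_fin,
    smul_eq_mul] at h1
  have h4 : (1 : ℝ) ≤ n := by exact_mod_cast one_le_dim hA
  nlinarith

end Plant

end DiscountedSOF

/-! ### Deterministic analysis of a run with accurate estimates. -/

namespace DiscountedSOF

variable {n m p : ℕ} {P : Plant n m p} {𝒟 : Measure (Fin n → ℝ)} {d : ℝ} {b : Bounds}
  {c : Config m p} {Jbar : ℝ} {ω : Noise n m p} {k : ℕ} {s : State m p}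

/-- Hypotheses under which the algorithm is analysed. -/
structure Assumptions (P : Plant n m p) (𝒟 : Measure (Fin n → ℝ)) (d : ℝ) (b : Bounds)
    (c : Config m p) (Jbar : ℝ) : Prop where
  valid : b.Valid P
  law : IsInitialLaw 𝒟 d
  unstable : 1 ≤ specRad P.A
  dim_pos : 1 ≤ min m p
  eps_pos : 0 < c.ε
  zeta_pos : 0 < c.ζ
  zeta_lt : c.ζ < 1
  disc_pos : 0 < c.γ₀
  disc_lt : c.γ₀ < 1 / specRad P.A ^ 2
  cost_le : ∀ γ : ℝ, 0 < γ → γ ≤ 1 → ∀ K ∈ P.stabSet γ,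
    ‖P.costGrad 𝒟 γ K‖ ≤ c.ε → P.cost 𝒟 γ K ≤ Jbar

/-- A state from which an outer iteration can be analysed. -/
structure GoodState (P : Plant n m p) (b : Bounds) (s : State m p) : Prop where
  disc_pos : 0 < s.2.1
  disc_lt : s.2.1 < 1
  level : P.Level b s.2.1 (Matrix.of s.1) s.2.2
  level_lt : b.ℓ₀ < s.2.2

/-- The gradient estimate at step `j` is inaccurate. -/
def BadGrad (P : Plant n m p) (𝒟 : Measure (Fin n → ℝ)) (b : Bounds) (c : Config m p)
    (ω : Noise n m p) (k : ℕ) (s : State m p) (j : ℕ) : Prop :=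
  P.Level b s.2.1 (inner P b c ω k s j) s.2.2 ∧
    c.ε / 3 < ‖toVec (stepGrad P c ω k s j (inner P b c ω k s j)) -
      P.costGrad 𝒟 s.2.1 (inner P b c ω k s j)‖

/-- The cost estimate at the end of the iteration is inaccurate. -/
def BadCost (P : Plant n m p) (𝒟 : Measure (Fin n → ℝ)) (b : Bounds) (c : Config m p)
    (ω : Noise n m p) (k : ℕ) (s : State m p) : Prop :=
  P.Level b s.2.1 (nextGain P b c ω k s) s.2.2 ∧
    ¬ (P.cost 𝒟 s.2.1 (nextGain P b c ω k s) < 2 * nextCostEst P b c ω k s ∧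
      2 * nextCostEst P b c ω k s ≤ 3 * P.cost 𝒟 s.2.1 (nextGain P b c ω k s))

section

variable (H : Assumptions P 𝒟 d b c Jbar)
include H

lemma Assumptions.setting (hs : GoodState P b s) : P.Setting b 𝒟 d s.2.1 :=
  ⟨H.valid, H.law, hs.disc_pos, hs.disc_lt.le, H.dim_pos⟩

variable [IsProbabilityMeasure 𝒟]

/-- With accurate gradient estimates, the inner loop finds a nearly stationary gain. -/
lemma GoodState.nextGain_spec (hs : GoodState P b s)
    (hg : ∀ j ≤ ⌊b.iterBound m p c.ε s.2.2⌋₊, ¬ BadGrad P 𝒟 b c ω k s j) :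
    InnerStops P b c ω k s ∧ P.Level b s.2.1 (nextGain P b c ω k s) s.2.2 ∧
      ‖P.costGrad 𝒟 s.2.1 (nextGain P b c ω k s)‖ ≤ c.ε := by
  -- Accuracy is only needed at iterates that are still in the level set, which is exactly where
  -- `BadGrad` speaks about an estimate and where concentration is available.
  obtain ⟨j, h1, h2, h3, h4⟩ := Plant.Level.exists_meets_test (P := P) (b := b) H.eps_pos (H.setting hs)
    (κ := inner P b c ω k s) (g := fun j => stepGrad P c ω k s j (inner P b c ω k s j))
    hs.level (fun j => rfl) fun j hj hl => not_lt.1 fun hlt => hg j hj ⟨hl, hlt⟩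
  have hj : sInf {j | StopsAt P b c ω k s j} = j := by
    refine le_antisymm (Nat.sInf_le h1) (not_lt.1 fun hlt => h2 _ hlt ?_)
    exact Nat.sInf_mem (s := {j | StopsAt P b c ω k s j}) ⟨j, h1⟩
  refine ⟨⟨j, h1⟩, ?_⟩
  rw [nextGain, hj]
  exact ⟨h3, h4⟩

lemma Assumptions.cost_ge {γ : ℝ} (hγ : 0 ≤ γ) {K : Matrix (Fin m) (Fin p) ℝ}
    (h : P.Stable γ K) : b.ℓ₀ ≤ P.cost 𝒟 γ K := by
  rw [h.cost_eq hγ H.valid H.law]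
  have h1 := h.trace_valueMat_ge H.valid
  have h2 : (1 : ℝ) ≤ n := by exact_mod_cast Plant.one_le_dim H.unstable
  nlinarith [H.valid.pos]

lemma Assumptions.goodState_zero : GoodState P b (0, c.γ₀, P.cost 𝒟 c.γ₀ 0) := by
  have hst := Plant.stable_zero H.unstable H.disc_pos H.disc_lt (P := P)
  have hJ := hst.cost_eq H.disc_pos.le H.valid H.law
  have hlt := hst.lt_trace_valueMat_zero H.valid H.unstable H.disc_pos
  rw [← hJ] at hlt
  exact ⟨H.disc_pos, Plant.disc_lt_one H.unstable H.disc_lt,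
    ⟨H.valid, (Plant.disc_lt_one H.unstable H.disc_lt).le, hlt.le, hst, hJ.ge⟩, hlt⟩

/-- The hypothesis on `Jbar` has content only if nearly stationary gains exist. Descent with exact
gradients from `K = 0` finds one, and its cost is at least `ℓ₀`. -/
lemma Assumptions.le_Jbar : b.ℓ₀ ≤ Jbar := by
  have hs := H.goodState_zero
  obtain ⟨K, h1, h2⟩ := hs.level.exists_norm_costGrad_le H.eps_pos (H.setting hs)
  exact (H.cost_ge hs.disc_pos.le h1).trans (H.cost_le _ hs.disc_pos hs.disc_lt.le K
    ((Plant.mem_stabSet_iff hs.disc_pos).2 h1) h2)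

/-- The guaranteed growth factor of the discount factor. -/
lemma Assumptions.one_lt_growth : 1 < 1 + c.ζ * b.ℓ₀ / (3 * Jbar - b.ℓ₀) := by
  have h1 := H.le_Jbar
  have h2 := H.valid.pos
  have h3 := H.zeta_pos
  have : 0 < 3 * Jbar - b.ℓ₀ := by linarith
  have : 0 < c.ζ * b.ℓ₀ / (3 * Jbar - b.ℓ₀) := by positivity
  linarith

/-- Progress of an outer iteration without inaccurate estimates. -/
lemma GoodState.progress (hs : GoodState P b s)
    (hg : ∀ j ≤ ⌊b.iterBound m p c.ε s.2.2⌋₊, ¬ BadGrad P 𝒟 b c ω k s j)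
    (hc : ¬ BadCost P 𝒟 b c ω k s) :
    InnerStops P b c ω k s ∧
      (1 + c.ζ * b.ℓ₀ / (3 * Jbar - b.ℓ₀)) * s.2.1 ≤ nextDiscount P b c ω k s ∧
      (1 ≤ nextDiscount P b c ω k s → specRad (P.closedLoop (nextGain P b c ω k s)) < 1) ∧
      (nextDiscount P b c ω k s < 1 → GoodState P b (nextState P b c ω k s)) ∧
      (nextState P b c ω k s).2.2 ≤ 27 * Jbar ^ 3 / ((1 - c.ζ) * b.ℓ₀ ^ 2) := by
  obtain ⟨hterm, hlev, hgrad⟩ := hs.nextGain_spec H hg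
  set K := nextGain P b c ω k s with hK
  set Jh := nextCostEst P b c ω k s with hJh
  have hest : P.cost 𝒟 s.2.1 K < 2 * Jh ∧ 2 * Jh ≤ 3 * P.cost 𝒟 s.2.1 K := by
    by_contra hcon
    exact hc ⟨hlev, hcon⟩
  have hst := hlev.stable
  have hJ := hst.cost_eq hs.disc_pos.le H.valid H.law
  have hJge := H.cost_ge hs.disc_pos.le hst
  have hJle := H.cost_le _ hs.disc_pos hs.disc_lt.le K
    ((Plant.mem_stabSet_iff hs.disc_pos).2 hst) hgrad
  set J := P.cost 𝒟 s.2.1 K with hJdef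
  obtain ⟨he1, he2⟩ := hest
  have h0 := H.valid.pos
  have hζ0 := H.zeta_pos
  have hζ1 : 0 < 1 - c.ζ := by linarith [H.zeta_lt]
  have hJhlt : b.ℓ₀ < 2 * Jh := hJge.trans_lt he1
  have hJh1 : 0 < Jh := by linarith
  have hdisc : nextDiscount P b c ω k s =
      (1 + c.ζ * (b.ℓ₀ / (2 * Jh - b.ℓ₀))) * s.2.1 := rfl
  have hs1 := hs.disc_pos
  have hden : 0 < 2 * Jh - b.ℓ₀ := by linarith
  set α := b.ℓ₀ / (2 * Jh - b.ℓ₀) with hα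
  have hα0 : 0 < α := by positivity
  -- `α` solves `α * 2 Ĵ = (1 + α) ℓ₀`. This is the balance required by `mul_disc`, since `V ⪯ J I ⪯
  -- 2 Ĵ I` and the stage cost is at least `ℓ₀ ‖x‖²`.
  have hmul := hst.mul_disc H.valid hζ0.le H.zeta_lt hα0.le fun x => by
    have h1 := Plant.Level.qf_valueMat_le (ν := 2 * Jh)
      ⟨H.valid, hs.disc_lt.le, hJhlt.le, hst, hJ ▸ he1.le⟩ x
    have h2 := H.valid.qf_stageMat_ge' K x
    have h3 : α * (2 * Jh) = (1 + α) * b.ℓ₀ := by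
      rw [hα]
      field_simp
      ring
    calc α * qf (P.valueMat s.2.1 K) x ≤ α * (2 * Jh * en x ^ 2) := by gcongr
      _ = (1 + α) * (b.ℓ₀ * en x ^ 2) := by rw [← mul_assoc, h3, mul_assoc]
      _ ≤ _ := by gcongr
  obtain ⟨hst', htr⟩ := hmul
  have hstate : nextState P b c ω k s = (fun i j => K i j, nextDiscount P b c ω k s,
    8 * Jh ^ 3 / ((1 - c.ζ) * b.ℓ₀ ^ 2)) := rfl
  rw [← hdisc] at hst' htr
  -- Both `J` and `ℓ₀` are at most `2 Ĵ`, hence `J ℓ₀² ≤ (2 Ĵ)³`.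
  have hcube : J ≤ 8 * Jh ^ 3 / b.ℓ₀ ^ 2 := by
    rw [le_div_iff₀ (by positivity)]
    have h1 : J * b.ℓ₀ ^ 2 ≤ (2 * Jh) * (2 * Jh) ^ 2 := by
      have := he1.le
      have := hJhlt.le
      gcongr
    calc _ ≤ _ := h1
      _ = _ := by ring
  have hcube' : J / (1 - c.ζ) ≤ 8 * Jh ^ 3 / ((1 - c.ζ) * b.ℓ₀ ^ 2) := by
    rw [mul_comm (1 - c.ζ), ← div_div]
    gcongr
  -- Strictness comes from `ζ > 0` and preserves the invariant `ν > ℓ₀`.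
  have hlt : b.ℓ₀ < J / (1 - c.ζ) := by
    rw [lt_div_iff₀ hζ1]
    nlinarith
  refine ⟨hterm, ?_, fun h1 => Plant.specRad_closedLoop_lt_one h1 hst', fun h1 => ?_, ?_⟩
  -- The growth factor is smallest for the largest estimate, and `2 Ĵ ≤ 3 J ≤ 3 Jbar`.
  · rw [hdisc, mul_div_assoc]
    gcongr
    rw [hα]
    exact div_le_div_of_nonneg_left h0.le hden (by linarith)
  · rw [hstate]
    refine ⟨?_, h1, ⟨H.valid, h1.le, (hlt.le.trans hcube'), hst', ?_⟩, hlt.trans_le hcube'⟩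
    · change 0 < nextDiscount P b c ω k s
      rw [hdisc]
      positivity
    · rw [← hJ] at htr
      exact htr.trans hcube'
  · rw [hstate]
    change 8 * Jh ^ 3 / ((1 - c.ζ) * b.ℓ₀ ^ 2) ≤ _
    have h1 : (2 * Jh) ^ 3 ≤ (3 * Jbar) ^ 3 :=
      pow_le_pow_left₀ (by positivity) (by linarith) 3
    have h2 : 8 * Jh ^ 3 ≤ 27 * Jbar ^ 3 := by linarith
    gcongr

/-- An unsuccessful run meets an inaccurate estimate. -/
lemma Assumptions.exists_bad {k' : ℕ} (hk' : k' = outerBound c.γ₀ c.ζ b.ℓ₀ Jbar)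
    (hfail : ¬ Succeeds P 𝒟 b c k' ω) :
    ∃ k < k', ∃ s, run P 𝒟 b c ω k = some s ∧ GoodState P b s ∧
      s.2.2 ≤ max (P.cost 𝒟 c.γ₀ 0) (27 * Jbar ^ 3 / ((1 - c.ζ) * b.ℓ₀ ^ 2)) ∧
      ((∃ j ≤ ⌊b.iterBound m p c.ε s.2.2⌋₊, BadGrad P 𝒟 b c ω k s j) ∨
        BadCost P 𝒟 b c ω k s) := by
  by_contra! hcon
  set q := 1 + c.ζ * b.ℓ₀ / (3 * Jbar - b.ℓ₀) with hq
  have hq1 : 1 < q := H.one_lt_growth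
  have hγ0 := H.disc_pos
  -- Without a bad estimate and without success, every iteration up to `k'` starts from a good state
  -- with discount factor at least `γ₀ q ^ k`. By the choice of `k'` this reaches 1 at `k = k'`,
  -- while a good state has discount factor below 1.
  have key : ∀ k ≤ k', ∃ s, run P 𝒟 b c ω k = some s ∧ GoodState P b s ∧
      s.2.2 ≤ max (P.cost 𝒟 c.γ₀ 0) (27 * Jbar ^ 3 / ((1 - c.ζ) * b.ℓ₀ ^ 2)) ∧
      c.γ₀ * q ^ k ≤ s.2.1 := by
    intro k
    induction k with
    | zero => exact fun _ => ⟨_, rfl, H.goodState_zero, le_max_left _ _, by simp⟩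
    | succ k ih =>
      intro hk
      obtain ⟨s, h1, h2, h3, h4⟩ := ih (by omega)
      obtain ⟨h5, h6⟩ := hcon k (by omega) s h1 h2 h3
      obtain ⟨p1, p2, p3, p4, p5⟩ := h2.progress H h5 h6
      have hlt : nextDiscount P b c ω k s < 1 := by
        by_contra hge
        exact hfail ⟨k, by omega, _, ⟨s, h1, p1, not_lt.1 hge, rfl⟩, p3 (not_lt.1 hge)⟩
      refine ⟨nextState P b c ω k s, ?_, p4 hlt, p5.trans (le_max_right _ _), ?_⟩
      · rw [run, h1]
        exact if_pos ⟨p1, hlt⟩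
      · refine le_trans ?_ p2
        rw [pow_succ']
        calc _ = q * (c.γ₀ * q ^ k) := by ring
          _ ≤ _ := by gcongr
  obtain ⟨s, -, h2, -, h4⟩ := key k' le_rfl
  have h5 : Real.log (1 / c.γ₀) / Real.log q ≤ k' := by
    rw [hk', outerBound]
    exact Nat.le_ceil _
  rw [div_le_iff₀ (Real.log_pos hq1), ← Real.log_pow,
    Real.log_le_log_iff (by positivity) (by positivity), div_le_iff₀' hγ0] at h5
  linarith [h2.disc_lt]

end

end DiscountedSOF

/-! ### Measurability of the algorithm, of stability and of the gradient. -/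

namespace DiscountedSOF

variable {n m p : ℕ} {P : Plant n m p} {𝒟 : Measure (Fin n → ℝ)} {d : ℝ} {b : Bounds}
  {c : Config m p} {Jbar : ℝ} {k : ℕ}

section Measurability

variable {Ω : Type*} [MeasurableSpace Ω]

/-- Handles random rollout lengths, sample sizes and stopping indices, since they take countably
many values. -/
lemma measurable_nat_index {β : Type*} [MeasurableSpace β] {f : ℕ → Ω → β}
    (hf : ∀ i, Measurable (f i)) {N : Ω → ℕ} (hN : Measurable N) :
    Measurable fun x => f (N x) x :=
  (measurable_from_prod_countable_right (f := fun q : ℕ × Ω => f q.1 q.2) hf).comp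
    (hN.prodMk measurable_id)

variable {γ r : Ω → ℝ} {τ N : Ω → ℕ} {κ : Ω → Matrix (Fin m) (Fin p) ℝ} {x : Ω → Fin n → ℝ}
  {w : Ω → ℕ → (Fin m → Fin p → ℝ) × (Fin n → ℝ)}

lemma measurable_truncCost (hγ : Measurable γ) (hτ : Measurable τ)
    (hκ : Measurable fun o => toVec (κ o)) (hx : Measurable x) :
    Measurable fun o => P.truncCost (γ o) (τ o) (κ o) (x o) := by
  refine measurable_nat_index (f := fun τ o => P.truncCost (γ o) τ (κ o) (x o)) (fun τ => ?_) hτ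
  have h1 : Continuous fun q : ℝ × GainSpace m p × (Fin n → ℝ) =>
      P.truncCost q.1 τ (toMat q.2.1) q.2.2 :=
    P.continuous_truncCost (Plant.continuous_toMat.comp (by fun_prop)) (by fun_prop)
      (by fun_prop) τ
  have h2 := h1.measurable.comp (hγ.prodMk (hκ.prodMk hx))
  simp only [Function.comp_def, toMat_toVec] at h2
  exact h2

lemma measurable_gradEst (hγ : Measurable γ) (hr : Measurable r) (hτ : Measurable τ)
    (hN : Measurable N) (hκ : Measurable fun o => toVec (κ o)) (hw : Measurable w) :
    Measurable fun o => toVec (P.gradEst (γ o) (κ o) (r o) (τ o) (N o) (w o)) := by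
  simp only [Plant.toVec_gradEst]
  refine measurable_nat_index (f := fun N o => (N : ℝ)⁻¹ • ∑ i ∈ Finset.range N,
    P.truncSampleGrad (γ o) (κ o) (r o) (τ o) (w o i)) (fun N => ?_) hN
  refine (Finset.measurable_sum _ fun i _ => ?_).const_smul (N : ℝ)⁻¹
  have hwi : Measurable fun o => w o i := (measurable_pi_apply i).comp hw
  have hd : Measurable fun o => direction (w o i).1 := measurable_direction.comp hwi.fst
  have h1 := measurable_truncCost (P := P) (κ := fun o => κ o + r o • toMat (direction (w o i).1))
    hγ hτ (hκ.add (hr.smul hd)) hwi.snd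
  have h2 := measurable_truncCost (P := P) (κ := fun o => κ o - r o • toMat (direction (w o i).1))
    hγ hτ (hκ.sub (hr.smul hd)) hwi.snd
  exact (measurable_const.div (hr.const_mul 2)).smul ((h1.sub h2).smul hd)

variable {s : Ω → State m p} {ξ : Ω → Noise n m p} {δ₀ δ₁ : ℝ} (hc : c.Admissible b d δ₀ δ₁)
  (hs : Measurable s) (hξ : Measurable ξ)
include hc hs hξ

lemma measurable_stepGrad (k j : ℕ) (hκ : Measurable fun o => toVec (κ o)) :
    Measurable fun o => toVec (stepGrad P c (ξ o) k (s o) j (κ o)) := by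
  refine measurable_gradEst hs.snd.fst ((hc.meas_r k).comp hs) ((hc.meas_τe k).comp hs)
    ((hc.meas_Ne k).comp hs) hκ ?_
  exact measurable_pi_iff.2 fun i => (measurable_pi_apply (k, j, i)).comp hξ.fst

lemma measurable_inner (k j : ℕ) : Measurable fun o => toVec (inner P b c (ξ o) k (s o) j) := by
  induction j with
  | zero => exact measurable_toVec.comp hs.fst
  | succ j ih =>
    have h1 : Measurable fun ν : ℝ => b.step m p c.ε ν := by
      unfold Bounds.step Bounds.rad Bounds.gradBound Bounds.smooth Bounds.kappa
      fun_prop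
    exact ih.sub ((h1.comp hs.snd.snd).smul (measurable_stepGrad hc hs hξ k j ih))

lemma measurableSet_stopsAt (k j : ℕ) : MeasurableSet {o | StopsAt P b c (ξ o) k (s o) j} := by
  simp only [StopsAt, frob_eq]
  exact measurableSet_le
    (measurable_stepGrad hc hs hξ k j (measurable_inner hc hs hξ k j)).norm measurable_const

lemma measurableSet_innerStops (k : ℕ) : MeasurableSet {o | InnerStops P b c (ξ o) k (s o)} := by
  simp only [InnerStops, Set.ofPred_exists]
  exact MeasurableSet.iUnion fun j => measurableSet_stopsAt hc hs hξ k j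

/-- If the loop never stops, `sInf ∅ = 0`. This is why the case `i = 0` appears separately in the
description of `{sInf ≥ i}`. -/
lemma measurable_stopIndex (k : ℕ) :
    Measurable fun o => sInf {j | StopsAt P b c (ξ o) k (s o) j} := by
  refine measurable_of_Ici fun i => ?_
  have e : (fun o => sInf {j | StopsAt P b c (ξ o) k (s o) j}) ⁻¹' Set.Ici i =
      (⋂ j : ℕ, ⋂ _ : j < i, {o | ¬ StopsAt P b c (ξ o) k (s o) j}) ∩
        ({o | InnerStops P b c (ξ o) k (s o)} ∪ {_o | i = 0}) := by
    ext o
    simp only [Set.mem_preimage, Set.mem_Ici, Set.mem_inter_iff, Set.mem_iInter, Set.mem_union,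
      Set.mem_ofPred_eq]
    constructor
    · intro h
      refine ⟨fun j hj hst => absurd ((h.trans (Nat.sInf_le hst)).trans_lt hj) (lt_irrefl _), ?_⟩
      by_contra! hcon
      have : {j | StopsAt P b c (ξ o) k (s o) j} = ∅ :=
        Set.eq_empty_iff_forall_notMem.2 fun j hj => hcon.1 ⟨j, hj⟩
      rw [this, Nat.sInf_empty] at h
      omega
    · rintro ⟨h1, h2⟩
      rcases h2 with h2 | h2
      · exact not_lt.1 fun hlt => h1 _ hlt (Nat.sInf_mem h2)
      · omega
  rw [e]
  refine MeasurableSet.inter (MeasurableSet.iInter fun j => MeasurableSet.iInter fun _ =>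
    (measurableSet_stopsAt hc hs hξ k j).compl) ?_
  exact (measurableSet_innerStops hc hs hξ k).union (MeasurableSet.const _)

lemma measurable_nextGain (k : ℕ) : Measurable fun o => toVec (nextGain P b c (ξ o) k (s o)) :=
  measurable_nat_index (fun j => measurable_inner hc hs hξ k j) (measurable_stopIndex hc hs hξ k)

lemma measurable_nextCostEst (k : ℕ) : Measurable fun o => nextCostEst P b c (ξ o) k (s o) := by
  refine Measurable.const_mul (Finset.measurable_sum _ fun i _ => ?_) _
  exact measurable_truncCost hs.snd.fst ((hc.meas_τ k).comp hs) (measurable_nextGain hc hs hξ k)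
    ((measurable_pi_apply (k, i)).comp hξ.snd)

lemma measurable_nextDiscount (k : ℕ) : Measurable fun o => nextDiscount P b c (ξ o) k (s o) := by
  have := measurable_nextCostEst (P := P) hc hs hξ k
  have h2 := hs.snd.fst
  unfold nextDiscount
  fun_prop

lemma measurable_nextState (k : ℕ) : Measurable fun o => nextState P b c (ξ o) k (s o) := by
  refine Measurable.prodMk ?_ ((measurable_nextDiscount hc hs hξ k).prodMk ?_)
  · have h1 := measurable_nextGain (P := P) hc hs hξ k
    refine measurable_pi_iff.2 fun i => measurable_pi_iff.2 fun j => ?_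
    have h2 : Measurable fun v : GainSpace m p => v (i, j) := by fun_prop
    exact h2.comp h1
  · have := measurable_nextCostEst (P := P) hc hs hξ k
    fun_prop

end Measurability

section Regularity

variable {Ω : Type*} [MeasurableSpace Ω] {γ ν : Ω → ℝ} {κ : Ω → Matrix (Fin m) (Fin p) ℝ}

/-- Stability is finiteness of the series of `fsq (A_K ^ t)`, whose terms are continuous in the
discount factor and the gain. -/
lemma measurableSet_stable (hγ : Measurable γ) (hκ : Measurable fun o => toVec (κ o)) :
    MeasurableSet {o | P.Stable (γ o) (κ o)} := by
  have e : {o | P.Stable (γ o) (κ o)} = {o | ∑' t : ℕ,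
      ENNReal.ofReal (fsq (P.damped (γ o) (κ o) ^ t)) < ⊤} := by
    ext o
    constructor
    · rintro ⟨s, hs⟩
      exact (hs.summable_fsq.tsum_ofReal_lt_top)
    · intro h
      have h1 : Summable fun t => fsq (P.damped (γ o) (κ o) ^ t) := by
        have h2 := ENNReal.summable_toReal (ne_of_lt h)
        simpa only [ENNReal.toReal_ofReal (fsq_nonneg _)] using h2
      exact ⟨_, fun N => h1.sum_le_tsum _ fun t _ => fsq_nonneg _⟩
  rw [e]
  refine measurableSet_lt (Measurable.tsum fun t => ?_) measurable_const
  have h1 : Continuous fun q : ℝ × GainSpace m p => fsq (P.damped q.1 (toMat q.2) ^ t) := by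
    have h2 : Continuous fun q : ℝ × GainSpace m p => P.damped q.1 (toMat q.2) ^ t :=
      (continuous_fst.sqrt.smul (P.continuous_closedLoop
        (Plant.continuous_toMat.comp continuous_snd))).pow t
    exact continuous_finsetSum _ fun i _ => continuous_finsetSum _ fun j _ =>
      (h2.matrix_elem i j).pow 2
  exact (h1.measurable.comp (hγ.prodMk hκ)).ennreal_ofReal

variable [IsProbabilityMeasure 𝒟]

lemma measurable_cost_comp (hγ : Measurable γ) (hκ : Measurable fun o => toVec (κ o)) :
    Measurable fun o => P.cost 𝒟 (γ o) (κ o) := by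
  refine Measurable.ennreal_toReal ?_
  refine Measurable.lintegral_prod_right' (f := fun q : Ω × (Fin n → ℝ) =>
    ∑' t : ℕ, ENNReal.ofReal (γ q.1 ^ t * P.stageCost (κ q.1) (P.traj (κ q.1) q.2 t))) ?_
  refine Measurable.tsum fun t => ?_
  have h1 : Continuous fun q : GainSpace m p × (Fin n → ℝ) =>
      P.stageCost (toMat q.1) (P.traj (toMat q.1) q.2 t) :=
    P.continuous_stageCost_traj (Plant.continuous_toMat.comp continuous_fst) continuous_snd t
  have h2 := h1.measurable.comp ((hκ.comp measurable_fst).prodMk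
    (measurable_snd (α := Ω) (β := Fin n → ℝ)))
  exact (((hγ.comp measurable_fst).pow_const t).mul h2).ennreal_ofReal

/-- The trace of the value matrix is replaced by the cost, which is measurable as an integral. The
conjunct `0 < γ` makes the two agree on stabilizing gains. -/
lemma measurableSet_level (h𝒟 : IsInitialLaw 𝒟 d) (hb : b.Valid P) (hγ : Measurable γ)
    (hκ : Measurable fun o => toVec (κ o)) (hν : Measurable ν) :
    MeasurableSet {o | 0 < γ o ∧ P.Level b (γ o) (κ o) (ν o)} := by
  have e : {o | 0 < γ o ∧ P.Level b (γ o) (κ o) (ν o)} =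
      {o | 0 < γ o} ∩ ({o | γ o ≤ 1} ∩ ({o | b.ℓ₀ ≤ ν o} ∩ ({o | P.Stable (γ o) (κ o)} ∩
        {o | P.cost 𝒟 (γ o) (κ o) ≤ ν o}))) := by
    ext o
    constructor
    · rintro ⟨h1, h⟩
      exact ⟨h1, h.disc_le, h.level_ge, h.stable, (h.stable.cost_eq h1.le hb h𝒟).trans_le h.trace_le⟩
    · rintro ⟨h1, h2, h3, h4, h5⟩
      exact ⟨h1, hb, h2, h3, h4, (h4.cost_eq (le_of_lt h1) hb h𝒟).ge.trans h5⟩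
  rw [e]
  exact (measurableSet_lt measurable_const hγ).inter ((measurableSet_le hγ measurable_const).inter
    ((measurableSet_le measurable_const hν).inter ((measurableSet_stable hγ hκ).inter
      (measurableSet_le (measurable_cost_comp hγ hκ) hν))))

open Classical in
/-- The gradient, restricted to the stabilizing gains, is measurable in all of its arguments. -/
lemma measurable_costGrad_comp (h𝒟 : IsInitialLaw 𝒟 d) (hb : b.Valid P) (hmp : 1 ≤ min m p)
    (hγ : Measurable γ) (hκ : Measurable fun o => toVec (κ o)) :
    Measurable fun o => if (0 < γ o ∧ γ o ≤ 1) ∧ P.Stable (γ o) (κ o) then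
      P.costGrad 𝒟 (γ o) (κ o) else 0 := by
  set T := {o | (0 < γ o ∧ γ o ≤ 1) ∧ P.Stable (γ o) (κ o)} with hT
  have hTm : MeasurableSet T :=
    ((measurableSet_lt measurable_const hγ).inter (measurableSet_le hγ measurable_const)).inter
      (measurableSet_stable hγ hκ)
  have hcoord : ∀ ij : Fin m × Fin p, Measurable fun o =>
      (if (0 < γ o ∧ γ o ≤ 1) ∧ P.Stable (γ o) (κ o) then P.costGrad 𝒟 (γ o) (κ o) else 0) ij := by
    intro ij
    set e : GainSpace m p := EuclideanSpace.single ij 1 with he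
    -- `measurable_costGrad` concerns a fixed discount factor. Joint measurability is obtained by
    -- writing each partial derivative as a limit of difference quotients of the cost.
    refine measurable_of_tendsto_metrizable (f := fun (l : ℕ) o => if o ∈ T then
      ((l : ℝ) + 1) * (P.cost 𝒟 (γ o) (κ o + toMat (((l : ℝ) + 1)⁻¹ • e)) -
        P.cost 𝒟 (γ o) (κ o)) else 0) (fun l => ?_) ?_
    · refine Measurable.ite hTm (((measurable_cost_comp hγ ?_).sub
        (measurable_cost_comp hγ hκ)).const_mul _) measurable_const
      exact hκ.add_const (((l : ℝ) + 1)⁻¹ • e)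
    · refine tendsto_pi_nhds.2 fun o => ?_
      by_cases ho : o ∈ T
      · have ho' : (0 < γ o ∧ γ o ≤ 1) ∧ P.Stable (γ o) (κ o) := ho
        simp only [if_pos ho, if_pos ho']
        have hg := (ho'.2.hasGradientAt (𝒟 := 𝒟) ⟨hb, h𝒟, ho'.1.1, ho'.1.2, hmp⟩).hasFDerivAt
        have hl := hg.lim_real e
        have h2 := hl.comp (tendsto_natCast_atTop_atTop.comp (Filter.tendsto_add_atTop_nat 1))
        have e1 : (InnerProductSpace.toDual ℝ (GainSpace m p)) (P.costGrad 𝒟 (γ o) (κ o)) e =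
            P.costGrad 𝒟 (γ o) (κ o) ij := by
          rw [InnerProductSpace.toDual_apply_apply, he, EuclideanSpace.inner_single_right]
          simp
        rw [e1] at h2
        refine h2.congr fun l => ?_
        simp
      · have ho' : ¬ ((0 < γ o ∧ γ o ≤ 1) ∧ P.Stable (γ o) (κ o)) := ho
        simp only [if_neg ho, if_neg ho']
        exact tendsto_const_nhds
  have h3 : Measurable fun o (ij : Fin m × Fin p) =>
      (if (0 < γ o ∧ γ o ≤ 1) ∧ P.Stable (γ o) (κ o) then P.costGrad 𝒟 (γ o) (κ o) else 0) ij :=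
    measurable_pi_iff.2 hcoord
  exact (WithLp.measurable_toLp 2 _).comp h3

end Regularity

end DiscountedSOF

/-! ### Which samples the iterates depend on. -/

namespace DiscountedSOF

variable {n m p : ℕ} {P : Plant n m p} {𝒟 : Measure (Fin n → ℝ)} {d : ℝ} {b : Bounds}
  {c : Config m p} {Jbar : ℝ} {k : ℕ}

section Dependence

variable {ω ω' : Noise n m p} {s : State m p}

/-- The iterate at step `j` involves only the samples of the steps before `j`, so those of step `j`
are fresh for its gradient estimate. -/
lemma inner_congr {j : ℕ} (h : ∀ l < j, ∀ i, ω.1 (k, l, i) = ω'.1 (k, l, i)) :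
    inner P b c ω k s j = inner P b c ω' k s j := by
  induction j with
  | zero => rfl
  | succ j ih =>
    rw [inner, inner, ih fun l hl => h l (by omega)]
    simp only [stepGrad, h j (Nat.lt_succ_self j)]

lemma stopsAt_congr (h : ∀ j i, ω.1 (k, j, i) = ω'.1 (k, j, i)) (j : ℕ) :
    StopsAt P b c ω k s j ↔ StopsAt P b c ω' k s j := by
  rw [StopsAt, StopsAt, inner_congr fun l _ => h l]
  simp only [stepGrad, h]

lemma innerStops_congr (h : ∀ j i, ω.1 (k, j, i) = ω'.1 (k, j, i)) :
    InnerStops P b c ω k s ↔ InnerStops P b c ω' k s :=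
  exists_congr fun j => stopsAt_congr h j

lemma nextGain_congr (h : ∀ j i, ω.1 (k, j, i) = ω'.1 (k, j, i)) :
    nextGain P b c ω k s = nextGain P b c ω' k s := by
  rw [nextGain, nextGain]
  simp only [stopsAt_congr h]
  exact inner_congr fun l _ => h l

lemma nextCostEst_congr (h : ∀ j i, ω.1 (k, j, i) = ω'.1 (k, j, i))
    (h' : ∀ i, ω.2 (k, i) = ω'.2 (k, i)) :
    nextCostEst P b c ω k s = nextCostEst P b c ω' k s := by
  rw [nextCostEst, nextCostEst, nextGain_congr h]
  simp only [h']

lemma nextDiscount_congr (h : ∀ j i, ω.1 (k, j, i) = ω'.1 (k, j, i))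
    (h' : ∀ i, ω.2 (k, i) = ω'.2 (k, i)) :
    nextDiscount P b c ω k s = nextDiscount P b c ω' k s := by
  rw [nextDiscount, nextDiscount, nextCostEst_congr h h']

lemma nextState_congr (h : ∀ j i, ω.1 (k, j, i) = ω'.1 (k, j, i))
    (h' : ∀ i, ω.2 (k, i) = ω'.2 (k, i)) :
    nextState P b c ω k s = nextState P b c ω' k s := by
  rw [nextState, nextState, nextCostEst_congr h h', nextDiscount_congr h h', nextGain_congr h]

/-- The state of the algorithm at the start of iteration `k`, continued past the return. -/
noncomputable def state (P : Plant n m p) (𝒟 : Measure (Fin n → ℝ)) (b : Bounds) (c : Config m p)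
    (ω : Noise n m p) : ℕ → State m p
  | 0 => (0, c.γ₀, P.cost 𝒟 c.γ₀ 0)
  | k + 1 => nextState P b c ω k (state P 𝒟 b c ω k)

/-- Iteration `k` is executed. -/
def Executed (P : Plant n m p) (𝒟 : Measure (Fin n → ℝ)) (b : Bounds) (c : Config m p)
    (ω : Noise n m p) (k : ℕ) : Prop :=
  ∀ i < k, InnerStops P b c ω i (state P 𝒟 b c ω i) ∧
    nextDiscount P b c ω i (state P 𝒟 b c ω i) < 1

lemma executed_succ : Executed P 𝒟 b c ω (k + 1) ↔ Executed P 𝒟 b c ω k ∧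
    InnerStops P b c ω k (state P 𝒟 b c ω k) ∧
    nextDiscount P b c ω k (state P 𝒟 b c ω k) < 1 :=
  Nat.forall_lt_succ_right

-- Separates the total, measurable process `state` from the event of being executed, so that
-- probabilities need not involve `Option`.
open Classical in
lemma run_eq (ω : Noise n m p) (k : ℕ) : run P 𝒟 b c ω k =
    if Executed P 𝒟 b c ω k then some (state P 𝒟 b c ω k) else none := by
  induction k with
  | zero => exact (if_pos fun i hi => absurd hi (Nat.not_lt_zero i)).symm
  | succ k ih =>
    rw [run, ih]
    by_cases h : Executed P 𝒟 b c ω k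
    · simp only [executed_succ, h, true_and]
      rfl
    · rw [if_neg h, if_neg fun h' => h (executed_succ.1 h').1]

/-- The samples of the iterations before `k` agree. -/
def AgreeBefore (k : ℕ) (ω ω' : Noise n m p) : Prop :=
  ∀ l < k, (∀ j i, ω.1 (l, j, i) = ω'.1 (l, j, i)) ∧ ∀ i, ω.2 (l, i) = ω'.2 (l, i)

lemma AgreeBefore.mono {l : ℕ} (h : AgreeBefore k ω ω') (hl : l ≤ k) : AgreeBefore l ω ω' :=
  fun i hi => h i (hi.trans_le hl)

lemma AgreeBefore.state_eq (h : AgreeBefore k ω ω') : state P 𝒟 b c ω k = state P 𝒟 b c ω' k := by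
  induction k with
  | zero => rfl
  | succ k ih =>
    obtain ⟨h1, h2⟩ := h k (Nat.lt_succ_self k)
    rw [state, state, ih (h.mono (Nat.le_succ k)), nextState_congr h1 h2]

lemma AgreeBefore.executed_iff (h : AgreeBefore k ω ω') :
    Executed P 𝒟 b c ω k ↔ Executed P 𝒟 b c ω' k := by
  refine forall₂_congr fun i hi => ?_
  obtain ⟨h1, h2⟩ := h i hi
  rw [(h.mono hi.le).state_eq, innerStops_congr h1, nextDiscount_congr h1 h2]

end Dependence

section Measurability

variable {δ₀ δ₁ : ℝ} (hc : c.Admissible b d δ₀ δ₁)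
include hc

lemma measurable_state (k : ℕ) : Measurable fun ω : Noise n m p => state P 𝒟 b c ω k := by
  induction k with
  | zero => exact measurable_const
  | succ k ih => exact measurable_nextState hc ih measurable_id k

lemma measurableSet_executed (k : ℕ) :
    MeasurableSet {ω : Noise n m p | Executed P 𝒟 b c ω k} := by
  simp only [Executed, Set.ofPred_forall]
  refine MeasurableSet.iInter fun i => MeasurableSet.iInter fun _ => ?_
  have h := measurable_state (P := P) (𝒟 := 𝒟) hc i
  exact (measurableSet_innerStops hc h measurable_id i).inter
    (measurableSet_lt (measurable_nextDiscount hc h measurable_id i) measurable_const)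

omit hc in
lemma measurable_iterBound : Measurable fun ν : ℝ => b.iterBound m p c.ε ν := by
  unfold Bounds.iterBound Bounds.step Bounds.rad Bounds.gradBound Bounds.smooth Bounds.kappa
  fun_prop

variable [IsProbabilityMeasure 𝒟] (H : Assumptions P 𝒟 d b c Jbar)
include H

lemma measurableSet_goodState (k : ℕ) :
    MeasurableSet {ω : Noise n m p | GoodState P b (state P 𝒟 b c ω k)} := by
  have h := measurable_state (P := P) (𝒟 := 𝒟) hc k
  have h1 := measurableSet_level (P := P) (𝒟 := 𝒟) (b := b) H.law H.valid h.snd.fst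
    (measurable_toVec.comp h.fst) h.snd.snd
  have e : {ω : Noise n m p | GoodState P b (state P 𝒟 b c ω k)} =
      {ω | 0 < (state P 𝒟 b c ω k).2.1 ∧ P.Level b (state P 𝒟 b c ω k).2.1
        (Matrix.of (state P 𝒟 b c ω k).1) (state P 𝒟 b c ω k).2.2} ∩
      ({ω | (state P 𝒟 b c ω k).2.1 < 1} ∩ {ω | b.ℓ₀ < (state P 𝒟 b c ω k).2.2}) := by
    ext ω
    exact ⟨fun h => ⟨⟨h.disc_pos, h.level⟩, h.disc_lt, h.level_lt⟩,
      fun h => ⟨h.1.1, h.2.1, h.1.2, h.2.2⟩⟩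
  rw [e]
  exact h1.inter ((measurableSet_lt h.snd.fst measurable_const).inter
    (measurableSet_lt measurable_const h.snd.snd))

-- On good states in the level set, the gradient agrees with its measurable version that is set to 0
-- at non-stabilizing gains.
open Classical in
lemma measurableSet_badGrad (k j : ℕ) :
    MeasurableSet {ω : Noise n m p | GoodState P b (state P 𝒟 b c ω k) ∧
      BadGrad P 𝒟 b c ω k (state P 𝒟 b c ω k) j} := by
  have h := measurable_state (P := P) (𝒟 := 𝒟) hc k
  have hin := measurable_inner (P := P) hc h measurable_id k j
  have h1 := measurableSet_level (P := P) (𝒟 := 𝒟) (b := b) H.law H.valid h.snd.fst hin h.snd.snd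
  have h2 := measurable_costGrad_comp (P := P) H.law H.valid H.dim_pos h.snd.fst hin
  have h3 := measurable_stepGrad (P := P) hc h measurable_id k j hin
  have e : {ω : Noise n m p | GoodState P b (state P 𝒟 b c ω k) ∧
      BadGrad P 𝒟 b c ω k (state P 𝒟 b c ω k) j} =
      {ω | GoodState P b (state P 𝒟 b c ω k)} ∩
        ({ω | 0 < (state P 𝒟 b c ω k).2.1 ∧ P.Level b (state P 𝒟 b c ω k).2.1
          (inner P b c ω k (state P 𝒟 b c ω k) j) (state P 𝒟 b c ω k).2.2} ∩
        {ω | c.ε / 3 < ‖toVec (stepGrad P c ω k (state P 𝒟 b c ω k) j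
          (inner P b c ω k (state P 𝒟 b c ω k) j)) -
          (if (0 < (state P 𝒟 b c ω k).2.1 ∧ (state P 𝒟 b c ω k).2.1 ≤ 1) ∧
            P.Stable (state P 𝒟 b c ω k).2.1 (inner P b c ω k (state P 𝒟 b c ω k) j) then
            P.costGrad 𝒟 (state P 𝒟 b c ω k).2.1 (inner P b c ω k (state P 𝒟 b c ω k) j)
            else 0)‖}) := by
    ext ω
    have key : GoodState P b (state P 𝒟 b c ω k) → P.Level b (state P 𝒟 b c ω k).2.1
        (inner P b c ω k (state P 𝒟 b c ω k) j) (state P 𝒟 b c ω k).2.2 →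
        (0 < (state P 𝒟 b c ω k).2.1 ∧ (state P 𝒟 b c ω k).2.1 ≤ 1) ∧
          P.Stable (state P 𝒟 b c ω k).2.1 (inner P b c ω k (state P 𝒟 b c ω k) j) :=
      fun h1 h2 => ⟨⟨h1.disc_pos, h1.disc_lt.le⟩, h2.stable⟩
    simp only [Set.mem_inter_iff, Set.mem_ofPred_eq, BadGrad]
    constructor
    · rintro ⟨h1, h2, h3⟩
      refine ⟨h1, ⟨h1.disc_pos, h2⟩, ?_⟩
      rwa [if_pos (key h1 h2)]
    · rintro ⟨h1, ⟨-, h2⟩, h3⟩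
      rw [if_pos (key h1 h2)] at h3
      exact ⟨h1, h2, h3⟩
  rw [e]
  exact (measurableSet_goodState hc H k).inter
    (h1.inter (measurableSet_lt measurable_const (h3.sub h2).norm))

lemma measurableSet_badCost (k : ℕ) :
    MeasurableSet {ω : Noise n m p | GoodState P b (state P 𝒟 b c ω k) ∧
      BadCost P 𝒟 b c ω k (state P 𝒟 b c ω k)} := by
  have h := measurable_state (P := P) (𝒟 := 𝒟) hc k
  have hg := measurable_nextGain (P := P) hc h measurable_id k
  have h1 := measurableSet_level (P := P) (𝒟 := 𝒟) (b := b) H.law H.valid h.snd.fst hg h.snd.snd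
  have h2 := measurable_cost_comp (P := P) (𝒟 := 𝒟) h.snd.fst hg
  have h3 := measurable_nextCostEst (P := P) hc h measurable_id k
  have e : {ω : Noise n m p | GoodState P b (state P 𝒟 b c ω k) ∧
      BadCost P 𝒟 b c ω k (state P 𝒟 b c ω k)} =
      {ω | GoodState P b (state P 𝒟 b c ω k)} ∩
        ({ω | 0 < (state P 𝒟 b c ω k).2.1 ∧ P.Level b (state P 𝒟 b c ω k).2.1
          (nextGain P b c ω k (state P 𝒟 b c ω k)) (state P 𝒟 b c ω k).2.2} ∩
        ({ω | P.cost 𝒟 (state P 𝒟 b c ω k).2.1 (nextGain P b c ω k (state P 𝒟 b c ω k)) <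
            2 * nextCostEst P b c ω k (state P 𝒟 b c ω k)} ∩
          {ω | 2 * nextCostEst P b c ω k (state P 𝒟 b c ω k) ≤ 3 *
            P.cost 𝒟 (state P 𝒟 b c ω k).2.1 (nextGain P b c ω k (state P 𝒟 b c ω k))})ᶜ) := by
    ext ω
    exact ⟨fun h => ⟨h.1, ⟨h.1.disc_pos, h.2.1⟩, h.2.2⟩, fun h => ⟨h.1, h.2.1.2, h.2.2⟩⟩
  rw [e]
  exact (measurableSet_goodState hc H k).inter (h1.inter
    ((measurableSet_lt h2 (h3.const_mul 2)).inter
      (measurableSet_le (h3.const_mul 2) (h2.const_mul 3))).compl)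

end Measurability

end DiscountedSOF

/-! ### Conditional error probabilities by resampling. -/

namespace DiscountedSOF

section Resampling

variable {Ω Y : Type*} [MeasurableSpace Ω] [MeasurableSpace Y] {μ : Measure Ω} {η : Measure Y}
  [SFinite η]

/-- A conditional probability bound, for a part of the randomness that can be resampled. -/
lemma measure_le_of_resample {Φ : Ω × Y → Ω} (hΦ : MeasurePreserving Φ (μ.prod η) μ)
    {B H : Set Ω} (hB : MeasurableSet B) (hH : MeasurableSet H) {δ : ℝ≥0∞}
    (h1 : ∀ o y, Φ (o, y) ∈ B → o ∈ H) (h2 : ∀ o ∈ H, η {y | Φ (o, y) ∈ B} ≤ δ) :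
    μ B ≤ δ * μ H := by
  rw [← hΦ.measure_preimage hB.nullMeasurableSet, Measure.prod_apply (hΦ.measurable hB),
    ← lintegral_indicator_const hH δ]
  refine lintegral_mono fun o => ?_
  by_cases ho : o ∈ H
  · rw [Set.indicator_of_mem ho]
    exact h2 o ho
  · have : Prod.mk o ⁻¹' (Φ ⁻¹' B) = ∅ :=
      Set.eq_empty_iff_forall_notMem.2 fun y hy => ho (h1 o y hy)
    rw [this, measure_empty]
    exact zero_le

variable {ι κ X Z : Type*} [MeasurableSpace X] [MeasurableSpace Z] (ν : Measure X)
  [IsProbabilityMeasure ν] (ρ : Measure Z) [IsProbabilityMeasure ρ]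

lemma measurePreserving_resample_snd (e : κ → ι) (he : Function.Injective e) :
    MeasurePreserving (fun q : (Z × (ι → X)) × (κ → X) => (q.1.1, Function.extend e q.2 q.1.2))
      ((ρ.prod (Measure.infinitePi fun _ : ι => ν)).prod (Measure.infinitePi fun _ : κ => ν))
      (ρ.prod (Measure.infinitePi fun _ : ι => ν)) :=
  ((MeasurePreserving.id ρ).prod (measurePreserving_extend ν e he)).comp
    (measurePreserving_prodAssoc ρ _ _)

lemma measurePreserving_resample_fst (e : κ → ι) (he : Function.Injective e) :
    MeasurePreserving (fun q : ((ι → X) × Z) × (κ → X) => (Function.extend e q.2 q.1.1, q.1.2))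
      (((Measure.infinitePi fun _ : ι => ν).prod ρ).prod (Measure.infinitePi fun _ : κ => ν))
      ((Measure.infinitePi fun _ : ι => ν).prod ρ) :=
  Measure.measurePreserving_swap.comp ((measurePreserving_resample_snd ν ρ e he).comp
    (Measure.measurePreserving_swap.prod (MeasurePreserving.id _)))

end Resampling

variable {n m p : ℕ} {P : Plant n m p} {𝒟 : Measure (Fin n → ℝ)} {d : ℝ} {b : Bounds}
  {c : Config m p} {Jbar : ℝ} {k : ℕ} {δ₀ δ₁ : ℝ}

/-- The event that iteration `k` is executed from a good state, restricted to `G`. -/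
def Reached (P : Plant n m p) (𝒟 : Measure (Fin n → ℝ)) (b : Bounds) (c : Config m p) (k : ℕ)
    (G : Set (Noise n m p)) : Set (Noise n m p) :=
  {ω | Executed P 𝒟 b c ω k} ∩ {ω | GoodState P b (state P 𝒟 b c ω k)} ∩ G

variable [IsProbabilityMeasure 𝒟] (hc : c.Admissible b d δ₀ δ₁) (H : Assumptions P 𝒟 d b c Jbar)
  {G : Set (Noise n m p)} (hG : MeasurableSet G)
  (hG' : ∀ ω ω', AgreeBefore k ω ω' → (ω ∈ G ↔ ω' ∈ G))

-- The condition on `G` says that it is decided by the iterations before `k`. Resampling iteration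
-- `k` then leaves the reached event unchanged.
omit [IsProbabilityMeasure 𝒟] in
include hG' in
lemma AgreeBefore.mem_reached_iff {ω ω' : Noise n m p} (h : AgreeBefore k ω ω') :
    ω ∈ Reached P 𝒟 b c k G ↔ ω' ∈ Reached P 𝒟 b c k G := by
  refine and_congr (and_congr h.executed_iff ?_) (hG' ω ω' h)
  rw [Set.mem_ofPred_eq, Set.mem_ofPred_eq, h.state_eq]

include hc H hG

lemma measurableSet_reached : MeasurableSet (Reached P 𝒟 b c k G) :=
  ((measurableSet_executed hc k).inter (measurableSet_goodState hc H k)).inter hG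

variable (hd : 0 < d) (hδ₀ : 0 < δ₀) (hδ₀' : δ₀ ≤ 1) (hδ₁ : 0 < δ₁) (hδ₁' : δ₁ < 1)
include hG'

include hd hδ₀ hδ₀' in
/-- Probability of an inaccurate gradient estimate. -/
lemma measure_badGrad_le (j : ℕ) :
    noiseLaw m p 𝒟 (Reached P 𝒟 b c k G ∩
        {ω | j ≤ ⌊b.iterBound m p c.ε (state P 𝒟 b c ω k).2.2⌋₊} ∩
        {ω | BadGrad P 𝒟 b c ω k (state P 𝒟 b c ω k) j}) ≤
      ENNReal.ofReal δ₀ * noiseLaw m p 𝒟 (Reached P 𝒟 b c k G ∩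
        {ω | j ≤ ⌊b.iterBound m p c.ε (state P 𝒟 b c ω k).2.2⌋₊}) := by
  have hst := measurable_state (P := P) (𝒟 := 𝒟) hc k
  have he : Function.Injective fun i : ℕ => (k, j, i) := fun i i' h => by simpa using h
  -- Only the samples of gradient step `j` in iteration `k` are renewed.
  have hagree : ∀ (ω : Noise n m p) (y : ℕ → (Fin m → Fin p → ℝ) × (Fin n → ℝ)),
      AgreeBefore k (Function.extend (fun i : ℕ => (k, j, i)) y ω.1, ω.2) ω := fun ω y l hl => by
    refine ⟨fun j' i => Function.extend_apply' _ _ _ ?_, fun i => rfl⟩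
    rintro ⟨i', hi'⟩
    simp only [Prod.mk.injEq] at hi'
    omega
  have hHm : MeasurableSet (Reached P 𝒟 b c k G ∩
        {ω | j ≤ ⌊b.iterBound m p c.ε (state P 𝒟 b c ω k).2.2⌋₊}) :=
    (measurableSet_reached hc H hG).inter (measurableSet_le measurable_const
      (Nat.measurable_floor.comp (measurable_iterBound.comp hst.snd.snd)))
  refine measure_le_of_resample (measurePreserving_resample_fst ((gaussLaw m p).prod 𝒟)
    (Measure.infinitePi fun _ : ℕ × ℕ => 𝒟) _ he) ?_ hHm ?_ ?_
  · have e : Reached P 𝒟 b c k G ∩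
        {ω | j ≤ ⌊b.iterBound m p c.ε (state P 𝒟 b c ω k).2.2⌋₊} ∩
        {ω | BadGrad P 𝒟 b c ω k (state P 𝒟 b c ω k) j} = Reached P 𝒟 b c k G ∩
        {ω | j ≤ ⌊b.iterBound m p c.ε (state P 𝒟 b c ω k).2.2⌋₊} ∩
        {ω | GoodState P b (state P 𝒟 b c ω k) ∧
          BadGrad P 𝒟 b c ω k (state P 𝒟 b c ω k) j} := by
      ext ω
      exact ⟨fun h => ⟨h.1, h.1.1.1.2, h.2⟩, fun h => ⟨h.1, h.2.2⟩⟩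
    rw [e]
    exact hHm.inter (measurableSet_badGrad hc H k j)
  · rintro ω y ⟨⟨h1, h2⟩, -⟩
    refine ⟨((hagree ω y).mem_reached_iff hG').1 h1, ?_⟩
    rwa [Set.mem_ofPred_eq, (hagree ω y).state_eq] at h2
  · rintro ω ⟨h1, -⟩
    have hgood : GoodState P b (state P 𝒟 b c ω k) := h1.1.2
    set s := state P 𝒟 b c ω k with hs
    have hν := hgood.level.level_pos
    -- The iterate is unchanged by the renewal. For fixed `ω` the estimate is thus formed at a fixed
    -- gain, and the concentration bound applies to `y`.
    have hin : ∀ y : ℕ → (Fin m → Fin p → ℝ) × (Fin n → ℝ),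
        inner P b c (Function.extend (fun i : ℕ => (k, j, i)) y ω.1, ω.2) k s j =
          inner P b c ω k s j := fun y => inner_congr fun l hl i => by
      refine Function.extend_apply' _ _ _ ?_
      rintro ⟨i', hi'⟩
      simp only [Prod.mk.injEq] at hi'
      omega
    by_cases hl : P.Level b s.2.1 (inner P b c ω k s j) s.2.2
    · refine (measure_mono ?_).trans (hl.measure_gradEst_sub_gt_le
        (hc.r_pos k s.1 s.2.1 s.2.2 hν) (H.setting hgood) hd H.eps_pos hδ₀ hδ₀' (hc.r_le k s.1 s.2.1 s.2.2 hν)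
        (hc.τe_ge k s.1 s.2.1 s.2.2 hν) (hc.Ne_ge k s.1 s.2.1 s.2.2 hν))
      rintro y ⟨-, h2⟩
      have h3 := h2.2
      rw [(hagree ω y).state_eq, ← hs, hin y, stepGrad] at h3
      simp only [he.extend_apply] at h3
      exact h3
    · refine (measure_mono_null ?_ measure_empty).trans_le zero_le
      rintro y ⟨-, h2⟩
      have h3 := h2.1
      rw [(hagree ω y).state_eq, ← hs, hin y] at h3
      exact hl h3

include hδ₁ hδ₁' in
/-- Probability of an inaccurate cost estimate. -/
lemma measure_badCost_le :
    noiseLaw m p 𝒟 (Reached P 𝒟 b c k G ∩ {ω | BadCost P 𝒟 b c ω k (state P 𝒟 b c ω k)}) ≤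
      ENNReal.ofReal δ₁ := by
  have he : Function.Injective fun i : ℕ => (k, i) := fun i i' h => by simpa using h
  have hagree : ∀ (ω : Noise n m p) (y : ℕ → Fin n → ℝ),
      AgreeBefore k (ω.1, Function.extend (fun i : ℕ => (k, i)) y ω.2) ω := fun ω y l hl => by
    refine ⟨fun j' i => rfl, fun i => Function.extend_apply' _ _ _ ?_⟩
    rintro ⟨i', hi'⟩
    simp only [Prod.mk.injEq] at hi'
    omega
  have hHm : MeasurableSet (Reached P 𝒟 b c k G) := measurableSet_reached hc H hG
  have key : noiseLaw m p 𝒟 (Reached P 𝒟 b c k G ∩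
      {ω | BadCost P 𝒟 b c ω k (state P 𝒟 b c ω k)}) ≤
      ENNReal.ofReal δ₁ * noiseLaw m p 𝒟 (Reached P 𝒟 b c k G) := by
    refine measure_le_of_resample (measurePreserving_resample_snd 𝒟
      (Measure.infinitePi fun _ : ℕ × ℕ × ℕ => (gaussLaw m p).prod 𝒟) _ he) ?_ hHm ?_ ?_
    · have e : Reached P 𝒟 b c k G ∩ {ω | BadCost P 𝒟 b c ω k (state P 𝒟 b c ω k)} =
          Reached P 𝒟 b c k G ∩ {ω | GoodState P b (state P 𝒟 b c ω k) ∧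
            BadCost P 𝒟 b c ω k (state P 𝒟 b c ω k)} := by
        ext ω
        exact ⟨fun h => ⟨h.1, h.1.1.2, h.2⟩, fun h => ⟨h.1, h.2.2⟩⟩
      rw [e]
      exact hHm.inter (measurableSet_badCost hc H k)
    · rintro ω y ⟨h1, -⟩
      exact ((hagree ω y).mem_reached_iff hG').1 h1
    · intro ω h1
      have hgood : GoodState P b (state P 𝒟 b c ω k) := h1.1.2
      set s := state P 𝒟 b c ω k with hs
      have hν := hgood.level.level_pos
      -- The gain is determined by the gradient samples alone, so all cost samples of iteration `k`
      -- are fresh for it.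
      have hgain : ∀ y : ℕ → Fin n → ℝ,
          nextGain P b c (ω.1, Function.extend (fun i : ℕ => (k, i)) y ω.2) k s =
            nextGain P b c ω k s := fun y => nextGain_congr fun j i => rfl
      by_cases hl : P.Level b s.2.1 (nextGain P b c ω k s) s.2.2
      · refine (measure_mono ?_).trans (hl.measure_costEst_le (H.setting hgood)
          (Plant.one_le_dim H.unstable) hgood.level_lt hδ₁ hδ₁'
          (hc.τ_ge k s.1 s.2.1 s.2.2 hν) hc.N_ge)
        rintro y ⟨-, h2⟩
        have h3 := h2.2
        rw [(hagree ω y).state_eq, ← hs, nextCostEst, hgain y] at h3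
        simp only [he.extend_apply] at h3
        exact h3
      · refine (measure_mono_null ?_ measure_empty).trans_le zero_le
        rintro y ⟨-, h2⟩
        have h3 := h2.1
        rw [(hagree ω y).state_eq, ← hs, hgain y] at h3
        exact hl h3
  refine key.trans (mul_le_of_le_one_right' ?_)
  have : IsProbabilityMeasure (noiseLaw m p 𝒟) := by unfold noiseLaw; infer_instance
  exact prob_le_one

end DiscountedSOF

/-! ### Union bound with a random number of estimates, and the three conclusions. -/

namespace DiscountedSOF

variable {n m p : ℕ} {P : Plant n m p} {𝒟 : Measure (Fin n → ℝ)} {d : ℝ} {b : Bounds}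
  {c : Config m p} {Jbar : ℝ} {k : ℕ} {δ₀ δ₁ : ℝ}

/-- The contribution of iteration `k` to the sum of the `M_k + 1`. -/
noncomputable def weight (P : Plant n m p) (𝒟 : Measure (Fin n → ℝ)) (b : Bounds) (c : Config m p)
    (ω : Noise n m p) (k : ℕ) : ℝ≥0∞ :=
  ENNReal.ofReal (b.iterBound m p c.ε (state P 𝒟 b c ω k).2.2 + 1)

/-- A nondecreasing budget limits the total weight of the terms that fit into it. -/
lemma sum_ite_le_of_partial_sum_le (f : ℕ → ℝ≥0∞) (S : ℝ≥0∞) (K : ℕ)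
    [∀ k, Decidable (∑ i ∈ Finset.range (k + 1), f i ≤ S)] :
    ∑ k ∈ Finset.range K, (if ∑ i ∈ Finset.range (k + 1), f i ≤ S then f k else 0) ≤
      min S (∑ k ∈ Finset.range K, f k) := by
  induction K with
  | zero => simp
  | succ K ih =>
    rw [Finset.sum_range_succ]
    obtain ⟨h1, h2⟩ := le_min_iff.1 ih
    split_ifs with h
    · have h3 : ∑ k ∈ Finset.range K, (if ∑ i ∈ Finset.range (k + 1), f i ≤ S then f k else 0) +
          f K ≤ ∑ k ∈ Finset.range (K + 1), f k := by
        rw [Finset.sum_range_succ]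
        gcongr
      exact le_min (h3.trans h) h3
    · rw [add_zero]
      refine le_min h1 (h2.trans ?_)
      rw [Finset.sum_range_succ]
      exact le_self_add

section IterBound

/-- The iteration bound is monotone in the level. -/
lemma iterBound_mono (hb : b.Valid P) (hmp : 1 ≤ min m p) {ε : ℝ} (hε : 0 < ε) {ν ν' : ℝ}
    (hν : 0 < ν) (h : ν ≤ ν') : b.iterBound m p ε ν ≤ b.iterBound m p ε ν' := by
  have h0 := hb.pos
  have hl := hb.l1_pos
  have hψ := hb.one_le_psi
  have hφ := hb.one_le_phi
  have hmp' : (0 : ℝ) < (min m p : ℕ) := by exact_mod_cast hmp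
  have hν' : 0 < ν' := hν.trans_le h
  have hκ0 : 0 < b.kappa ν := Real.sqrt_pos.2 (by positivity)
  have hκ : b.kappa ν ≤ b.kappa ν' := Real.sqrt_le_sqrt (by gcongr)
  have hκ0' : 0 < b.kappa ν' := hκ0.trans_le hκ
  have hstep0 : 0 < b.step m p ε ν' := by
    unfold Bounds.step Bounds.rad Bounds.gradBound Bounds.smooth
    exact lt_min (by positivity) (by positivity)
  have hstep : b.step m p ε ν' ≤ b.step m p ε ν := by
    unfold Bounds.step Bounds.rad Bounds.gradBound Bounds.smooth
    gcongr
  unfold Bounds.iterBound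
  gcongr

end IterBound

variable [IsProbabilityMeasure 𝒟] (hc : c.Admissible b d δ₀ δ₁) (H : Assumptions P 𝒟 d b c Jbar)
  (hd : 0 < d) (hδ₀ : 0 < δ₀) (hδ₀' : δ₀ ≤ 1) (hδ₁ : 0 < δ₁) (hδ₁' : δ₁ < 1)
  {G : ℕ → Set (Noise n m p)} (hG : ∀ k, MeasurableSet (G k))
  (hG' : ∀ k ω ω', AgreeBefore k ω ω' → (ω ∈ G k ↔ ω' ∈ G k))

omit [IsProbabilityMeasure 𝒟] in
include hc in
lemma measurable_weight (k : ℕ) : Measurable fun ω : Noise n m p => weight P 𝒟 b c ω k :=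
  ((measurable_iterBound.comp (measurable_state hc k).snd.snd).add_const 1).ennreal_ofReal

include hc H hd hδ₀ hδ₀' hG hG' in
/-- Probability of an inaccurate gradient estimate in iteration `k`. -/
lemma measure_exists_badGrad_le (k : ℕ) :
    noiseLaw m p 𝒟 (Reached P 𝒟 b c k (G k) ∩
        {ω | ∃ j ≤ ⌊b.iterBound m p c.ε (state P 𝒟 b c ω k).2.2⌋₊,
          BadGrad P 𝒟 b c ω k (state P 𝒟 b c ω k) j}) ≤
      ENNReal.ofReal δ₀ * ∫⁻ ω, (Reached P 𝒟 b c k (G k)).indicator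
        (fun ω => weight P 𝒟 b c ω k) ω ∂noiseLaw m p 𝒟 := by
  have hst := measurable_state (P := P) (𝒟 := 𝒟) hc k
  set M : Noise n m p → ℕ := fun ω => ⌊b.iterBound m p c.ε (state P 𝒟 b c ω k).2.2⌋₊ with hM
  have hMm : Measurable M := Nat.measurable_floor.comp (measurable_iterBound.comp hst.snd.snd)
  have hR := measurableSet_reached (k := k) hc H (hG k)
  have hRj : ∀ j, MeasurableSet (Reached P 𝒟 b c k (G k) ∩ {ω | j ≤ M ω}) := fun j =>
    hR.inter (measurableSet_le measurable_const hMm)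
  calc _ ≤ noiseLaw m p 𝒟 (⋃ j, (Reached P 𝒟 b c k (G k) ∩ {ω | j ≤ M ω} ∩
        {ω | BadGrad P 𝒟 b c ω k (state P 𝒟 b c ω k) j})) := by
        refine measure_mono ?_
        rintro ω ⟨h1, j, hj, h2⟩
        exact Set.mem_iUnion.2 ⟨j, ⟨h1, hj⟩, h2⟩
    _ ≤ ∑' j, noiseLaw m p 𝒟 (Reached P 𝒟 b c k (G k) ∩ {ω | j ≤ M ω} ∩
        {ω | BadGrad P 𝒟 b c ω k (state P 𝒟 b c ω k) j}) := measure_iUnion_le _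
    _ ≤ ∑' j, ENNReal.ofReal δ₀ *
          noiseLaw m p 𝒟 (Reached P 𝒟 b c k (G k) ∩ {ω | j ≤ M ω}) :=
        ENNReal.tsum_le_tsum fun j => measure_badGrad_le hc H (hG k) (hG' k) hd hδ₀ hδ₀' j
    -- Exchanging sum and integral counts the admissible steps: for each `ω` there are `⌊M⌋ + 1`
    -- indices `j ≤ M`, which is at most the weight `M + 1`.
    _ = ENNReal.ofReal δ₀ * ∫⁻ ω, ∑' j, (Reached P 𝒟 b c k (G k) ∩ {ω | j ≤ M ω}).indicator
          (fun _ => 1) ω ∂noiseLaw m p 𝒟 := by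
        rw [ENNReal.tsum_mul_left, lintegral_tsum fun j =>
          (measurable_const.indicator (hRj j)).aemeasurable]
        simp only [lintegral_indicator_const (hRj _), one_mul]
    _ ≤ _ := by
        gcongr with ω
        by_cases hω : ω ∈ Reached P 𝒟 b c k (G k)
        · rw [Set.indicator_of_mem hω]
          have hgood : GoodState P b (state P 𝒟 b c ω k) := hω.1.2
          have hM0 := hgood.level.iterBound_pos H.eps_pos H.dim_pos
          rw [tsum_eq_sum (s := Finset.range (M ω + 1)) fun j hj =>
            Set.indicator_of_notMem (fun h => hj (Finset.mem_range.2 (Nat.lt_succ_of_le h.2))) _]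
          refine (Finset.sum_le_card_nsmul _ _ (1 : ℝ≥0∞) fun j _ => ?_).trans ?_
          · exact Set.indicator_apply_le' (fun _ => le_rfl) fun _ => zero_le
          rw [Finset.card_range, nsmul_eq_mul, mul_one, weight, ← ENNReal.ofReal_natCast]
          refine ENNReal.ofReal_le_ofReal ?_
          push_cast
          gcongr
          exact Nat.floor_le hM0.le
        · rw [Set.indicator_of_notMem hω]
          refine (ENNReal.tsum_eq_zero.2 fun j => ?_).le
          exact Set.indicator_of_notMem (fun h => hω h.1) _

include hc H hd hδ₀ hδ₀' hδ₁ hδ₁' hG hG' in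
/-- Union bound over the outer iterations. -/
lemma measure_failure_le {k' : ℕ} (hk' : k' = outerBound c.γ₀ c.ζ b.ℓ₀ Jbar)
    {F : Set (Noise n m p)} (hF : ∀ ω ∈ F, ¬ Succeeds P 𝒟 b c k' ω)
    (hFG : ∀ ω ∈ F, ∀ k < k', Executed P 𝒟 b c ω k → GoodState P b (state P 𝒟 b c ω k) →
      (state P 𝒟 b c ω k).2.2 ≤
        max (P.cost 𝒟 c.γ₀ 0) (27 * Jbar ^ 3 / ((1 - c.ζ) * b.ℓ₀ ^ 2)) → ω ∈ G k) :
    noiseLaw m p 𝒟 F ≤ ENNReal.ofReal (k' * δ₁) + ENNReal.ofReal δ₀ *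
      ∫⁻ ω, ∑ k ∈ Finset.range k', (Reached P 𝒟 b c k (G k)).indicator
        (fun ω => weight P 𝒟 b c ω k) ω ∂noiseLaw m p 𝒟 := by
  classical
  have hsub : F ⊆ ⋃ k ∈ Finset.range k', ((Reached P 𝒟 b c k (G k) ∩
        {ω | ∃ j ≤ ⌊b.iterBound m p c.ε (state P 𝒟 b c ω k).2.2⌋₊,
          BadGrad P 𝒟 b c ω k (state P 𝒟 b c ω k) j}) ∪
      (Reached P 𝒟 b c k (G k) ∩ {ω | BadCost P 𝒟 b c ω k (state P 𝒟 b c ω k)})) := by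
    intro ω hω
    -- The iteration with the bad estimate is executed from a good state, and `hFG` places `ω` in `G
    -- k`.
    obtain ⟨k, hk, s, h1, h2, h3, h4⟩ := H.exists_bad hk' (hF ω hω)
    rw [run_eq] at h1
    split_ifs at h1 with hex
    obtain rfl : state P 𝒟 b c ω k = s := Option.some.inj h1
    have hR : ω ∈ Reached P 𝒟 b c k (G k) := ⟨⟨hex, h2⟩, hFG ω hω k hk hex h2 h3⟩
    exact Set.mem_biUnion (Finset.mem_coe.2 (Finset.mem_range.2 hk))
      (h4.imp (fun h => ⟨hR, h⟩) fun h => ⟨hR, h⟩)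
  calc _ ≤ ∑ k ∈ Finset.range k', (ENNReal.ofReal δ₀ * ∫⁻ ω, (Reached P 𝒟 b c k (G k)).indicator
        (fun ω => weight P 𝒟 b c ω k) ω ∂noiseLaw m p 𝒟 + ENNReal.ofReal δ₁) := by
        refine (measure_mono hsub).trans ((measure_biUnion_finset_le _ _).trans
          (Finset.sum_le_sum fun k _ => (measure_union_le _ _).trans (add_le_add ?_ ?_)))
        · exact measure_exists_badGrad_le hc H hd hδ₀ hδ₀' hG hG' k
        · exact measure_badCost_le hc H (hG k) (hG' k) hδ₁ hδ₁'
    _ = _ := by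
        rw [Finset.sum_add_distrib, Finset.sum_const, Finset.card_range, ← Finset.mul_sum, add_comm,
          nsmul_eq_mul, ENNReal.ofReal_mul (by positivity), ENNReal.ofReal_natCast,
          lintegral_finsetSum _ fun k _ =>
            (measurable_weight hc k).indicator (measurableSet_reached hc H (hG k))]

omit [IsProbabilityMeasure 𝒟] in
open Classical in
lemma iterSum_eq (k' : ℕ) (ω : Noise n m p) : iterSum P 𝒟 b c k' ω =
    ∑ k ∈ Finset.range (k' + 1), if Executed P 𝒟 b c ω k then weight P 𝒟 b c ω k else 0 := by
  refine Finset.sum_congr rfl fun k _ => ?_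
  rw [run_eq]
  split_ifs <;> rfl

-- Taking `G k` to be everything bounds the integrand by the full sum of weights of executed
-- iterations.
open Classical in
theorem measure_not_succeeds_le (hc : c.Admissible b d δ₀ δ₁) (H : Assumptions P 𝒟 d b c Jbar)
    (hd : 0 < d) (hδ₀ : 0 < δ₀) (hδ₀' : δ₀ ≤ 1) (hδ₁ : 0 < δ₁) (hδ₁' : δ₁ < 1)
    {k' : ℕ} (hk' : k' = outerBound c.γ₀ c.ζ b.ℓ₀ Jbar) :
    noiseLaw m p 𝒟 {ω | ¬ Succeeds P 𝒟 b c k' ω} ≤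
        ENNReal.ofReal (k' * δ₁) + ENNReal.ofReal δ₀ *
          ∫⁻ ω, iterSum P 𝒟 b c k' ω ∂(noiseLaw m p 𝒟) := by
  refine (measure_failure_le (G := fun _ => Set.univ) hc H hd hδ₀ hδ₀' hδ₁ hδ₁'
    (fun _ => MeasurableSet.univ) (fun _ _ _ _ => Iff.rfl) hk' (fun ω hω => hω)
    fun _ _ _ _ _ _ _ => Set.mem_univ _).trans ?_
  gcongr with ω
  rw [iterSum_eq, Finset.sum_range_succ]
  refine le_add_right (Finset.sum_le_sum fun k _ => ?_)
  rw [Set.indicator_apply]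
  split_ifs with h1 h2
  · exact le_rfl
  · exact absurd h1.1.1 h2
  · exact zero_le
  · exact le_rfl

-- `G k` is the event that the weights of the executed iterations up to and including `k` are within
-- the budget `S`. It is known at the start of iteration `k` because `ν_k` is, and it contains every
-- run whose total is at most `S`.
open Classical in
theorem measure_not_succeeds_and_le (hc : c.Admissible b d δ₀ δ₁)
    (H : Assumptions P 𝒟 d b c Jbar) (hd : 0 < d) (hδ₀ : 0 < δ₀) (hδ₀' : δ₀ ≤ 1) (hδ₁ : 0 < δ₁)
    (hδ₁' : δ₁ < 1) {k' : ℕ} (hk' : k' = outerBound c.γ₀ c.ζ b.ℓ₀ Jbar) (S : ℝ≥0∞) :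
    noiseLaw m p 𝒟 {ω | ¬ Succeeds P 𝒟 b c k' ω ∧ iterSum P 𝒟 b c k' ω ≤ S} ≤
      ENNReal.ofReal (k' * δ₁) + ENNReal.ofReal δ₀ * S := by
  let f : Noise n m p → ℕ → ℝ≥0∞ := fun ω k =>
    if Executed P 𝒟 b c ω k then weight P 𝒟 b c ω k else 0
  have hf : ∀ k, Measurable fun ω => f ω k := fun k =>
    Measurable.ite (measurableSet_executed hc k) (measurable_weight hc k) measurable_const
  have hprob : IsProbabilityMeasure (noiseLaw m p 𝒟) := by unfold noiseLaw; infer_instance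
  refine (measure_failure_le (G := fun k => {ω | ∑ i ∈ Finset.range (k + 1), f ω i ≤ S}) hc H hd
    hδ₀ hδ₀' hδ₁ hδ₁' (fun k => measurableSet_le (Finset.measurable_sum _ fun i _ => hf i)
    measurable_const) (fun k ω ω' h => ?_) hk' (fun ω hω => hω.1) fun ω hω k hk _ _ _ => ?_).trans ?_
  · have : ∑ i ∈ Finset.range (k + 1), f ω i = ∑ i ∈ Finset.range (k + 1), f ω' i := by
      refine Finset.sum_congr rfl fun i hi => ?_
      have hi' := h.mono (Nat.lt_succ_iff.1 (Finset.mem_range.1 hi))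
      simp only [f, weight, hi'.state_eq, hi'.executed_iff]
    rw [Set.mem_ofPred_eq, Set.mem_ofPred_eq, this]
  · have h1 : iterSum P 𝒟 b c k' ω ≤ S := hω.2
    rw [iterSum_eq] at h1
    exact (Finset.sum_le_sum_of_subset (Finset.range_mono (by omega))).trans h1
  · gcongr
    -- For every `ω` the iterations that fit into the budget have total weight at most `S`, so the
    -- random sum is replaced by a constant.
    calc _ ≤ ∫⁻ _ω, S ∂noiseLaw m p 𝒟 := by
          refine lintegral_mono fun ω => ?_
          refine le_trans (Finset.sum_le_sum fun k _ => ?_)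
            ((sum_ite_le_of_partial_sum_le (f ω) S k').trans (min_le_left _ _))
          rw [Set.indicator_apply]
          split_ifs with h1 h2
          · exact (if_pos h1.1.1).ge
          · exact absurd h1.2 h2
          · exact zero_le
          · exact le_rfl
      _ = S := by simp

/-- `G k` is the event `ν_k ≤ νbar`, which `exists_bad` guarantees at the first failure. By
monotonicity of the iteration bound, each of the `k'` weights is then at most the uniform one. -/
theorem measure_not_succeeds_le_uniform (hc : c.Admissible b d δ₀ δ₁)
    (H : Assumptions P 𝒟 d b c Jbar) (hd : 0 < d) (hδ₀ : 0 < δ₀) (hδ₀' : δ₀ ≤ 1) (hδ₁ : 0 < δ₁)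
    (hδ₁' : δ₁ < 1) {k' : ℕ} (hk' : k' = outerBound c.γ₀ c.ζ b.ℓ₀ Jbar) :
    noiseLaw m p 𝒟 {ω | ¬ Succeeds P 𝒟 b c k' ω} ≤ ENNReal.ofReal (k' * (δ₁ +
      (b.iterBound m p c.ε (max (P.cost 𝒟 c.γ₀ 0) (27 * Jbar ^ 3 / ((1 - c.ζ) * b.ℓ₀ ^ 2))) + 1) *
        δ₀)) := by
  set νbar := max (P.cost 𝒟 c.γ₀ 0) (27 * Jbar ^ 3 / ((1 - c.ζ) * b.ℓ₀ ^ 2)) with hν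
  have hprob : IsProbabilityMeasure (noiseLaw m p 𝒟) := by unfold noiseLaw; infer_instance
  refine (measure_failure_le (G := fun k => {ω | (state P 𝒟 b c ω k).2.2 ≤ νbar}) hc H hd
    hδ₀ hδ₀' hδ₁ hδ₁' (fun k => measurableSet_le (measurable_state hc k).snd.snd
    measurable_const) (fun k ω ω' h => ?_) hk' (fun ω hω => hω) fun ω _ k _ _ _ h => h).trans ?_
  · rw [Set.mem_ofPred_eq, Set.mem_ofPred_eq, h.state_eq]
  · have hM : 0 ≤ b.iterBound m p c.ε νbar := by
      have h1 := H.goodState_zero.level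
      have h2 := (h1.iterBound_pos H.eps_pos H.dim_pos).le
      exact h2.trans (iterBound_mono H.valid H.dim_pos H.eps_pos h1.level_pos (le_max_left _ _))
    have h1 : ∫⁻ ω, ∑ k ∈ Finset.range k',
        (Reached P 𝒟 b c k {ω | (state P 𝒟 b c ω k).2.2 ≤ νbar}).indicator
          (fun ω => weight P 𝒟 b c ω k) ω ∂noiseLaw m p 𝒟 ≤
        ENNReal.ofReal (k' * (b.iterBound m p c.ε νbar + 1)) := by
      calc _ ≤ ∫⁻ _ω, ENNReal.ofReal (k' * (b.iterBound m p c.ε νbar + 1)) ∂noiseLaw m p 𝒟 := by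
            refine lintegral_mono fun ω => ?_
            refine (Finset.sum_le_card_nsmul _ _
              (ENNReal.ofReal (b.iterBound m p c.ε νbar + 1)) fun k _ => ?_).trans_eq ?_
            · refine Set.indicator_apply_le' (fun h => ENNReal.ofReal_le_ofReal ?_)
                fun _ => zero_le
              have hg : GoodState P b (state P 𝒟 b c ω k) := h.1.2
              have := iterBound_mono H.valid H.dim_pos H.eps_pos hg.level.level_pos h.2
              linarith
            · rw [Finset.card_range, nsmul_eq_mul, ENNReal.ofReal_mul (by positivity),
                ENNReal.ofReal_natCast]
        _ = _ := by simp
    calc _ ≤ ENNReal.ofReal (k' * δ₁) + ENNReal.ofReal δ₀ *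
          ENNReal.ofReal (k' * (b.iterBound m p c.ε νbar + 1)) := by gcongr
      _ = _ := by
          rw [← ENNReal.ofReal_mul hδ₀.le, ← ENNReal.ofReal_add (by positivity) (by positivity)]
          congr 1
          ring

end DiscountedSOF

theorem theorem2 {n m p : ℕ} (P : DiscountedSOF.Plant n m p)
    (𝒟 : Measure (Fin n → ℝ)) [IsProbabilityMeasure 𝒟] (d : ℝ) (hd : 0 < d)
    (h𝒟 : DiscountedSOF.IsInitialLaw 𝒟 d)
    (hunstable : 1 ≤ DiscountedSOF.specRad P.A)
    (hstab : ∃ K, DiscountedSOF.specRad (P.closedLoop K) < 1)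
    (b : DiscountedSOF.Bounds) (hb : b.Valid P)
    (δ₀ δ₁ : ℝ) (hδ₀ : 0 < δ₀) (hδ₀' : δ₀ < Real.exp (-2) / 2) (hδ₁ : 0 < δ₁) (hδ₁' : δ₁ < 1)
    (c : DiscountedSOF.Config m p) (hε : 0 < c.ε) (hζ : 0 < c.ζ) (hζ' : c.ζ < 1)
    (hγ₀ : 0 < c.γ₀) (hγ₀' : c.γ₀ < 1 / DiscountedSOF.specRad P.A ^ 2)
    (hc : c.Admissible b d δ₀ δ₁)
    (Jbar : ℝ)
    (hJbar : ∀ γ : ℝ, 0 < γ → γ ≤ 1 → ∀ K ∈ P.stabSet γ,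
      ‖P.costGrad 𝒟 γ K‖ ≤ c.ε → P.cost 𝒟 γ K ≤ Jbar)
    (k' : ℕ) (hk' : k' = DiscountedSOF.outerBound c.γ₀ c.ζ b.ℓ₀ Jbar) :
    -- failure probability bounded through the expectation of the random sum of the `M_k + 1`
    DiscountedSOF.noiseLaw m p 𝒟 {ω | ¬ DiscountedSOF.Succeeds P 𝒟 b c k' ω} ≤
        ENNReal.ofReal (k' * δ₁) + ENNReal.ofReal δ₀ *
          ∫⁻ ω, DiscountedSOF.iterSum P 𝒟 b c k' ω ∂(DiscountedSOF.noiseLaw m p 𝒟) ∧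
    -- the same through the realized value of that sum, at every level `S`
    (∀ S : ℝ≥0∞, DiscountedSOF.noiseLaw m p 𝒟
        {ω | ¬ DiscountedSOF.Succeeds P 𝒟 b c k' ω ∧ DiscountedSOF.iterSum P 𝒟 b c k' ω ≤ S} ≤
        ENNReal.ofReal (k' * δ₁) + ENNReal.ofReal δ₀ * S) ∧
    -- the same with the uniform bound on the `M_k`
    DiscountedSOF.noiseLaw m p 𝒟 {ω | ¬ DiscountedSOF.Succeeds P 𝒟 b c k' ω} ≤
      ENNReal.ofReal (k' * (δ₁ +
        (b.iterBound m p c.ε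
          (max (P.cost 𝒟 c.γ₀ 0) (27 * Jbar ^ 3 / ((1 - c.ζ) * b.ℓ₀ ^ 2))) + 1) * δ₀)) := by
  have hδ : δ₀ ≤ 1 := by
    have : Real.exp (-2) ≤ 1 := Real.exp_le_one_iff.2 (by norm_num)
    linarith
  have H : DiscountedSOF.Assumptions P 𝒟 d b c Jbar :=
    ⟨hb, h𝒟, hunstable, DiscountedSOF.Plant.one_le_min_of_stabilizable hunstable hstab, hε, hζ,
      hζ', hγ₀, hγ₀', hJbar⟩
  exact ⟨DiscountedSOF.measure_not_succeeds_le hc H hd hδ₀ hδ hδ₁ hδ₁' hk',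
    DiscountedSOF.measure_not_succeeds_and_le hc H hd hδ₀ hδ hδ₁ hδ₁' hk',
    DiscountedSOF.measure_not_succeeds_le_uniform hc H hd hδ₀ hδ hδ₁ hδ₁' hk'⟩
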